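/- Formulas in negation normal form (NNF) are built from literals (propositional variables and their negations) by conjunctions $\{\wedge\ \varphi_1\ldots\varphi_k\}$ and disjunctions $(\vee\ \varphi_1\ldots\varphi_k)$ with $k\ge 1$ arguments; they contain no truth constants. An NNF formula is negative if all its literals are negative. An NNF formula is Horn-NNF (HNF) if every disjunction occurring in it has any number of negative disjuncts and at most one non-negative disjunct. HNF-SAT is the problem of testing the satisfiability of HNF formulas, i.e. the set of all words, over a fixed finite alphabet, that encode a satisfiable HNF formula (variables being named by binary strings). Proposition. HNF-SAT is P-complete: it is decided by a deterministic Turing machine in polynomial time, and every language over a finite alphabet that is decided by a deterministic Turing machine in polynomial time is many-one reducible to HNF-SAT by a function that is computable in logarithmic space. -/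

import Mathlib

/-! ### Turing machines with a read-only input tape, work tapes and a write-only output tape -/

/-- The possible moves of a head in one step. -/
inductive Move
  | left
  | stay
  | right

/-- The displacement of a head on a two-way infinite tape. -/
def Move.toInt : Move → ℤ
  | .left => -1
  | .stay => 0
  | .right => 1

/-- The effect of one step: the new state, the move of the input head, the symbols written on the
work tapes, the moves of the work heads, and the symbol (if any) appended to the output. -/
structure TMAction (State Γ ι β : Type) where
  next : State
  inputMove : Move
  write : ι → Γ
  move : ι → Move
  emit : Option β

/-- A deterministic Turing machine with input alphabet `α` and output alphabet `β`.
It has a two-way read-only input tape, finitely many two-way infinite work tapes (indexed by `ι`)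
over a finite alphabet `Γ`, and a one-way write-only output tape. The transition function sees the
state, the scanned input symbol (`none` is the end marker) and the scanned work symbols;
the value `none` means that the machine halts. -/
structure TM (α β : Type) where
  State : Type
  [finiteState : Finite State]
  Γ : Type
  [finiteΓ : Finite Γ]
  ι : Type
  [finiteι : Finite ι]
  blank : Γ
  start : State
  accept : Set State
  δ : State → Option α → (ι → Γ) → Option (TMAction State Γ ι β)

namespace TM

variable {α β : Type}

/-- Configurations. Cell `0` of the input tape holds the left end marker, cells `1, …, |w|` hold
the input word `w`, and cell `|w| + 1` holds the right end marker. -/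
structure Cfg (M : TM α β) where
  state : M.State
  inputHead : ℕ
  head : M.ι → ℤ
  tape : M.ι → ℤ → M.Γ
  out : List β

/-- The content of a cell of the input tape; `none` is the end marker. -/
def readInput (w : List α) : ℕ → Option α
  | 0 => none
  | p + 1 => w[p]?

/-- The move of the input head, which never leaves the cells `0, …, n + 1`, where `n = |w|`. -/
def moveInput (n p : ℕ) : Move → ℕ
  | .left => p - 1
  | .stay => p
  | .right => min (p + 1) (n + 1)

/-- The initial configuration: all work tapes are blank, and the input head is on the left end
marker. -/
def init (M : TM α β) : M.Cfg where
  state := M.start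
  inputHead := 0
  head := fun _ => 0
  tape := fun _ _ => M.blank
  out := []

/-- What the transition function prescribes in a configuration on input `w`. -/
def action (M : TM α β) (w : List α) (c : M.Cfg) : Option (TMAction M.State M.Γ M.ι β) :=
  M.δ c.state (readInput w c.inputHead) (fun i => c.tape i (c.head i))

/-- A configuration is halted when no transition applies. -/
def Halted (M : TM α β) (w : List α) (c : M.Cfg) : Prop :=
  M.action w c = none

/-- One step of the machine on input `w`; a halted configuration stays as it is. -/
def step (M : TM α β) (w : List α) (c : M.Cfg) : M.Cfg :=
  match M.action w c with
  | none => c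
  | some a =>
    { state := a.next
      inputHead := moveInput w.length c.inputHead a.inputMove
      head := fun i => c.head i + (a.move i).toInt
      tape := fun i => Function.update (c.tape i) (c.head i) (a.write i)
      out := c.out ++ a.emit.toList }

/-- The configuration after `t` steps on input `w`. -/
def cfgAt (M : TM α β) (w : List α) (t : ℕ) : M.Cfg :=
  (M.step w)^[t] M.init

/-- `M` decides `L`, and halts on every input of length `n` after at most `T n` steps. -/
def DecidesInTime (M : TM α β) (L : Language α) (T : ℕ → ℕ) : Prop :=
  ∀ w : List α,
    M.Halted w (M.cfgAt w (T w.length)) ∧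
      ((M.cfgAt w (T w.length)).state ∈ M.accept ↔ w ∈ L)

/-- `M` halts on every input `w` with output `f w`, and its work heads stay in the cells
`-S |w|, …, S |w|` of the work tapes. Neither the input tape nor the output tape counts as work
space. -/
def ComputesInSpace (M : TM α β) (f : List α → List β) (S : ℕ → ℕ) : Prop :=
  ∀ w : List α,
    (∃ t, M.Halted w (M.cfgAt w t) ∧ (M.cfgAt w t).out = f w) ∧
      ∀ t i, |(M.cfgAt w t).head i| ≤ (S w.length : ℤ)

end TM

/-! ### The class P, logarithmic-space reductions and P-completeness -/

/-- `L` is in P: a deterministic Turing machine decides it in polynomial time. -/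
def InP {α : Type} [Finite α] (L : Language α) : Prop :=
  ∃ (M : TM α Empty) (p : Polynomial ℕ), M.DecidesInTime L (fun n => p.eval n)

/-- `f` is computable in logarithmic space, i.e. in space `O(log n)`. -/
def LogSpaceComputable {α β : Type} [Finite α] [Finite β] (f : List α → List β) : Prop :=
  ∃ (M : TM α β) (c : ℕ), M.ComputesInSpace f (fun n => c * (Nat.log 2 n + 1))

/-- `L` is many-one reducible to `L'` in logarithmic space. -/
def LogSpaceReducible {α β : Type} [Finite α] [Finite β]
    (L : Language α) (L' : Language β) : Prop :=
  ∃ f : List α → List β, LogSpaceComputable f ∧ ∀ w, w ∈ L ↔ f w ∈ L'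

/-- `L'` is P-complete: it is in P, and every language in P, over any finite alphabet, is many-one
reducible to it in logarithmic space. -/
def PComplete {β : Type} [Finite β] (L' : Language β) : Prop :=
  InP L' ∧ ∀ (α : Type) [Finite α] (L : Language α), InP L → LogSpaceReducible L L'

/-! ### Formulas in negation normal form and Horn-NNF formulas -/

/-- Propositional variables are named by binary strings. -/
abbrev PVar : Type := List Bool

/-- Constant-free formulas in negation normal form: literals (`lit true x` is the positive literal
`x`, and `lit false x` is its negation), conjunctions and disjunctions of `k + 1 ≥ 1` formulas. -/
inductive NNF
  | lit (sign : Bool) (x : PVar)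
  | conj {k : ℕ} (φ : Fin (k + 1) → NNF)
  | disj {k : ℕ} (φ : Fin (k + 1) → NNF)

namespace NNF

/-- The formula is true under the interpretation `v` of the propositional variables. -/
def Holds (v : PVar → Bool) : NNF → Prop
  | lit s x => v x = s
  | conj φ => ∀ i, (φ i).Holds v
  | disj φ => ∃ i, (φ i).Holds v

/-- The formula has a model. -/
def Satisfiable (φ : NNF) : Prop :=
  ∃ v, φ.Holds v

/-- Negative formulas: all literals are negative. -/
def IsNegative : NNF → Prop
  | lit s _ => s = false
  | conj φ => ∀ i, (φ i).IsNegative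
  | disj φ => ∀ i, (φ i).IsNegative

/-- Horn-NNF formulas: every disjunction that occurs in the formula, at any depth, has at most one
non-negative disjunct. -/
def IsHNF : NNF → Prop
  | lit _ _ => True
  | conj φ => ∀ i, (φ i).IsHNF
  | disj φ =>
    (∀ i, (φ i).IsHNF) ∧ ∀ i j, ¬ (φ i).IsNegative → ¬ (φ j).IsNegative → i = j

/-- The alphabet in which formulas are written. -/
inductive Symb
  | andOpen
  | andClose
  | orOpen
  | orClose
  | sign (s : Bool)
  | bit (b : Bool)
  | endMark
  deriving DecidableEq, Fintype

/-- The formula as a word, in prefix notation: `{∧ φ₁ … φₖ}`, `(∨ φ₁ … φₖ)`, and for a literal its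
sign, the name of its variable and an end mark. -/
def encode : NNF → List Symb
  | lit s x => .sign s :: (x.map .bit ++ [.endMark])
  | conj φ => .andOpen :: ((List.ofFn fun i => (φ i).encode).flatten ++ [.andClose])
  | disj φ => .orOpen :: ((List.ofFn fun i => (φ i).encode).flatten ++ [.orClose])

/-- No encoding of a formula starts with a closing symbol. -/
theorem encode_head (φ : NNF) :
    ∃ a l, φ.encode = a :: l ∧ a ≠ .andClose ∧ a ≠ .orClose := by
  cases φ <;> simp [encode]

theorem bits_append_inj : ∀ (x y : PVar) (s t : List Symb),
    x.map Symb.bit ++ .endMark :: s = y.map Symb.bit ++ .endMark :: t → x = y ∧ s = t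
  | [], [], s, t, h => by simpa using h
  | [], b :: y, s, t, h => by simp at h
  | a :: x, [], s, t, h => by simp at h
  | a :: x, b :: y, s, t, h => by
    simp only [List.map_cons, List.cons_append, List.cons.injEq, Symb.bit.injEq] at h
    obtain ⟨rfl, h⟩ := h
    obtain ⟨rfl, rfl⟩ := bits_append_inj x y s t h
    exact ⟨rfl, rfl⟩

theorem flatten_append_inj (c : Symb) (hc : c = .andClose ∨ c = .orClose) :
    ∀ (l l' : List NNF) (s t : List Symb),
    (∀ φ ∈ l, ∀ (ψ : NNF) (s t : List Symb),
      φ.encode ++ s = ψ.encode ++ t → φ = ψ ∧ s = t) →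
    (l.map encode).flatten ++ c :: s = (l'.map encode).flatten ++ c :: t → l = l' ∧ s = t
  | [], [], s, t, _, h => by simpa using h
  | [], ψ :: l', s, t, _, h => by
    obtain ⟨a, m, hm, h1, h2⟩ := encode_head ψ
    simp only [List.map_nil, List.flatten_nil, List.nil_append, List.map_cons, List.flatten_cons,
      hm, List.cons_append, List.cons.injEq] at h
    grind
  | φ :: l, [], s, t, _, h => by
    obtain ⟨a, m, hm, h1, h2⟩ := encode_head φ
    simp only [List.map_nil, List.flatten_nil, List.nil_append, List.map_cons, List.flatten_cons,
      hm, List.cons_append, List.cons.injEq] at h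
    grind
  | φ :: l, ψ :: l', s, t, ih, h => by
    simp only [List.map_cons, List.flatten_cons, List.append_assoc] at h
    obtain ⟨rfl, h1⟩ := ih φ (by simp) ψ _ _ h
    obtain ⟨rfl, rfl⟩ :=
      flatten_append_inj c hc l l' s t (fun χ hχ => ih χ (List.mem_cons_of_mem _ hχ)) h1
    exact ⟨rfl, rfl⟩

theorem encode_append_inj (φ ψ : NNF) (s t : List Symb)
    (h : φ.encode ++ s = ψ.encode ++ t) : φ = ψ ∧ s = t := by
  induction φ generalizing ψ s t with
  | lit a x =>
    cases ψ with
    | lit b y =>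
      simp only [encode, List.cons_append, List.append_assoc, List.nil_append, List.cons.injEq,
        Symb.sign.injEq] at h
      obtain ⟨rfl, h⟩ := h
      obtain ⟨rfl, rfl⟩ := bits_append_inj x y s t h
      exact ⟨rfl, rfl⟩
    | conj ψ => simp [encode] at h
    | disj ψ => simp [encode] at h
  | conj φ ih =>
    cases ψ with
    | lit b y => simp [encode] at h
    | disj ψ => simp [encode] at h
    | conj ψ =>
      simp only [encode, List.cons_append, List.append_assoc, List.nil_append, List.cons.injEq,
        true_and] at h
      have e : ∀ {k : ℕ} (χ : Fin (k + 1) → NNF),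
          (List.ofFn fun i => (χ i).encode) = (List.ofFn χ).map encode := by
        intro k χ; rw [List.map_ofFn]; rfl
      rw [e, e] at h
      obtain ⟨h1, rfl⟩ := flatten_append_inj _ (Or.inl rfl) _ _ s t
        (by intro χ hχ; obtain ⟨i, rfl⟩ := (List.mem_ofFn' _ _).1 hχ; exact ih i) h
      have hk := congrArg List.length h1
      simp only [List.length_ofFn, Nat.add_right_cancel_iff] at hk
      subst hk
      exact ⟨by rw [List.ofFn_injective h1], rfl⟩
  | disj φ ih =>
    cases ψ with
    | lit b y => simp [encode] at h
    | conj ψ => simp [encode] at h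
    | disj ψ =>
      simp only [encode, List.cons_append, List.append_assoc, List.nil_append, List.cons.injEq,
        true_and] at h
      have e : ∀ {k : ℕ} (χ : Fin (k + 1) → NNF),
          (List.ofFn fun i => (χ i).encode) = (List.ofFn χ).map encode := by
        intro k χ; rw [List.map_ofFn]; rfl
      rw [e, e] at h
      obtain ⟨h1, rfl⟩ := flatten_append_inj _ (Or.inr rfl) _ _ s t
        (by intro χ hχ; obtain ⟨i, rfl⟩ := (List.mem_ofFn' _ _).1 hχ; exact ih i) h
      have hk := congrArg List.length h1
      simp only [List.length_ofFn, Nat.add_right_cancel_iff] at hk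
      subst hk
      exact ⟨by rw [List.ofFn_injective h1], rfl⟩

/-- Different formulas are written as different words, so that every word encodes at most one
formula. -/
theorem encode_injective : Function.Injective encode := fun φ ψ h =>
  (encode_append_inj φ ψ [] [] (by rw [h])).1

end NNF

/-- The decision problem HNF-SAT: the set of all words that encode a satisfiable Horn-NNF
formula. -/
def HNFSAT : Language NNF.Symb :=
  {w | ∃ φ : NNF, φ.IsHNF ∧ φ.Satisfiable ∧ φ.encode = w}

/-! Membership in P. Truth values are attached to occurrences of literals, not to variables: a
marking `m` gives each literal, located by its position in the code, a value, and `NNF.ev` evaluates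
the formula from these. The value is monotone in the marks, since negations occur only in literals.
Initially all marks are true. The invariant `NNF.SoundMarks` says that positive literals are marked
true and that a negative literal is marked false only if its variable is true in every model. If
turning a single positive occurrence of `x` to false makes the value false, then `x` is true in
every model (`NNF.SoundMarks.consequence`), so all negative occurrences of `x` may be marked false.
Once nothing changes, the formula is satisfiable iff its value is true (`NNF.satisfiable_iff_ev`):
the interpretation that makes exactly the derived variables true is a model. Here the Horn condition
enters (`NNF.exists_ev_eq_false`): in a false disjunction the negative disjuncts already have value
false, so the failure can be traced through the one remaining disjunct, and at most one positive
literal has to be blamed. Every effective round lowers a mark, so linearly many rounds suffice. A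
pushdown automaton evaluates the formula in linear time and at the same time checks that the input
is the code of a Horn-NNF formula.

Hardness. The space-time diagram of a machine is written in coordinates relative to the heads: every
tape is shifted so that its head is at distance 0. Then one cell, the centre, holds the state and
all scanned symbols, and a cell at the next time is a function of the centre and of three
neighbouring cells (`TM.row_step`). The variables say that the cell at a given time and distance has
a given content. Unit clauses give the initial row, clauses with one positive literal give the rule,
and negative unit clauses forbid a rejecting halted centre. The computation itself satisfies the
clauses if it does not reject (`Prog.holds_of_accepts`); conversely every model contains the part of
the diagram that the clauses derive, including the centre up to the halting time
(`Prog.row_of_holds`, `Prog.accepts_of_satisfiable`).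

Logarithmic space. Times and distances are words of logarithmic length over a fixed number of
digits, chosen so that the time bound is below the middle number (`Prog.eval_lt_centre`). The
transducer runs through all words with six tracks of digits; a finite automaton decides whether the
tracks are `s`, `s + 1`, the middle number, `d`, `d + 1`, `d + 2`, and in that case the clauses are
output. Only counters and sweeps over one short word are needed.

Both machines are obtained from structured programs, whose runs come with a time bound and with an
invariant that holds in all intermediate memories; the invariant yields the space bound. -/

/-! ### Structured programs for Turing machines -/

/-- The memory of a structured program: a finite register, the position of the input head, the
work tapes with their heads, and the output. -/
structure Mem (β R Γ ι : Type) where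
  reg : R
  inp : ℕ
  head : ι → ℤ
  tape : ι → ℤ → Γ
  out : List β

/-- Structured programs over a finite register `R` and work tapes with symbols `Γ`. -/
inductive Prog (α β R Γ ι : Type)
  | act (f : R → Option α → (ι → Γ) → TMAction R Γ ι β)
  | seq (p q : Prog α β R Γ ι)
  | ite (c : R → Option α → (ι → Γ) → Bool) (p q : Prog α β R Γ ι)
  | loop (c : R → Option α → (ι → Γ) → Bool) (p : Prog α β R Γ ι)

namespace Prog

variable {α β R Γ ι : Type}

/-- The control points of a program. -/
def Pt : Prog α β R Γ ι → Type
  | act _ => Unit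
  | seq p q => p.Pt ⊕ q.Pt
  | ite _ p q => Option (p.Pt ⊕ q.Pt)
  | loop _ p => Option p.Pt

theorem finite_pt : ∀ p : Prog α β R Γ ι, Finite p.Pt
  | act _ => inferInstanceAs (Finite Unit)
  | seq p q => by
    have := finite_pt p
    have := finite_pt q
    exact inferInstanceAs (Finite (p.Pt ⊕ q.Pt))
  | ite _ p q => by
    have := finite_pt p
    have := finite_pt q
    exact inferInstanceAs (Finite (Option (p.Pt ⊕ q.Pt)))
  | loop _ p => by
    have := finite_pt p
    exact inferInstanceAs (Finite (Option p.Pt))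

/-- The control point where a program starts. -/
def entry : (p : Prog α β R Γ ι) → p.Pt
  | act _ => ()
  | seq p _ => .inl p.entry
  | ite _ _ _ => none
  | loop _ _ => none

/-- The action that changes nothing. -/
def idle (r : R) (s : ι → Γ) : TMAction R Γ ι β :=
  ⟨r, .stay, s, fun _ => .stay, none⟩

/-- One step of control: the next control point (`none` is the exit) and the action. -/
def next : (p : Prog α β R Γ ι) → p.Pt → R → Option α → (ι → Γ) →
    Option p.Pt × TMAction R Γ ι β
  | act f, _, r, a, s => (none, f r a s)
  | seq p q, .inl x, r, a, s =>
    (some (match (p.next x r a s).1 with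
      | some y => .inl y
      | none => .inr q.entry), (p.next x r a s).2)
  | seq _ q, .inr x, r, a, s => ((q.next x r a s).1.map .inr, (q.next x r a s).2)
  | ite c p q, none, r, a, s =>
    (some (some (if c r a s then .inl p.entry else .inr q.entry)), idle r s)
  | ite _ p _, some (.inl x), r, a, s =>
    ((p.next x r a s).1.map fun y => some (.inl y), (p.next x r a s).2)
  | ite _ _ q, some (.inr x), r, a, s =>
    ((q.next x r a s).1.map fun y => some (.inr y), (q.next x r a s).2)
  | loop c p, none, r, a, s => (if c r a s then some (some p.entry) else none, idle r s)
  | loop _ p, some x, r, a, s => (some (p.next x r a s).1, (p.next x r a s).2)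

end Prog

namespace Mem

variable {α β R Γ ι : Type}

/-- The scanned symbols of the work tapes. -/
def scan (m : Mem β R Γ ι) : ι → Γ := fun i => m.tape i (m.head i)

/-- The effect of an action on the memory. -/
def apply (w : List α) (m : Mem β R Γ ι) (a : TMAction R Γ ι β) : Mem β R Γ ι where
  reg := a.next
  inp := TM.moveInput w.length m.inp a.inputMove
  head := fun i => m.head i + (a.move i).toInt
  tape := fun i => Function.update (m.tape i) (m.head i) (a.write i)
  out := m.out ++ a.emit.toList

/-- The value of a test in a memory. -/
def test (w : List α) (m : Mem β R Γ ι) (c : R → Option α → (ι → Γ) → Bool) : Bool :=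
  c m.reg (TM.readInput w m.inp) m.scan

theorem apply_idle (w : List α) (m : Mem β R Γ ι) : m.apply w (Prog.idle m.reg m.scan) = m := by
  cases m
  simp [apply, Prog.idle, scan, TM.moveInput, Move.toInt]

end Mem

namespace Prog

variable {α β R Γ ι : Type} {w : List α} {I : Mem β R Γ ι → Prop}

/-- One step of a program. -/
def pstep (w : List α) (p : Prog α β R Γ ι) (x : p.Pt) (m : Mem β R Γ ι) :
    Option p.Pt × Mem β R Γ ι :=
  ((p.next x m.reg (TM.readInput w m.inp) m.scan).1,
    m.apply w (p.next x m.reg (TM.readInput w m.inp) m.scan).2)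

/-- Reachability in a given number of steps, with all memories on the way satisfying `I`. -/
inductive Reach (w : List α) (I : Mem β R Γ ι → Prop) (p : Prog α β R Γ ι) :
    ℕ → Option p.Pt × Mem β R Γ ι → Option p.Pt × Mem β R Γ ι → Prop
  | refl (x : Option p.Pt × Mem β R Γ ι) : I x.2 → Reach w I p 0 x x
  | step {t : ℕ} {x : p.Pt} {m : Mem β R Γ ι} {y : Option p.Pt × Mem β R Γ ι} :
      I m → Reach w I p t (pstep w p x m) y → Reach w I p (t + 1) (some x, m) y

theorem Reach.trans {p : Prog α β R Γ ι} {s t : ℕ} {x y z : Option p.Pt × Mem β R Γ ι}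
    (h : Reach w I p s x y) (h' : Reach w I p t y z) : Reach w I p (s + t) x z := by
  induction h with
  | refl x _ => simpa using h'
  | @step s x m y hm _ ih =>
    rw [show s + 1 + t = s + t + 1 by omega]
    exact .step hm (ih h')

/-- Runs of a part of a program are runs of the program, if steps are embedded by `e`. -/
theorem Reach.embed {p q : Prog α β R Γ ι} (e : Option p.Pt → Option q.Pt)
    (he : ∀ x m, ∃ y, e (some x) = some y ∧
      pstep w q y m = (e (pstep w p x m).1, (pstep w p x m).2))
    {t : ℕ} {x y : Option p.Pt × Mem β R Γ ι} (h : Reach w I p t x y) :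
    Reach w I q t (e x.1, x.2) (e y.1, y.2) := by
  induction h with
  | refl x hx => exact .refl _ hx
  | @step s x m y hm _ ih =>
    obtain ⟨z, hz, h⟩ := he x m
    simp only [hz]
    exact .step hm (by rw [h]; exact ih)

/-- The program `p` runs from `m` to `m'` in at most `T` steps, and `I` holds all the way. -/
def Run (w : List α) (I : Mem β R Γ ι → Prop) (p : Prog α β R Γ ι) (m : Mem β R Γ ι) (T : ℕ)
    (m' : Mem β R Γ ι) : Prop :=
  ∃ t ≤ T, Reach w I p t (some p.entry, m) (none, m')

variable {p q : Prog α β R Γ ι} {m m₁ m₂ : Mem β R Γ ι} {T T' : ℕ}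
  {c : R → Option α → (ι → Γ) → Bool}

theorem Run.mono (h : Run w I p m T m₁) (hT : T ≤ T') : Run w I p m T' m₁ := by
  obtain ⟨t, ht, h⟩ := h
  exact ⟨t, ht.trans hT, h⟩

theorem Run.act (f : R → Option α → (ι → Γ) → TMAction R Γ ι β) (hm : I m)
    (hm' : I (m.apply w (f m.reg (TM.readInput w m.inp) m.scan))) :
    Run w I (act f) m 1 (m.apply w (f m.reg (TM.readInput w m.inp) m.scan)) :=
  ⟨1, le_rfl, .step hm (.refl (none, _) hm')⟩

theorem Run.seq (h : Run w I p m T m₁) (h' : Run w I q m₁ T' m₂) :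
    Run w I (seq p q) m (T + T') m₂ := by
  obtain ⟨t, ht, h⟩ := h
  obtain ⟨t', ht', h'⟩ := h'
  refine ⟨t + t', by omega, Reach.trans (p := .seq p q) (y := (some (Sum.inr q.entry : p.Pt ⊕ q.Pt), m₁)) ?_ ?_⟩
  -- The exit of `p` is identified with the entry of `q`, so that the two embedded runs can be
  -- joined.
  · exact h.embed (q := .seq p q)
      (fun o => some (match o with
        | some y => .inl y
        | none => .inr q.entry))
      (fun x m => ⟨.inl x, rfl, rfl⟩)
  · exact h'.embed (q := .seq p q) (fun o => o.map .inr) (fun x m => ⟨.inr x, rfl, rfl⟩)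

theorem Run.ite (h : Run w I (if m.test w c then p else q) m T m₁) (hm : I m) :
    Run w I (ite c p q) m (T + 1) m₁ := by
  obtain ⟨t, ht, h⟩ := h
  refine ⟨t + 1, by omega, .step hm ?_⟩
  have e : pstep w (.ite c p q) none m =
      (some (some (if m.test w c then .inl p.entry else .inr q.entry)), m) := by
    simp only [pstep, next, Mem.apply_idle]
    rfl
  change Reach w I _ t (pstep w (.ite c p q) none m) _
  rw [e]
  cases hc : m.test w c with
  | true =>
    rw [hc] at h
    exact Reach.embed (q := .ite c p q) (fun o => o.map fun y => some (.inl y))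
      (fun x m => ⟨some (.inl x), rfl, rfl⟩) h
  | false =>
    rw [hc] at h
    exact Reach.embed (q := .ite c p q) (fun o => o.map fun y => some (.inr y))
      (fun x m => ⟨some (.inr x), rfl, rfl⟩) h

theorem pstep_loop : pstep w (.loop c p) none m =
    (if m.test w c then some (some p.entry) else none, m) := by
  simp only [pstep, next, Mem.apply_idle]
  rfl

theorem Run.loop_false (hc : m.test w c = false) (hm : I m) : Run w I (loop c p) m 1 m := by
  refine ⟨1, le_rfl, .step hm ?_⟩
  change Reach w I _ 0 (pstep w (.loop c p) none m) _
  rw [pstep_loop, hc]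
  exact .refl (none, m) hm

theorem Run.loop_true (hc : m.test w c = true) (hm : I m) (h : Run w I p m T m₁)
    (h' : Run w I (loop c p) m₁ T' m₂) : Run w I (loop c p) m (T + 1 + T') m₂ := by
  obtain ⟨t, ht, h⟩ := h
  obtain ⟨t', ht', h'⟩ := h'
  refine ⟨t + t' + 1, by omega, .step hm ?_⟩
  change Reach w I _ _ (pstep w (.loop c p) none m) _
  rw [pstep_loop, hc]
  exact (Reach.embed (q := .loop c p) some (fun x m => ⟨some x, rfl, rfl⟩) h).trans h'

/-- A loop whose body is executed `K` times, with an invariant. -/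
theorem Run.loop_count (P : ℕ → Mem β R Γ ι → Prop) (b K : ℕ)
    (hI : ∀ k m, P k m → I m)
    (hP : ∀ k < K, ∀ m, P k m → m.test w c = true ∧ ∃ m', Run w I p m b m' ∧ P (k + 1) m')
    (hK : ∀ m, P K m → m.test w c = false) (hm : P 0 m) :
    ∃ m', Run w I (loop c p) m (K * (b + 1) + 1) m' ∧ P K m' := by
  -- Induction on the number `j` of remaining rounds. A round costs the body and one step for the
  -- test; one more test ends the loop.
  suffices H : ∀ j k m, j + k = K → P k m →
      ∃ m', Run w I (loop c p) m (j * (b + 1) + 1) m' ∧ P K m' from H K 0 m (by omega) hm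
  intro j
  induction j with
  | zero =>
    intro k m hk hm
    obtain rfl : k = K := by omega
    exact ⟨m, by simpa using Run.loop_false (hK m hm) (hI _ _ hm), hm⟩
  | succ j ih =>
    intro k m hk hm
    obtain ⟨hc, m₁, h₁, hm₁⟩ := hP k (by omega) m hm
    obtain ⟨m₂, h₂, hm₂⟩ := ih (k + 1) m₁ (by omega) hm₁
    exact ⟨m₂, (Run.loop_true hc (hI _ _ hm) h₁ h₂).mono (by ring_nf; omega), hm₂⟩

/-! ### From structured programs to Turing machines. -/

/-- The Turing machine that executes a program. -/
def toTM [Finite R] [Finite Γ] [Finite ι] (p : Prog α β R Γ ι) (r : R) (blank : Γ) (acc : Set R) :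
    TM α β where
  State := Option p.Pt × R
  finiteState := by
    have := p.finite_pt
    infer_instance
  Γ := Γ
  ι := ι
  blank := blank
  start := (some p.entry, r)
  accept := {s | s.2 ∈ acc}
  δ := fun s a g => s.1.map fun x =>
    { next := ((p.next x s.2 a g).1, (p.next x s.2 a g).2.next)
      inputMove := (p.next x s.2 a g).2.inputMove
      write := (p.next x s.2 a g).2.write
      move := (p.next x s.2 a g).2.move
      emit := (p.next x s.2 a g).2.emit }

/-- The initial memory. -/
def start (r : R) (blank : Γ) : Mem β R Γ ι where
  reg := r
  inp := 0
  head := fun _ => 0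
  tape := fun _ _ => blank
  out := []

section

variable [Finite R] [Finite Γ] [Finite ι] {r : R} {blank : Γ} {acc : Set R}

/-- The configuration of the Turing machine of a program at a control point with a memory. -/
def cfg (p : Prog α β R Γ ι) (r : R) (blank : Γ) (acc : Set R)
    (x : Option p.Pt × Mem β R Γ ι) : (p.toTM r blank acc).Cfg where
  state := (x.1, x.2.reg)
  inputHead := x.2.inp
  head := x.2.head
  tape := x.2.tape
  out := x.2.out

theorem step_cfg (x : p.Pt) : (p.toTM r blank acc).step w (p.cfg r blank acc (some x, m)) =
    p.cfg r blank acc (pstep w p x m) := rfl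

theorem init_toTM : (p.toTM r blank acc).init =
    p.cfg r blank acc (some p.entry, start r blank) := rfl

theorem halted_cfg : (p.toTM r blank acc).Halted w (p.cfg r blank acc (none, m)) := rfl

theorem _root_.TM.step_of_halted {M : TM α β} {c : M.Cfg} (h : M.Halted w c) :
    (M.step w)^[T] c = c := by
  have : M.step w c = c := by
    unfold TM.Halted at h
    simp [TM.step, h]
  exact Function.iterate_fixed this T

theorem Reach.iterate {t : ℕ} {x y : Option p.Pt × Mem β R Γ ι} (h : Reach w I p t x y) :
    ((p.toTM r blank acc).step w)^[t] (p.cfg r blank acc x) = p.cfg r blank acc y := by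
  induction h with
  | refl x _ => rfl
  | step _ _ ih => rw [Function.iterate_succ_apply, step_cfg, ih]

/-- The invariant is carried by every constructor of `Reach`, so it can be read off at each
intermediate time of the machine. -/
theorem Reach.inv {t : ℕ} {x y : Option p.Pt × Mem β R Γ ι} (h : Reach w I p t x y) :
    ∀ s ≤ t, ∃ z, ((p.toTM r blank acc).step w)^[s] (p.cfg r blank acc x) =
      p.cfg r blank acc z ∧ I z.2 := by
  induction h with
  | refl x hx => intro s hs; exact ⟨x, by simp [Nat.le_zero.1 hs], hx⟩
  | @step t x m y hm _ ih =>
    intro s hs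
    cases s with
    | zero => exact ⟨(some x, m), rfl, hm⟩
    | succ s =>
      obtain ⟨z, hz, h⟩ := ih s (by omega)
      exact ⟨z, by rw [Function.iterate_succ_apply, step_cfg, hz], h⟩

/-- A program that exits early leaves the machine in a halted configuration, which stays as it is;
an upper bound for the time is therefore as good as the exact time. -/
theorem Run.cfgAt (h : Run w I p (start r blank) T m) :
    (p.toTM r blank acc).cfgAt w T = p.cfg r blank acc (none, m) := by
  obtain ⟨t, ht, h⟩ := h
  have h1 := h.iterate (r := r) (blank := blank) (acc := acc)
  rw [TM.cfgAt, ← Nat.sub_add_cancel ht, Function.iterate_add_apply]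
  rw [init_toTM, h1, TM.step_of_halted halted_cfg]

/-- A space bound concerns all times, also those after the exit. From then on the configuration is
constant and inherits the invariant of the exit memory. -/
theorem Run.cfgAt_inv (h : Run w I p (start r blank) T m) (s : ℕ) :
    ∃ z, (p.toTM r blank acc).cfgAt w s = p.cfg r blank acc z ∧ I z.2 := by
  obtain ⟨t, ht, h⟩ := h
  by_cases hs : s ≤ t
  · exact h.inv s hs
  · obtain ⟨z, hz, hI⟩ := h.inv (r := r) (blank := blank) (acc := acc) t le_rfl
    refine ⟨z, ?_, hI⟩
    have h1 := h.iterate (r := r) (blank := blank) (acc := acc)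
    rw [← hz, h1, TM.cfgAt, ← Nat.sub_add_cancel (not_le.1 hs).le, Function.iterate_add_apply]
    rw [init_toTM, h1, TM.step_of_halted halted_cfg]

end

end Prog

/-! ### Programs with one work tape -/

namespace Prog

variable {α β R G : Type} {w : List α}

/-- Termination of a program without regard to time. -/
def Ends {Γ ι : Type} (w : List α) (I : Mem β R Γ ι → Prop) (p : Prog α β R Γ ι)
    (m m' : Mem β R Γ ι) : Prop :=
  ∃ T, Run w I p m T m'

section

variable {Γ ι : Type} {I : Mem β R Γ ι → Prop} {p q : Prog α β R Γ ι} {m m₁ m₂ : Mem β R Γ ι}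
  {c : R → Option α → (ι → Γ) → Bool}

theorem Ends.seq (h : Ends w I p m m₁) (h' : Ends w I q m₁ m₂) : Ends w I (seq p q) m m₂ :=
  let ⟨_, h⟩ := h
  let ⟨_, h'⟩ := h'
  ⟨_, h.seq h'⟩

theorem Ends.ite (hm : I m) (h : Ends w I (if m.test w c then p else q) m m₁) :
    Ends w I (ite c p q) m m₁ :=
  let ⟨_, h⟩ := h
  ⟨_, h.ite hm⟩

theorem Ends.loop_false (hm : I m) (hc : m.test w c = false) : Ends w I (loop c p) m m :=
  ⟨_, Run.loop_false hc hm⟩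

theorem Ends.loop_true (hm : I m) (hc : m.test w c = true) (h : Ends w I p m m₁)
    (h' : Ends w I (loop c p) m₁ m₂) : Ends w I (loop c p) m m₂ :=
  let ⟨_, h⟩ := h
  let ⟨_, h'⟩ := h'
  ⟨_, Run.loop_true hc hm h h'⟩

end

/-- The memory of a program with one work tape. -/
def mem1 (r : R) (i : ℕ) (h : ℤ) (t : ℤ → Option G) (o : List β) : Mem β R (Option G) Unit where
  reg := r
  inp := i
  head := fun _ => h
  tape := fun _ => t
  out := o

/-- A basic step of a program with one work tape. -/
def act1 (f : R → Option α → Option G → R × Move × Option G × Move × Option β) :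
    Prog α β R (Option G) Unit :=
  .act fun r a s =>
    { next := (f r a (s ())).1
      inputMove := (f r a (s ())).2.1
      write := fun _ => (f r a (s ())).2.2.1
      move := fun _ => (f r a (s ())).2.2.2.1
      emit := (f r a (s ())).2.2.2.2 }

/-- A loop in a program with one work tape. -/
def loop1 (c : R → Option α → Option G → Bool) (p : Prog α β R (Option G) Unit) :
    Prog α β R (Option G) Unit :=
  .loop (fun r a s => c r a (s ())) p

/-- A conditional in a program with one work tape. -/
def ite1 (c : R → Option α → Option G → Bool) (p q : Prog α β R (Option G) Unit) :
    Prog α β R (Option G) Unit :=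
  .ite (fun r a s => c r a (s ())) p q

/-- The work head stays in the cells `-S, …, S`. -/
def InSpace (S : ℕ) (m : Mem β R (Option G) Unit) : Prop :=
  |m.head ()| ≤ (S : ℤ)

variable {S : ℕ} {r r' : R} {i : ℕ} {h : ℤ} {t : ℤ → Option G} {o : List β}
  {m' : Mem β R (Option G) Unit}

theorem inSpace_mem1 : InSpace S (mem1 r i h t o) ↔ -(S : ℤ) ≤ h ∧ h ≤ S := by
  simp [InSpace, mem1, abs_le]

theorem Ends.act1 {f : R → Option α → Option G → R × Move × Option G × Move × Option β}
    {mi mh : Move} {g : Option G} {e : Option β}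
    (hf : f r (TM.readInput w i) (t h) = (r', mi, g, mh, e))
    (h1 : -(S : ℤ) ≤ h ∧ h ≤ S) (h2 : -(S : ℤ) ≤ h + mh.toInt ∧ h + mh.toInt ≤ S) :
    Ends w (InSpace S) (act1 f) (mem1 r i h t o)
      (mem1 r' (TM.moveInput w.length i mi) (h + mh.toInt) (Function.update t h g)
        (o ++ e.toList)) := by
  have e : (mem1 r i h t o : Mem β R (Option G) Unit).apply w
      ({ next := (f r (TM.readInput w i) (t h)).1
         inputMove := (f r (TM.readInput w i) (t h)).2.1
         write := fun _ => (f r (TM.readInput w i) (t h)).2.2.1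
         move := fun _ => (f r (TM.readInput w i) (t h)).2.2.2.1
         emit := (f r (TM.readInput w i) (t h)).2.2.2.2 }) =
      mem1 r' (TM.moveInput w.length i mi) (h + mh.toInt) (Function.update t h g)
        (o ++ e.toList) := by
    simp only [hf, Mem.apply, mem1]
  refine ⟨1, ?_⟩
  rw [← e]
  refine Run.act (w := w) _ (inSpace_mem1.2 h1) ?_
  exact e ▸ inSpace_mem1.2 h2

theorem Ends.loop1_false {c : R → Option α → Option G → Bool} {p : Prog α β R (Option G) Unit}
    (h1 : -(S : ℤ) ≤ h ∧ h ≤ S) (hc : c r (TM.readInput w i) (t h) = false) :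
    Ends w (InSpace S) (loop1 c p) (mem1 r i h t o) (mem1 r i h t o) :=
  Ends.loop_false (inSpace_mem1.2 h1) hc

theorem Ends.loop1_true {c : R → Option α → Option G → Bool} {p : Prog α β R (Option G) Unit}
    {m₁ m₂ : Mem β R (Option G) Unit}
    (h1 : -(S : ℤ) ≤ h ∧ h ≤ S) (hc : c r (TM.readInput w i) (t h) = true)
    (hp : Ends w (InSpace S) p (mem1 r i h t o) m₁) (hl : Ends w (InSpace S) (loop1 c p) m₁ m₂) :
    Ends w (InSpace S) (loop1 c p) (mem1 r i h t o) m₂ :=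
  Ends.loop_true (inSpace_mem1.2 h1) hc hp hl

theorem Ends.ite1 {c : R → Option α → Option G → Bool} {p q : Prog α β R (Option G) Unit}
    (h1 : -(S : ℤ) ≤ h ∧ h ≤ S)
    (hp : Ends w (InSpace S) (if c r (TM.readInput w i) (t h) then p else q)
      (mem1 r i h t o) m') :
    Ends w (InSpace S) (ite1 c p q) (mem1 r i h t o) m' :=
  Ends.ite (inSpace_mem1.2 h1) hp

/-! ### Words on the work tape: output, sweeps and increments. -/

/-- The tape that contains the word `l` in the cells `0, 1, …`. -/
def wordTape (l : List G) (z : ℤ) : Option G :=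
  if 0 ≤ z then l[z.toNat]? else none

theorem wordTape_nat (l : List G) (k : ℕ) : wordTape l k = l[k]? := by
  simp [wordTape]

theorem wordTape_append (a b : List G) (g : G) :
    wordTape (a ++ g :: b) (a.length : ℤ) = some g := by
  simp [wordTape_nat]

theorem wordTape_length (l : List G) : wordTape l (l.length : ℤ) = none := by
  simp [wordTape_nat]

theorem update_wordTape (a b : List G) (g g' : G) :
    Function.update (wordTape (a ++ g :: b)) (a.length : ℤ) (some g') =
      wordTape (a ++ g' :: b) := by
  funext z
  by_cases hz : z = a.length
  · subst hz
    rw [Function.update_self, wordTape_append]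
  · rw [Function.update_of_ne hz]
    unfold wordTape
    split_ifs with h0
    · have : a.length ≠ z.toNat := by omega
      rcases lt_or_gt_of_ne this with h | h
      · rw [List.getElem?_append_right h.le, List.getElem?_append_right h.le]
        obtain ⟨d, hd⟩ : ∃ d, z.toNat - a.length = d + 1 := ⟨z.toNat - a.length - 1, by omega⟩
        simp [hd]
      · rw [List.getElem?_append_left h, List.getElem?_append_left h]
    · rfl

theorem update_wordTape_length (l : List G) (g : Option G) :
    Function.update (wordTape l) (l.length : ℤ) g = wordTape (l ++ g.toList) := by
  cases g with
  | none =>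
    rw [Option.toList_none, List.append_nil, ← wordTape_length l, Function.update_eq_self]
  | some g =>
    funext z
    by_cases hz : z = l.length
    · subst hz
      rw [Function.update_self]
      exact (wordTape_append l [] g).symm
    · rw [Function.update_of_ne hz]
      unfold wordTape
      split_ifs with h0
      · have : l.length ≠ z.toNat := by omega
        simp only [Option.toList_some, List.getElem?_append]
        split_ifs with h1
        · rfl
        · rw [List.getElem?_eq_none (by omega), List.getElem?_eq_none (by simp; omega)]
      · rfl

/-- Move the work head. -/
def moveWork (mv : Move) : Prog α β R (Option G) Unit :=
  act1 fun r _ g => (r, .stay, g, mv, none)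

theorem ends_moveWork (mv : Move) (h1 : -(S : ℤ) ≤ h ∧ h ≤ S)
    (h2 : -(S : ℤ) ≤ h + mv.toInt ∧ h + mv.toInt ≤ S) :
    Ends w (InSpace S) (moveWork mv) (mem1 r i h t o) (mem1 r i (h + mv.toInt) t o) := by
  have := Ends.act1 (w := w) (r := r) (i := i) (t := t) (o := o) (r' := r) (g := t h) (mi := .stay)
    (e := none) (f := fun r _ g => (r, .stay, g, mv, none)) rfl h1 h2
  simpa [TM.moveInput, moveWork] using this

/-- Move the input head. -/
def moveInp (mv : Move) : Prog α β R (Option G) Unit :=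
  act1 fun r _ g => (r, mv, g, .stay, none)

theorem ends_moveInp (mv : Move) (h1 : -(S : ℤ) ≤ h ∧ h ≤ S) :
    Ends w (InSpace S) (moveInp mv) (mem1 r i h t o)
      (mem1 r (TM.moveInput w.length i mv) h t o) := by
  have := Ends.act1 (w := w) (r := r) (i := i) (t := t) (o := o) (r' := r) (g := t h) (mi := mv)
    (mh := .stay) (e := none) (f := fun r _ g => (r, mv, g, .stay, none)) rfl h1
    (by simpa [Move.toInt] using h1)
  simpa [Move.toInt, moveInp] using this

/-- Change the register. -/
def setReg (f : R → R) : Prog α β R (Option G) Unit :=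
  act1 fun r _ g => (f r, .stay, g, .stay, none)

theorem ends_setReg (f : R → R) (h1 : -(S : ℤ) ≤ h ∧ h ≤ S) :
    Ends w (InSpace S) (setReg f) (mem1 r i h t o) (mem1 (f r) i h t o) := by
  have := Ends.act1 (w := w) (r := r) (i := i) (t := t) (o := o) (r' := f r) (g := t h)
    (mi := .stay) (mh := .stay) (e := none)
    (f := fun r _ g => (f r, .stay, g, .stay, none)) rfl h1
    (by simpa [Move.toInt] using h1)
  simpa [Move.toInt, TM.moveInput, setReg] using this

/-- Output the first `K` symbols of a word that depends on what is scanned. -/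
def emitUpTo (e : R → Option α → Option G → List β) : ℕ → Prog α β R (Option G) Unit
  | 0 => setReg id
  | k + 1 => seq (emitUpTo e k) (act1 fun r a g => (r, .stay, g, .stay, (e r a g)[k]?))

theorem ends_emitUpTo (e : R → Option α → Option G → List β) (h1 : -(S : ℤ) ≤ h ∧ h ≤ S) (K : ℕ) :
    Ends w (InSpace S) (emitUpTo e K) (mem1 r i h t o)
      (mem1 r i h t (o ++ (e r (TM.readInput w i) (t h)).take K)) := by
  induction K with
  | zero => simpa [emitUpTo] using ends_setReg (w := w) id h1
  | succ K ih =>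
    refine ih.seq ?_
    have := Ends.act1 (w := w) (r := r) (i := i) (t := t)
      (o := o ++ (e r (TM.readInput w i) (t h)).take K) (r' := r) (g := t h)
      (mi := .stay) (mh := .stay) (e := (e r (TM.readInput w i) (t h))[K]?)
      (f := fun r a g => (r, .stay, g, .stay, (e r a g)[K]?)) rfl h1
      (by simpa [Move.toInt] using h1)
    simpa [Move.toInt, TM.moveInput, List.take_add_one] using this

/-- A bound for the length of the words to be output. -/
noncomputable def emitBound (e : R → Option α → Option G → List β) : ℕ :=
  sSup (Set.range fun x : R × Option α × Option G => (e x.1 x.2.1 x.2.2).length)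

theorem length_le_emitBound [Finite R] [Finite α] [Finite G]
    (e : R → Option α → Option G → List β) (r : R) (a : Option α) (g : Option G) :
    (e r a g).length ≤ emitBound e :=
  le_csSup (Set.finite_range _).bddAbove ⟨(r, a, g), rfl⟩

/-- Output a word that depends on what is scanned. -/
noncomputable def emit (e : R → Option α → Option G → List β) : Prog α β R (Option G) Unit :=
  emitUpTo e (emitBound e)

/-- Only finitely many words can be asked for, so a fixed number of steps, bounded by `emitBound`,
suffices; steps beyond the end of the word emit nothing. -/
theorem ends_emit [Finite R] [Finite α] [Finite G] (e : R → Option α → Option G → List β)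
    (h1 : -(S : ℤ) ≤ h ∧ h ≤ S) :
    Ends w (InSpace S) (emit e) (mem1 r i h t o)
      (mem1 r i h t (o ++ e r (TM.readInput w i) (t h))) := by
  have := ends_emitUpTo (w := w) (r := r) (i := i) (t := t) (o := o) e h1 (emitBound e)
  rwa [List.take_of_length_le (length_le_emitBound e _ _ _)] at this

/-- Move the work head back to cell `0`. -/
def rewind : Prog α β R (Option G) Unit :=
  seq (moveWork .left) (seq (loop1 (fun _ _ g => g.isSome) (moveWork .left)) (moveWork .right))

/-- The head starts at `k - 1` because `rewind` first leaves the cell `k`, which may be the blank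
one behind the word. The blank cell `-1` stops the loop. -/
theorem ends_rewind_loop (l : List G) (hS : l.length < S) (k : ℕ) (hk : k ≤ l.length) :
    Ends w (InSpace S) (loop1 (fun _ _ g => g.isSome) (moveWork .left))
      (mem1 r i ((k : ℤ) - 1) (wordTape l) o) (mem1 r i (-1) (wordTape l) o) := by
  induction k with
  | zero => exact Ends.loop1_false (by omega) (by simp [wordTape])
  | succ k ih =>
    have e : ((k + 1 : ℕ) : ℤ) - 1 = k := by omega
    rw [e]
    refine Ends.loop1_true (by omega) ?_ (ends_moveWork _ (by omega) ?_) (ih (by omega))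
    · rw [wordTape_nat, List.getElem?_eq_getElem hk, Option.isSome_some]
    · simp only [Move.toInt]
      omega

theorem ends_rewind (l : List G) (hS : l.length < S) (k : ℕ) (hk : k ≤ l.length) :
    Ends w (InSpace S) rewind (mem1 r i k (wordTape l) o) (mem1 r i 0 (wordTape l) o) := by
  have hS' : -(S : ℤ) ≤ k ∧ (k : ℤ) ≤ S := by omega
  refine (ends_moveWork _ hS' (by simp only [Move.toInt]; omega)).seq
    ((ends_rewind_loop l hS k hk).seq ?_)
  have := ends_moveWork (w := w) (S := S) (r := r) (i := i) (h := -1) (t := wordTape l) (o := o)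
    .right (by omega) (by simp only [Move.toInt]; omega)
  simpa [Move.toInt] using this

/-- Sweep over the word on the work tape: update the register with `u`, replace the symbols with
`k`, output `e` of the symbols, and return to cell `0`. -/
noncomputable def sweep (e : G → List β) (u : R → G → R) (k : G → G) :
    Prog α β R (Option G) Unit :=
  seq (loop1 (fun _ _ g => g.isSome)
    (seq (emit fun _ _ g => g.elim [] e)
      (act1 fun r _ g => (g.elim r (u r), .stay, g.map k, .right, none)))) rewind

/-- The induction is over the unread part `b`; the part `a` has already been rewritten. -/
theorem ends_sweep_loop [Finite R] [Finite α] [Finite G] (e : G → List β) (u : R → G → R)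
    (k : G → G) (a b : List G) (hS : a.length + b.length < S) (r : R) (o : List β) :
    Ends w (InSpace S) (loop1 (fun _ _ g => g.isSome)
      (seq (emit fun _ _ g => g.elim [] e)
        (act1 fun r _ g => (g.elim r (u r), .stay, g.map k, .right, none))))
      (mem1 r i a.length (wordTape (a ++ b)) o)
      (mem1 (b.foldl u r) i (a ++ b).length (wordTape (a ++ b.map k)) (o ++ b.flatMap e)) := by
  induction b generalizing a r o with
  | nil =>
    simp only [List.append_nil, List.foldl_nil, List.map_nil, List.flatMap_nil]
    exact Ends.loop1_false (by omega) (by rw [wordTape_length]; rfl)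
  | cons g b ih =>
    simp only [List.length_cons] at hS
    have e1 := wordTape_append a b g
    refine Ends.loop1_true (by omega) (by rw [e1]; rfl)
      ((ends_emit _ (by omega)).seq (Ends.act1 (r' := u r g) (mi := .stay) (mh := .right)
        (g := some (k g)) (e := none) (by rw [e1]; rfl) (by omega)
        (by simp only [Move.toInt]; omega))) ?_
    have := ih (a ++ [k g]) (by simp; omega) (u r g) (o ++ e g)
    rw [e1, update_wordTape]
    simpa [TM.moveInput, Move.toInt, add_assoc, add_comm, add_left_comm] using this

theorem ends_sweep [Finite R] [Finite α] [Finite G] (e : G → List β) (u : R → G → R)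
    (k : G → G) (l : List G) (hS : l.length < S) :
    Ends w (InSpace S) (sweep e u k) (mem1 r i 0 (wordTape l) o)
      (mem1 (l.foldl u r) i 0 (wordTape (l.map k)) (o ++ l.flatMap e)) := by
  refine (ends_sweep_loop e u k [] l (by simpa using hS) r o).seq ?_
  exact ends_rewind _ (by simpa using hS) _ (by simp)

/-- Increment a word, the least significant digit being the first: `nxt` is the successor of a
digit, and `g₀` the least digit. The second component tells whether there is an overflow. -/
def incWord (nxt : G → Option G) (g₀ : G) : List G → List G × Bool
  | [] => ([], true)
  | g :: l =>
    match nxt g with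
    | some g' => (g' :: l, false)
    | none => (g₀ :: (incWord nxt g₀ l).1, (incWord nxt g₀ l).2)

/-- Increment the word on the work tape; `x` is written behind the word in case of overflow, and
`v` stores in the register whether there is an overflow. -/
def inc (nxt : G → Option G) (g₀ : G) (x : Option G) (v : R → Bool → R) :
    Prog α β R (Option G) Unit :=
  seq (loop1 (fun _ _ g => g.any fun g => (nxt g).isNone)
      (act1 fun r _ _ => (r, .stay, some g₀, .right, none)))
    (seq (act1 fun r _ g => (v r g.isNone, .stay, g.elim x nxt, .stay, none)) rewind)

/-- The word `c` consists of the overflowing digits, already reset; `d` is the untouched rest.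
Either `d` is empty and the whole word overflows, or it begins with a digit that has a successor. -/
theorem ends_inc_loop (nxt : G → Option G) (g₀ : G) (a b : List G)
    (hS : a.length + b.length < S) :
    ∃ c d, c.length + d.length = b.length ∧
      Ends w (InSpace S) (loop1 (fun _ _ g => g.any fun g => (nxt g).isNone)
        (act1 fun r _ _ => (r, .stay, some g₀, .right, none)))
        (mem1 r i a.length (wordTape (a ++ b)) o)
        (mem1 r i (a ++ c).length (wordTape (a ++ c ++ d)) o) ∧
      (d = [] ∧ incWord nxt g₀ b = (c, true) ∨
        ∃ g g' d', d = g :: d' ∧ nxt g = some g' ∧ incWord nxt g₀ b = (c ++ g' :: d', false)) := by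
  induction b generalizing a with
  | nil =>
    refine ⟨[], [], rfl, ?_, .inl ⟨rfl, rfl⟩⟩
    simp only [List.append_nil]
    exact Ends.loop1_false (by omega) (by rw [wordTape_length]; rfl)
  | cons g b ih =>
    simp only [List.length_cons] at hS
    have e1 := wordTape_append a b g
    cases hg : nxt g with
    | some g' =>
      refine ⟨[], g :: b, by simp, ?_, .inr ⟨g, g', b, rfl, hg, by simp [incWord, hg]⟩⟩
      simp only [List.append_nil]
      exact Ends.loop1_false (by omega) (by rw [e1]; simp [hg])
    | none =>
      obtain ⟨c, d, hl, h, hd⟩ := ih (a ++ [g₀]) (by simp; omega)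
      refine ⟨g₀ :: c, d, by simp; omega, ?_, ?_⟩
      · refine Ends.loop1_true (by omega) (by rw [e1]; simp [hg])
          (Ends.act1 (r' := r) (mi := .stay) (mh := .right) (g := some g₀) (e := none) rfl
          (by omega) (by simp only [Move.toInt]; omega)) ?_
        rw [update_wordTape]
        simpa [TM.moveInput, Move.toInt, add_assoc, add_comm, add_left_comm] using h
      · rcases hd with ⟨rfl, hd⟩ | ⟨g, g', d', rfl, hg', hd⟩
        · exact .inl ⟨rfl, by simp [incWord, hg, hd]⟩
        · exact .inr ⟨g, g', d', rfl, hg', by simp [incWord, hg, hd]⟩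

theorem ends_inc (nxt : G → Option G) (g₀ : G) (x : Option G) (v : R → Bool → R) (l : List G)
    (hS : l.length + 1 < S) :
    Ends w (InSpace S) (inc nxt g₀ x v) (mem1 r i 0 (wordTape l) o)
      (mem1 (v r (incWord nxt g₀ l).2) i 0
        (wordTape ((incWord nxt g₀ l).1 ++ if (incWord nxt g₀ l).2 then x.toList else [])) o) := by
  obtain ⟨c, d, hl, h, hd⟩ := ends_inc_loop (w := w) (S := S) (r := r) (i := i) (o := o)
    nxt g₀ [] l (by simp; omega)
  refine h.seq ?_
  rw [List.nil_append]
  rcases hd with ⟨rfl, hd⟩ | ⟨g, g', d', rfl, hg, hd⟩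
  · simp only [List.length_nil, add_zero] at hl
    rw [hd]
    refine Ends.seq (Ends.act1 (r' := v r true) (mi := .stay) (mh := .stay) (g := x) (e := none)
      ?_ (by omega) (by simp only [Move.toInt]; omega)) ?_
    · rw [List.append_nil, wordTape_length]; rfl
    · rw [List.append_nil, update_wordTape_length]
      simp only [TM.moveInput, Move.toInt, add_zero, Option.toList_none, List.append_nil, if_true]
      refine ends_rewind _ ?_ _ (by simp)
      cases x <;> simp <;> omega
  · simp only [List.length_cons] at hl
    rw [hd]
    refine Ends.seq (Ends.act1 (r' := v r false) (mi := .stay) (mh := .stay) (g := some g')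
      (e := none) ?_ (by omega) (by simp only [Move.toInt]; omega)) ?_
    · rw [wordTape_append]; simp [hg]
    · rw [update_wordTape]
      simp only [TM.moveInput, Move.toInt, add_zero, Option.toList_none, List.append_nil,
        Bool.false_eq_true, if_false]
      exact ends_rewind _ (by simp; omega) c.length (by simp)

end Prog

/-! ### Words as numbers -/

namespace Prog

section digits

variable {G : Type}

/-- The word of length `ℓ` that represents `k` in base `b`, the least significant digit being the
first. -/
def digits (dig : ℕ → G) (b : ℕ) : ℕ → ℕ → List G
  | 0, _ => []
  | ℓ + 1, k => dig (k % b) :: digits dig b ℓ (k / b)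

variable {dig : ℕ → G} {b : ℕ}

@[simp]
theorem length_digits (ℓ k : ℕ) : (digits dig b ℓ k).length = ℓ := by
  induction ℓ generalizing k with
  | zero => rfl
  | succ ℓ ih => simp [digits, ih]

theorem map_digits {H : Type} (f : G → H) (ℓ k : ℕ) :
    (digits dig b ℓ k).map f = digits (fun i => f (dig i)) b ℓ k := by
  induction ℓ generalizing k with
  | zero => rfl
  | succ ℓ ih => simp [digits, ih]

theorem digits_zero (ℓ : ℕ) : digits dig b ℓ 0 = List.replicate ℓ (dig 0) := by
  induction ℓ with
  | zero => rfl
  | succ ℓ ih => simp [digits, ih, List.replicate_succ]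

theorem succ_mod_div {b k : ℕ} (hb : 0 < b) :
    (k % b + 1 < b ∧ (k + 1) % b = k % b + 1 ∧ (k + 1) / b = k / b) ∨
      (k % b + 1 = b ∧ (k + 1) % b = 0 ∧ (k + 1) / b = k / b + 1) := by
  have h1 := Nat.div_add_mod k b
  have h2 := Nat.mod_lt k hb
  rcases Nat.lt_or_ge (k % b + 1) b with h | h
  · left
    have e : k + 1 = (k % b + 1) + b * (k / b) := by omega
    refine ⟨h, ?_, ?_⟩
    · rw [e, Nat.add_mul_mod_self_left, Nat.mod_eq_of_lt h]
    · rw [e, Nat.add_mul_div_left _ _ hb, Nat.div_eq_of_lt h, zero_add]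
  · right
    have h3 : k % b + 1 = b := by omega
    have e : k + 1 = b * (k / b + 1) := by rw [mul_add, mul_one]; omega
    refine ⟨h3, ?_, ?_⟩
    · rw [e, Nat.mul_mod_right]
    · rw [e, Nat.mul_div_cancel_left _ hb]

/-- The two cases of `succ_mod_div`, no carry and carry, match the two cases of `incWord`. The
overflow bit tells exactly when the enumeration of all words of length `ℓ` is complete, so it can
end a loop. -/
theorem incWord_digits {nxt : G → Option G} (hb : 0 < b)
    (hn : ∀ k < b, nxt (dig k) = if k + 1 < b then some (dig (k + 1)) else none)
    (ℓ k : ℕ) (hk : k < b ^ ℓ) :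
    incWord nxt (dig 0) (digits dig b ℓ k) =
      (digits dig b ℓ (k + 1), decide (k + 1 = b ^ ℓ)) := by
  induction ℓ generalizing k with
  | zero =>
    obtain rfl : k = 0 := by simpa using hk
    rfl
  | succ ℓ ih =>
    have h1 := hn (k % b) (Nat.mod_lt k hb)
    have h2 : k / b < b ^ ℓ := by
      rw [Nat.div_lt_iff_lt_mul hb]
      rwa [pow_succ] at hk
    rcases succ_mod_div (k := k) hb with ⟨h3, h4, h5⟩ | ⟨h3, h4, h5⟩
    · rw [if_pos h3] at h1
      have h6 : k + 1 ≠ b ^ (ℓ + 1) := by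
        intro h
        rw [h, pow_succ', Nat.mul_mod_right] at h4
        omega
      simp [digits, incWord, h1, h4, h5, h6]
    · rw [if_neg (by omega)] at h1
      have h6 : k + 1 = b ^ (ℓ + 1) ↔ k / b + 1 = b ^ ℓ := by
        have : k + 1 = b * (k / b + 1) := by
          have := Nat.div_add_mod k b
          rw [mul_add, mul_one]
          omega
        rw [this, pow_succ', Nat.mul_right_inj hb.ne']
      simp [digits, incWord, h1, h4, h5, h6, ih _ h2]

/-- This is the overflow of a counter of variable length: with `ℓ` digits the number `b ^ ℓ` is
truncated to zeros, and appending the digit 1 repairs it. -/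
theorem digits_pow (hb : 1 < b) (ℓ : ℕ) :
    digits dig b (ℓ + 1) (b ^ ℓ) = digits dig b ℓ (b ^ ℓ) ++ [dig 1] := by
  induction ℓ with
  | zero => simp [digits, Nat.mod_eq_of_lt hb]
  | succ ℓ ih =>
    rw [digits, pow_succ', Nat.mul_div_cancel_left _ (by omega), ih, digits,
      Nat.mul_div_cancel_left _ (by omega)]
    rfl

/-- Counting reaches every word; thus a property of all words can be tested by the counter. -/
theorem exists_digits (hb : 0 < b) (hd : ∀ g, ∃ k < b, dig k = g) (l : List G) :
    ∃ k < b ^ l.length, digits dig b l.length k = l := by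
  induction l with
  | nil => exact ⟨0, by simp, rfl⟩
  | cons g l ih =>
    obtain ⟨k, hk, h⟩ := ih
    obtain ⟨i, hi, rfl⟩ := hd g
    refine ⟨i + b * k, ?_, ?_⟩
    · rw [List.length_cons, pow_succ']
      calc i + b * k < b * (k + 1) := by rw [mul_add]; omega
        _ ≤ _ := Nat.mul_le_mul_left _ hk
    · rw [List.length_cons, digits, Nat.add_mul_mod_self_left, Nat.mod_eq_of_lt hi,
        Nat.add_mul_div_left _ _ hb, Nat.div_eq_of_lt hi, zero_add, h]

end digits

/-! ### Values of words of digits, and an automaton for the successor. -/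

variable {B : ℕ}

/-- The number represented by a word of digits, the least significant digit being the first. -/
def val : List (Fin B) → ℕ
  | [] => 0
  | x :: l => x + B * val l

theorem add_mul_inj {x y X Y : ℕ} (hx : x < B) (hy : y < B) (h : x + B * X = y + B * Y) :
    x = y ∧ X = Y := by
  have hB : 0 < B := by omega
  have h1 := congrArg (· % B) h
  have h2 := congrArg (· / B) h
  simp only [Nat.add_mul_mod_self_left, Nat.mod_eq_of_lt hx, Nat.mod_eq_of_lt hy,
    Nat.add_mul_div_left _ _ hB, Nat.div_eq_of_lt hx, Nat.div_eq_of_lt hy, zero_add] at h1 h2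
  exact ⟨h1, h2⟩

theorem val_inj : ∀ {l l' : List (Fin B)}, l.length = l'.length → val l = val l' → l = l'
  | [], [], _, _ => rfl
  | x :: l, y :: l', h, h' => by
    obtain ⟨h1, h2⟩ := add_mul_inj x.2 y.2 h'
    rw [Fin.ext h1, val_inj (by simpa using h) h2]

theorem val_digits [NeZero B] (ℓ k : ℕ) (hk : k < B ^ ℓ) :
    val (digits (fun i => Fin.ofNat B i) B ℓ k) = k := by
  induction ℓ generalizing k with
  | zero => simp [digits, val] at hk ⊢; omega
  | succ ℓ ih =>
    have hB := Nat.pos_of_ne_zero (NeZero.ne B)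
    have : k / B < B ^ ℓ := by
      rw [Nat.div_lt_iff_lt_mul hB]
      rwa [pow_succ] at hk
    rw [digits, val, ih _ this]
    simp only [Fin.ofNat, Nat.mod_mod]
    exact Nat.mod_add_div k B

/-- One step of the automaton that tests whether the second of two words is the successor of the
first: `some true` means that there is a carry, `none` that the test has failed. -/
def succStep (s : Option Bool) (x y : Fin B) : Option Bool :=
  match s with
  | none => none
  | some false => if x = y then some false else none
  | some true =>
    if (y : ℕ) = x + 1 then some false
    else if (x : ℕ) + 1 = B ∧ (y : ℕ) = 0 then some true else none

theorem succStep_false (x y : Fin B) :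
    succStep (some false) x y = if x = y then some false else none := rfl

theorem succStep_true (x y : Fin B) : succStep (some true) x y =
    if (y : ℕ) = x + 1 then some false
    else if (x : ℕ) + 1 = B ∧ (y : ℕ) = 0 then some true else none := rfl

theorem foldl_succStep_none {G : Type} (f g : G → Fin B) (l : List G) :
    l.foldl (fun s x => succStep s (f x) (g x)) none = none := by
  induction l with
  | nil => rfl
  | cons x l ih => exact ih

theorem foldl_succStep_false {G : Type} (f g : G → Fin B) (l : List G) :
    l.foldl (fun s x => succStep s (f x) (g x)) (some false) = some false ↔
      val (l.map g) = val (l.map f) := by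
  induction l with
  | nil => simp
  | cons x l ih =>
    simp only [List.foldl_cons, List.map_cons, val, succStep_false]
    split_ifs with h
    · rw [ih, h]
      constructor
      · intro h'; rw [h']
      · intro h'; exact (add_mul_inj (g x).2 (g x).2 h').2
    · rw [foldl_succStep_none]
      simp only [reduceCtorEq, false_iff]
      intro h'
      exact h (Fin.ext (add_mul_inj (g x).2 (f x).2 h').1.symm)

/-- The carry enters at the least significant digit. Either it is absorbed, and the remaining digits
have to agree (`foldl_succStep_false`), or a maximal digit becomes 0 and the carry moves on. A carry
left at the end is not accepted, since the successor then does not fit into the length. -/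
theorem foldl_succStep_true {G : Type} (f g : G → Fin B) (l : List G) :
    l.foldl (fun s x => succStep s (f x) (g x)) (some true) = some false ↔
      val (l.map g) = val (l.map f) + 1 := by
  induction l with
  | nil => simp [val]
  | cons x l ih =>
    simp only [List.foldl_cons, List.map_cons, val, succStep_true]
    split_ifs with h h2
    · rw [foldl_succStep_false, h]
      constructor
      · intro h'; rw [h']; ring
      · intro h'
        exact (add_mul_inj (B := B) (by have := (g x).2; omega) (by have := (g x).2; omega)
          (show (f x : ℕ) + 1 + B * _ = (f x : ℕ) + 1 + B * _ by omega)).2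
    · rw [ih]
      obtain ⟨h2, h3⟩ := h2
      rw [h3, zero_add]
      have e : (f x : ℕ) + B * val (l.map f) + 1 = B * (val (l.map f) + 1) := by
        rw [mul_add]; omega
      rw [e]
      exact (Nat.mul_right_inj (by omega)).symm
    · rw [foldl_succStep_none]
      simp only [reduceCtorEq, false_iff]
      intro h'
      have hf := (f x).2
      rcases Nat.lt_or_ge ((f x : ℕ) + 1) B with h4 | h4
      · exact h (add_mul_inj (X := val (l.map g)) (Y := val (l.map f)) (g x).2 h4 (by omega)).1
      · have h5 : (f x : ℕ) + 1 = B := by omega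
        refine h2 ⟨h5, (add_mul_inj (B := B) (X := val (l.map g)) (Y := val (l.map f) + 1)
          (g x).2 (show 0 < B by omega) ?_).1⟩
        rw [mul_add]; omega

theorem two_mul_val_replicate (h : ℕ) (ℓ : ℕ) :
    2 * val (List.replicate ℓ (⟨h, by omega⟩ : Fin (2 * h + 1))) + 1 = (2 * h + 1) ^ ℓ := by
  induction ℓ with
  | zero => rfl
  | succ ℓ ih =>
    rw [List.replicate_succ, val, pow_succ', ← ih]
    ring

/-! ### Prefix codes -/

/-- A prefix code for a finite type. -/
noncomputable def code {X : Type} [Finite X] (x : X) : List Bool :=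
  List.replicate (Finite.equivFin X x : ℕ) true ++ [false]

theorem replicate_append_inj : ∀ (i j : ℕ) (s t : List Bool),
    List.replicate i true ++ false :: s = List.replicate j true ++ false :: t → i = j ∧ s = t
  | 0, 0, s, t, h => by simpa using h
  | 0, j + 1, s, t, h => by simp [List.replicate_succ] at h
  | i + 1, 0, s, t, h => by simp [List.replicate_succ] at h
  | i + 1, j + 1, s, t, h => by
    simp only [List.replicate_succ, List.cons_append, List.cons.injEq, true_and] at h
    obtain ⟨rfl, rfl⟩ := replicate_append_inj i j s t h
    exact ⟨rfl, rfl⟩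

theorem code_append_inj {X : Type} [Finite X] {x y : X} {s t : List Bool}
    (h : code x ++ s = code y ++ t) : x = y ∧ s = t := by
  simp only [code, List.append_assoc, List.singleton_append] at h
  obtain ⟨h1, h2⟩ := replicate_append_inj _ _ _ _ h
  exact ⟨(Finite.equivFin X).injective (Fin.ext h1), h2⟩

/-- The name of a variable that is indexed by a word and an element of a finite type. -/
noncomputable def name {X C : Type} [Finite X] [Finite C] (l : List X) (σ : C) : PVar :=
  l.flatMap code ++ code σ

/-- The codes of the two types overlap, so a name does not show where the word ends and the last
code begins; equality of the lengths fixes this boundary. -/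
theorem name_inj {X C : Type} [Finite X] [Finite C] : ∀ {l l' : List X} {σ σ' : C},
    l.length = l'.length → name l σ = name l' σ' → l = l' ∧ σ = σ'
  | [], [], σ, σ', _, h => by
    refine ⟨rfl, (code_append_inj (s := []) (t := []) ?_).1⟩
    simpa [name] using h
  | x :: l, y :: l', σ, σ', hl, h => by
    simp only [name, List.flatMap_cons, List.append_assoc] at h
    obtain ⟨rfl, h'⟩ := code_append_inj h
    obtain ⟨rfl, rfl⟩ := name_inj (by simpa using hl) h'
    exact ⟨rfl, rfl⟩

end Prog

/-! ### Conjunctions and disjunctions of lists of formulas. -/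

namespace NNF

/-- The conjunction of a nonempty list of formulas. -/
def conjL : List NNF → NNF
  -- A default value, as there are no truth constants; the semantic lemmas require a nonempty list.
  | [] => lit true []
  | φ :: l => conj (k := l.length) fun i => (φ :: l).get i

/-- The disjunction of a nonempty list of formulas. -/
def disjL : List NNF → NNF
  | [] => lit true []
  | φ :: l => disj (k := l.length) fun i => (φ :: l).get i

theorem ofFn_encode (φ : NNF) (l : List NNF) :
    (List.ofFn fun i : Fin (l.length + 1) => ((φ :: l).get i).encode) = (φ :: l).map encode := by
  have : List.ofFn (φ :: l).get = φ :: l := List.ofFn_get _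
  conv_rhs => rw [← this, List.map_ofFn]
  rfl

theorem encode_conjL {l : List NNF} (hl : l ≠ []) :
    (conjL l).encode = .andOpen :: (l.flatMap encode ++ [.andClose]) := by
  cases l with
  | nil => exact absurd rfl hl
  | cons φ l =>
    rw [conjL, encode, ofFn_encode]
    rfl

theorem encode_disjL {l : List NNF} (hl : l ≠ []) :
    (disjL l).encode = .orOpen :: (l.flatMap encode ++ [.orClose]) := by
  cases l with
  | nil => exact absurd rfl hl
  | cons φ l =>
    rw [disjL, encode, ofFn_encode]
    rfl

theorem holds_conjL {l : List NNF} (hl : l ≠ []) (v : PVar → Bool) :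
    (conjL l).Holds v ↔ ∀ φ ∈ l, φ.Holds v := by
  cases l with
  | nil => exact absurd rfl hl
  | cons φ l =>
    rw [conjL, Holds]
    exact (List.forall_mem_iff_get (l := φ :: l) (p := fun φ : NNF => φ.Holds v)).symm

theorem holds_disjL {l : List NNF} (hl : l ≠ []) (v : PVar → Bool) :
    (disjL l).Holds v ↔ ∃ φ ∈ l, φ.Holds v := by
  cases l with
  | nil => exact absurd rfl hl
  | cons φ l =>
    rw [disjL, Holds]
    exact (List.exists_mem_iff_get (l := φ :: l) (p := fun φ : NNF => φ.Holds v)).symm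

theorem isHNF_conjL {l : List NNF} (h : ∀ φ ∈ l, φ.IsHNF) : (conjL l).IsHNF := by
  cases l with
  | nil => trivial
  | cons φ l => exact (List.forall_mem_iff_get (l := φ :: l) (p := IsHNF)).1 h

end NNF

/-! ### A transducer that describes a space-time diagram by clauses -/

namespace Prog

section outputs

variable {α R G : Type} {w : List α} {S : ℕ} {r : R} {i : ℕ} {t : ℤ → Option G}
  {β : Type}

/-- The program outputs the word `f` and changes nothing else. -/
def Outputs (w : List α) (S : ℕ) (r : R) (i : ℕ) (t : ℤ → Option G)
    (p : Prog α β R (Option G) Unit) (f : List β) : Prop :=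
  ∀ o, Ends w (InSpace S) p (mem1 r i 0 t o) (mem1 r i 0 t (o ++ f))

theorem Outputs.seq {p q : Prog α β R (Option G) Unit} {f g : List β}
    (hp : Outputs w S r i t p f) (hq : Outputs w S r i t q g) :
    Outputs w S r i t (seq p q) (f ++ g) := fun o => by
  rw [← List.append_assoc]
  exact (hp o).seq (hq _)

theorem outputs_nop : Outputs (β := β) w S r i t (setReg id) [] := fun o => by
  rw [List.append_nil]
  exact ends_setReg _ (by omega)

theorem outputs_emit [Finite R] [Finite α] [Finite G] (f : R → Option α → Option G → List β) :
    Outputs w S r i t (emit f) (f r (TM.readInput w i) (t 0)) :=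
  fun _ => ends_emit _ (by omega)

/-- Execute a list of programs. -/
def seqL (l : List (Prog α β R (Option G) Unit)) : Prog α β R (Option G) Unit :=
  l.foldr seq (setReg id)

theorem outputs_seqL {X : Type} (l : List X) (p : X → Prog α β R (Option G) Unit)
    (f : X → List β) (h : ∀ x ∈ l, Outputs w S r i t (p x) (f x)) :
    Outputs w S r i t (seqL (l.map p)) (l.flatMap f) := by
  induction l with
  | nil => exact outputs_nop
  | cons x l ih =>
    simp only [List.mem_cons, forall_eq_or_imp] at h
    exact h.1.seq (ih h.2)

end outputs

theorem Ends.loop_count {α β R G : Type} {w : List α} {S : ℕ}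
    {c : R → Option α → Option G → Bool} {p : Prog α β R (Option G) Unit} (K : ℕ)
    (r : ℕ → R) (i : ℕ → ℕ) (t : ℕ → ℤ → Option G) (o : ℕ → List β)
    (h : ∀ k < K, c (r k) (TM.readInput w (i k)) (t k 0) = true ∧
      Ends w (InSpace S) p (mem1 (r k) (i k) 0 (t k) (o k))
        (mem1 (r (k + 1)) (i (k + 1)) 0 (t (k + 1)) (o (k + 1))))
    (hK : c (r K) (TM.readInput w (i K)) (t K 0) = false) :
    Ends w (InSpace S) (loop1 c p) (mem1 (r 0) (i 0) 0 (t 0) (o 0))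
      (mem1 (r K) (i K) 0 (t K) (o K)) := by
  suffices H : ∀ j k, j + k = K → Ends w (InSpace S) (loop1 c p)
      (mem1 (r k) (i k) 0 (t k) (o k)) (mem1 (r K) (i K) 0 (t K) (o K)) from H K 0 (by omega)
  intro j
  induction j with
  | zero =>
    intro k hk
    obtain rfl : k = K := by omega
    exact Ends.loop1_false (by omega) hK
  | succ j ih =>
    intro k hk
    obtain ⟨h1, h2⟩ := h k (by omega)
    exact Ends.loop1_true (by omega) h1 h2 (ih (k + 1) (by omega))

/-- The registers of the transducer: the state of an automaton that tests whether the tracks of a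
word are related as required, and two flags. -/
abbrev Regs : Type := (Option Bool × Bool × Option Bool × Option Bool) × Bool × Bool

/-- The symbols of the transducer: six tracks of digits. They carry the times `s` and `s + 1`, the
centre, and the positions `d`, `d + 1` and `d + 2`. -/
abbrev Tracks (h : ℕ) : Type := Fin 6 → Fin (2 * h + 1)

variable {α C : Type} [Finite α] [Finite C] (h : ℕ)

/-- The middle digit. -/
def mid : Fin (2 * h + 1) := ⟨h, by omega⟩

/-- The initial state of the automaton. -/
def relStart : Option Bool × Bool × Option Bool × Option Bool :=
  (some true, true, some true, some true)

/-- A step of the automaton. -/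
def relStep (q : Option Bool × Bool × Option Bool × Option Bool) (g : Tracks h) :
    Option Bool × Bool × Option Bool × Option Bool :=
  (succStep q.1 (g 0) (g 1), q.2.1 && decide (g 2 = mid h), succStep q.2.2.1 (g 3) (g 4),
    succStep q.2.2.2 (g 4) (g 5))

theorem foldl_relStep (l : List (Tracks h)) (q : Option Bool × Bool × Option Bool × Option Bool) :
    l.foldl (relStep h) q =
      (l.foldl (fun s g => succStep s (g 0) (g 1)) q.1, q.2.1 && l.all fun g => decide (g 2 = mid h),
        l.foldl (fun s g => succStep s (g 3) (g 4)) q.2.2.1,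
        l.foldl (fun s g => succStep s (g 4) (g 5)) q.2.2.2) := by
  induction l generalizing q with
  | nil => simp
  | cons g l ih => simp [ih, relStep, Bool.and_assoc]

/-- The tracks of the word are related as required. -/
def relOk (l : List (Tracks h)) : Bool :=
  decide (l.foldl (relStep h) relStart = (some false, true, some false, some false))

/-- The four components of the automaton run independently of each other, three of them as successor
tests and one as a test for the middle digit. -/
theorem relOk_iff (l : List (Tracks h)) : relOk h l = true ↔
    val (l.map fun g => g 1) = val (l.map fun g => g 0) + 1 ∧ (∀ g ∈ l, g 2 = mid h) ∧
      val (l.map fun g => g 4) = val (l.map fun g => g 3) + 1 ∧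
      val (l.map fun g => g 5) = val (l.map fun g => g 4) + 1 := by
  simp only [relOk, foldl_relStep, relStart, decide_eq_true_eq, Prod.mk.injEq,
    foldl_succStep_true (fun g : Tracks h => g _), Bool.true_and, List.all_eq_true]

/-- A selection of a time track and a position track. -/
def sel (i j : Fin 6) (g : Tracks h) : Fin (2 * h + 1) × Fin (2 * h + 1) := (g i, g j)

/-- The literal that says that the cell indexed by the selected tracks contains `σ`. -/
noncomputable def cellLit (s : Bool) (x : Tracks h → Fin (2 * h + 1) × Fin (2 * h + 1))
    (l : List (Tracks h)) (σ : C) : NNF :=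
  .lit s (name (l.map x) σ)

/-- Output a literal. -/
noncomputable def emitLit (s : Bool) (x : Tracks h → Fin (2 * h + 1) × Fin (2 * h + 1))
    (σ : Regs → Option α → C) : Prog α NNF.Symb Regs (Option (Tracks h)) Unit :=
  seq (emit fun _ _ _ => [.sign s])
    (seq (sweep (fun g => (code (x g)).map .bit) (fun r _ => r) id)
      (emit fun r a _ => (code (σ r a)).map .bit ++ [.endMark]))

variable {h} {w : List α} {S : ℕ} {r : Regs} {i : ℕ}

theorem outputs_sweep {R β G : Type} [Finite R] [Finite G] {r : R} (e : G → List β) (l : List G)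
    (hS : l.length < S) :
    Outputs w S r i (wordTape l) (sweep e (fun r _ => r) id) (l.flatMap e) := fun o => by
  have := ends_sweep (w := w) (r := r) (i := i) (o := o) e (fun r _ => r) id l hS
  have e1 : l.foldl (fun (r : R) _ => r) r = r := by
    induction l <;> simp_all
  rwa [e1, List.map_id] at this

theorem outputs_emitLit (s : Bool) (x : Tracks h → Fin (2 * h + 1) × Fin (2 * h + 1))
    (σ : Regs → Option α → C) (l : List (Tracks h)) (hS : l.length < S) :
    Outputs w S r i (wordTape l) (emitLit h s x σ)
      (cellLit h s x l (σ r (TM.readInput w i))).encode := by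
  have := (outputs_emit (w := w) (S := S) (r := r) (i := i) (t := wordTape l)
    (fun _ _ _ => [NNF.Symb.sign s])).seq
    ((outputs_sweep (w := w) (r := r) (i := i) (fun g => (code (x g)).map NNF.Symb.bit) l hS).seq
      (outputs_emit (fun r a _ => (code (σ r a)).map NNF.Symb.bit ++ [.endMark])))
  have e : (cellLit h s x l (σ r (TM.readInput w i))).encode =
      [.sign s] ++ (l.flatMap (fun g => (code (x g)).map .bit) ++
        ((code (σ r (TM.readInput w i))).map .bit ++ [.endMark])) := by
    simp [cellLit, NNF.encode, name, List.map_flatMap, List.flatMap_map]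
  rw [e]
  exact this

variable (h)

/-- The clauses of a word whose tracks are related as required: the rules that determine the
contents of a cell at the next time, and the exclusion of bad contents of the centre. -/
noncomputable def clauses (F : C → C → C → C → C) (bad : C → Bool) (l : List (Tracks h)) :
    List NNF :=
  haveI := Fintype.ofFinite C
  (Finset.univ : Finset (C × C × C × C)).toList.map (fun σ => .disjL
    ((([(sel h 0 2, σ.1), (sel h 0 3, σ.2.1), (sel h 0 4, σ.2.2.1), (sel h 0 5, σ.2.2.2)] :
      List ((Tracks h → Fin (2 * h + 1) × Fin (2 * h + 1)) × C)).map
        fun y => cellLit h false y.1 l y.2) ++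
      [cellLit h true (sel h 1 4) l (F σ.1 σ.2.1 σ.2.2.1 σ.2.2.2)])) ++
  (Finset.univ.filter fun σ => bad σ = true).toList.map (cellLit h false (sel h 0 2) l)

/-- Output the clauses of a word. -/
noncomputable def emitClauses (F : C → C → C → C → C) (bad : C → Bool) :
    Prog α NNF.Symb Regs (Option (Tracks h)) Unit :=
  haveI := Fintype.ofFinite C
  seq (seqL ((Finset.univ : Finset (C × C × C × C)).toList.map fun σ =>
    seq (emit fun _ _ _ => [.orOpen])
      (seq (seq (seqL (([(sel h 0 2, σ.1), (sel h 0 3, σ.2.1), (sel h 0 4, σ.2.2.1),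
          (sel h 0 5, σ.2.2.2)] :
        List ((Tracks h → Fin (2 * h + 1) × Fin (2 * h + 1)) × C)).map
          fun y => emitLit h false y.1 fun _ _ => y.2))
        (emitLit h true (sel h 1 4) fun _ _ => F σ.1 σ.2.1 σ.2.2.1 σ.2.2.2))
        (emit fun _ _ _ => [.orClose]))))
    (seqL ((Finset.univ.filter fun σ => bad σ = true).toList.map fun σ =>
      emitLit h false (sel h 0 2) fun _ _ => σ))

variable {h}

theorem outputs_emitClauses (F : C → C → C → C → C) (bad : C → Bool) (l : List (Tracks h))
    (hS : l.length < S) :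
    Outputs w S r i (wordTape l) (emitClauses h F bad)
      ((clauses h F bad l).flatMap NNF.encode) := by
  let _ := Fintype.ofFinite C
  rw [clauses, List.flatMap_append, List.flatMap_map, List.flatMap_map]
  refine Outputs.seq (outputs_seqL _ _ _ fun σ _ => ?_) (outputs_seqL _ _ _ fun σ _ => ?_)
  · rw [NNF.encode_disjL (by simp), List.flatMap_append, List.flatMap_map]
    refine Outputs.seq (f := [_]) (outputs_emit _) (Outputs.seq (Outputs.seq
      (outputs_seqL _ _ _ fun y _ => outputs_emitLit _ _ _ l hS) ?_) (outputs_emit _))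
    rw [List.flatMap_singleton]
    exact outputs_emitLit _ _ _ l hS
  · exact outputs_emitLit _ _ _ l hS

end Prog

/-! ### Enumeration of the symbols, counters, and the complete transducer. -/

namespace Prog

variable {α C : Type} [Finite α] [Finite C] (h : ℕ)

/-- The symbol all of whose tracks carry the digit `k`. -/
def constTracks (k : ℕ) : Tracks h := fun _ => Fin.ofNat (2 * h + 1) k

/-- The successor of a binary digit. -/
def nextBin (g : Tracks h) : Option (Tracks h) :=
  if g = constTracks h 0 then some (constTracks h 1) else none

/-- The successor of a symbol with equal tracks. -/
def nextConst (g : Tracks h) : Option (Tracks h) :=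
  if (g 0 : ℕ) + 1 < 2 * h + 1 then some (constTracks h (g 0 + 1)) else none

/-- The number of symbols. -/
noncomputable def trackCount : ℕ := Nat.card (Tracks h)

/-- The successor of an arbitrary symbol. -/
noncomputable def nextAll (g : Tracks h) : Option (Tracks h) :=
  if hg : (Finite.equivFin (Tracks h) g : ℕ) + 1 < trackCount h then
    some ((Finite.equivFin (Tracks h)).symm ⟨_, hg⟩) else none

/-- An enumeration of all symbols. -/
noncomputable def allTracks (k : ℕ) : Tracks h :=
  if hk : k < trackCount h then (Finite.equivFin (Tracks h)).symm ⟨k, hk⟩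
  else constTracks h 0

variable {h} in
-- The hypothesis `0 < h` makes the digits 0 and 1 different modulo `2 * h + 1`.
theorem nextBin_const (hh : 0 < h) (k : ℕ) (hk : k < 2) : nextBin h (constTracks h k) =
    if k + 1 < 2 then some (constTracks h (k + 1)) else none := by
  have hne : constTracks h 1 ≠ constTracks h 0 := by
    intro e
    have := congrArg Fin.val (congrFun e 0)
    simp [constTracks, Fin.ofNat, Nat.mod_eq_of_lt (show 1 < 2 * h + 1 by omega)] at this
  interval_cases k <;> simp [nextBin, hne]

theorem nextConst_const (k : ℕ) (hk : k < 2 * h + 1) : nextConst h (constTracks h k) =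
    if k + 1 < 2 * h + 1 then some (constTracks h (k + 1)) else none := by
  have : ((constTracks h k 0 : Fin (2 * h + 1)) : ℕ) = k := Nat.mod_eq_of_lt hk
  simp only [nextConst, this]

theorem trackCount_pos : 0 < trackCount h := Nat.card_pos

theorem nextAll_all (k : ℕ) (hk : k < trackCount h) : nextAll h (allTracks h k) =
    if k + 1 < trackCount h then some (allTracks h (k + 1)) else none := by
  simp only [nextAll, allTracks, dif_pos hk, Equiv.apply_symm_apply]
  split_ifs <;> rfl

theorem exists_allTracks (g : Tracks h) : ∃ k < trackCount h, allTracks h k = g := by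
  have hg : (Finite.equivFin _ g : ℕ) < trackCount h := (Finite.equivFin _ g).2
  refine ⟨_, hg, ?_⟩
  rw [allTracks, dif_pos hg]
  exact (Finite.equivFin _).symm_apply_apply g

section count

variable {w : List α} {S : ℕ} {r : Regs} {i : ℕ} {o : List NNF.Symb}

/-- Count in binary on the work tape. -/
noncomputable def incBin : Prog α NNF.Symb Regs (Option (Tracks h)) Unit :=
  inc (nextBin h) (constTracks h 0) (some (constTracks h 1)) fun r _ => r

/-- The binary representation of a number. -/
def binWord (k : ℕ) : List (Tracks h) := digits (constTracks h) 2 k.size k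

variable {h}

omit [Finite α] in
theorem ends_incBin (hh : 0 < h) (k : ℕ) (hS : k.size + 1 < S) :
    Ends w (InSpace S) (incBin h) (mem1 r i 0 (wordTape (binWord h k)) o)
      (mem1 r i 0 (wordTape (binWord h (k + 1))) o) := by
  have h1 := ends_inc (w := w) (S := S) (r := r) (i := i) (o := o) (nextBin h) (constTracks h 0)
    (some (constTracks h 1)) (fun r _ => r) (binWord h k) (by simpa [binWord] using hS)
  have h2 : (incWord (nextBin h) (constTracks h 0) (binWord h k)) = _ :=
    incWord_digits (by omega) (nextBin_const hh) k.size k (Nat.lt_size_self k)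
  rw [h2] at h1
  suffices e : digits (constTracks h) 2 k.size (k + 1) ++
      (if decide (k + 1 = 2 ^ k.size) = true then (some (constTracks h 1)).toList else []) =
      binWord h (k + 1) by rwa [e] at h1
  have h3 := Nat.lt_size_self k
  -- The binary length grows exactly when all digits overflow, and then the digit 1 is appended.
  by_cases hk : k + 1 = 2 ^ k.size
  · have e : (k + 1).size = k.size + 1 := by
      rw [hk, Nat.size_pow]
    rw [if_pos (by simpa using hk), binWord, e, hk]
    exact (digits_pow (b := 2) one_lt_two _).symm
  · have e : (k + 1).size = k.size := by
      apply le_antisymm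
      · rw [Nat.size_le]; omega
      · exact Nat.size_le_size (by omega)
    simp [binWord, e, hk]

variable (h) in
/-- Write as many symbols on the work tape as are needed for the length of the input. -/
noncomputable def layout : Prog α NNF.Symb Regs (Option (Tracks h)) Unit :=
  seq (incBin h) (seq (moveInp .right) (loop1 (fun _ a _ => a.isSome)
    (seq (incBin h) (moveInp .right))))

omit [Finite α] in
theorem readInput_succ (k : ℕ) (hk : k < w.length) : (TM.readInput w (k + 1)).isSome = true := by
  simp [TM.readInput, hk]

omit [Finite α] in
theorem readInput_end : TM.readInput w (w.length + 1) = none := by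
  simp [TM.readInput]

omit [Finite α] in
-- Counting the input in binary produces a word of logarithmic length, and only its length is used
-- later. The first increment, at the left end marker, makes the count `|w| + 1`, so the word is
-- nonempty even for empty input.
theorem ends_layout (hh : 0 < h) (hS : (w.length + 1).size + 1 < S) :
    Ends w (InSpace S) (layout h) (mem1 r 0 0 (wordTape []) o)
      (mem1 r (w.length + 1) 0 (wordTape (binWord h (w.length + 1))) o) := by
  have hS' : ∀ k ≤ w.length + 1, k.size + 1 < S := fun k hk => by
    have := Nat.size_le_size hk
    omega
  refine (ends_incBin hh 0 (hS' 0 (by omega))).seq ((ends_moveInp _ (by omega)).seq ?_)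
  have := Ends.loop_count (w := w) (S := S) (c := fun _ a _ => a.isSome)
    (p := seq (incBin h) (moveInp .right)) w.length (fun _ => r) (fun k => k + 1)
    (fun k => wordTape (binWord h (k + 1))) (fun _ => o) ?_ ?_
  · have e : TM.moveInput w.length 0 .right = 1 := by simp [TM.moveInput]
    rw [e]
    exact this
  · intro k hk
    refine ⟨readInput_succ k hk, (ends_incBin hh (k + 1) (hS' _ (by omega))).seq ?_⟩
    have := ends_moveInp (w := w) (r := r) (i := k + 1) (t := wordTape (binWord h (k + 1 + 1)))
      (o := o) (S := S) (h := 0) .right (by omega)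
    rwa [show TM.moveInput w.length (k + 1) .right = k + 1 + 1 by
      simp only [TM.moveInput]; omega] at this
  · rw [readInput_end]; rfl

/-- Move the input head back to the left end. -/
def rewindInp : Prog α NNF.Symb Regs (Option (Tracks h)) Unit :=
  seq (moveInp .left) (loop1 (fun _ a _ => a.isSome) (moveInp .left))

omit [Finite α] in
theorem ends_rewindInp {t : ℤ → Option (Tracks h)} :
    Ends w (InSpace S) rewindInp (mem1 r (w.length + 1) 0 t o) (mem1 r 0 0 t o) := by
  refine (ends_moveInp _ (by omega)).seq ?_
  have := Ends.loop_count (w := w) (S := S) (c := fun _ a _ => a.isSome)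
    (p := moveInp .left) w.length (fun _ => r) (fun k => w.length - k) (fun _ => t)
    (fun _ => o) ?_ ?_
  · simpa [TM.moveInput] using this
  · intro k hk
    have e : w.length - k = w.length - (k + 1) + 1 := by omega
    refine ⟨by rw [e]; exact readInput_succ _ (by omega), ?_⟩
    have := ends_moveInp (w := w) (r := r) (i := w.length - k) (t := t)
      (o := o) (S := S) (h := 0) .left (by omega)
    rwa [show TM.moveInput w.length (w.length - k) .left = w.length - (k + 1) by
      simp only [TM.moveInput]; omega] at this
  · rw [Nat.sub_self]; rfl

/-- Write the same symbol everywhere. -/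
noncomputable def reset (g : Tracks h) : Prog α NNF.Symb Regs (Option (Tracks h)) Unit :=
  sweep (fun _ => []) (fun r _ => r) fun _ => g

theorem ends_reset (g : Tracks h) (l : List (Tracks h)) (hS : l.length < S) :
    Ends w (InSpace S) (reset g) (mem1 r i 0 (wordTape l) o)
      (mem1 r i 0 (wordTape (List.replicate l.length g)) o) := by
  have := ends_sweep (w := w) (r := r) (i := i) (o := o) (fun _ => []) (fun r _ => r)
    (fun _ => g) l hS
  have e1 : l.foldl (fun (r : Regs) _ => r) r = r := by
    induction l <;> simp_all
  have e2 : l.flatMap (fun _ => ([] : List NNF.Symb)) = [] := by simp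
  rwa [e1, e2, List.append_nil, List.map_const'] at this

end count

/-- The value of the word all of whose digits are the middle digit. -/
def centre (ℓ : ℕ) : ℕ := val (List.replicate ℓ (mid h))

theorem two_mul_centre (ℓ : ℕ) : 2 * centre h ℓ + 1 = (2 * h + 1) ^ ℓ :=
  two_mul_val_replicate h ℓ

/-- The word all of whose tracks are the number `d`. -/
def posWord (ℓ d : ℕ) : List (Tracks h) := digits (constTracks h) (2 * h + 1) ℓ d

theorem val_posWord (ℓ d : ℕ) (hd : d < (2 * h + 1) ^ ℓ) (j : Fin 6) :
    val ((posWord h ℓ d).map fun g => g j) = d := by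
  rw [posWord, map_digits]
  exact val_digits ℓ d hd

/-- Words of the same length with the same value are equal, so `d` is the middle number iff all its
digits are the middle digit. A finite automaton can thus recognise the centre without arithmetic. -/
theorem posWord_all_mid (ℓ d : ℕ) (hd : d < (2 * h + 1) ^ ℓ) :
    ((posWord h ℓ d).all fun g => decide (g 2 = mid h)) = decide (d = centre h ℓ) := by
  rw [Bool.eq_iff_iff, List.all_eq_true, decide_eq_true_eq]
  simp only [decide_eq_true_eq]
  have e := val_posWord h ℓ d hd 2
  constructor
  · intro H
    rw [← e, centre]
    congr 1
    rw [List.eq_replicate_iff]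
    refine ⟨by simp [posWord], ?_⟩
    simpa using H
  · intro H
    have : (posWord h ℓ d).map (fun g => g 2) = List.replicate ℓ (mid h) := by
      apply val_inj (by simp [posWord])
      rw [e, H, centre]
    rw [List.eq_replicate_iff] at this
    simpa using this.2

variable (cell₀ : Bool → Bool → Option α → C) (F : C → C → C → C → C) (bad : C → Bool)

/-- The selection of time `0` and the position on track `0`. -/
def selStart (g : Tracks h) : Fin (2 * h + 1) × Fin (2 * h + 1) := (0, g 0)

/-- The literal that describes the contents of a cell at time `0`. -/
noncomputable def fact (w : List α) (ℓ d : ℕ) : NNF :=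
  cellLit h true (selStart h) (posWord h ℓ d)
    (cell₀ (decide (centre h ℓ < d)) (decide (d = centre h ℓ))
      (TM.readInput w (min (d - centre h ℓ) (w.length + 1))))

/-- Test whether the tracks of the word are related as required. -/
noncomputable def scanRel : Prog α NNF.Symb Regs (Option (Tracks h)) Unit :=
  sweep (fun _ => []) (fun r g => (relStep h r.1 g, r.2)) id

/-- Output the contents of a cell at time `0`, and go to the next cell. -/
noncomputable def factBody : Prog α NNF.Symb Regs (Option (Tracks h)) Unit :=
  seq (scanRel h)
    (seq (emitLit h true (selStart h) fun r a => cell₀ r.2.1 r.1.2.1 a)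
      (seq (setReg fun r => (r.1, r.2.1 || r.1.2.1, r.2.2))
        (seq (ite1 (fun r _ _ => r.2.1) (moveInp .right) (setReg id))
          (inc (nextConst h) (constTracks h 0) none fun r b => (relStart, r.2.1, b)))))

/-- Output the clauses of a word, and go to the next word. -/
noncomputable def clauseBody : Prog α NNF.Symb Regs (Option (Tracks h)) Unit :=
  seq (scanRel h)
    (seq (ite1 (fun r _ _ => decide (r.1 = (some false, true, some false, some false)))
        (emitClauses h F bad) (setReg id))
      (inc (nextAll h) (allTracks h 0) none fun r b => (relStart, r.2.1, b)))

variable {h} {w : List α} {S : ℕ} {r : Regs} {i : ℕ} {o : List NNF.Symb}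

theorem ends_scanRel (l : List (Tracks h)) (hS : l.length < S) :
    Ends w (InSpace S) (scanRel h) (mem1 r i 0 (wordTape l) o)
      (mem1 (l.foldl (relStep h) r.1, r.2) i 0 (wordTape l) o) := by
  have := ends_sweep (w := w) (r := r) (i := i) (o := o) (fun _ => [])
    (fun r g => (relStep h r.1 g, r.2)) id l hS
  have e1 : l.foldl (fun (r : Regs) g => (relStep h r.1 g, r.2)) r =
      (l.foldl (relStep h) r.1, r.2) := by
    clear this hS
    induction l generalizing r with
    | nil => rfl
    | cons g l ih => rw [List.foldl_cons, ih]; rfl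
  have e2 : l.flatMap (fun _ => ([] : List NNF.Symb)) = [] := by simp
  rwa [e1, e2, List.append_nil, List.map_id] at this

/-- The input head moves in step with the counter `d`, starting when the centre is reached and
stopping at the right end marker. The first flag remembers that the centre has been passed, the
second one is the overflow of the counter. -/
theorem ends_factBody (ℓ d : ℕ) (hd : d < (2 * h + 1) ^ ℓ) (hS : ℓ + 1 < S) :
    Ends w (InSpace S) (factBody h cell₀)
      (mem1 (relStart, decide (centre h ℓ < d), decide (d = (2 * h + 1) ^ ℓ))
        (min (d - centre h ℓ) (w.length + 1)) 0 (wordTape (posWord h ℓ d)) o)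
      (mem1 (relStart, decide (centre h ℓ < d + 1), decide (d + 1 = (2 * h + 1) ^ ℓ))
        (min (d + 1 - centre h ℓ) (w.length + 1)) 0 (wordTape (posWord h ℓ (d + 1)))
        (o ++ (fact h cell₀ w ℓ d).encode)) := by
  have hl : (posWord h ℓ d).length = ℓ := by simp [posWord]
  set q := (posWord h ℓ d).foldl (relStep h) relStart with hq
  set i := min (d - centre h ℓ) (w.length + 1) with hi
  set N := (2 * h + 1) ^ ℓ with hN
  have e : q.2.1 = decide (d = centre h ℓ) := by
    rw [hq, foldl_relStep]
    simp [relStart, posWord_all_mid h ℓ d hd]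
  have h1 : Ends w (InSpace S) (emitLit h true (selStart h) fun r a => cell₀ r.2.1 r.1.2.1 a)
      (mem1 (q, decide (centre h ℓ < d), decide (d = N)) i 0 (wordTape (posWord h ℓ d)) o)
      (mem1 (q, decide (centre h ℓ < d), decide (d = N)) i 0 (wordTape (posWord h ℓ d))
        (o ++ (fact h cell₀ w ℓ d).encode)) := by
    rw [fact, ← e]
    exact outputs_emitLit _ _ _ _ (by omega) _
  have h2 : Ends w (InSpace S) (setReg fun r => (r.1, r.2.1 || r.1.2.1, r.2.2))
      (mem1 (q, decide (centre h ℓ < d), decide (d = N)) i 0 (wordTape (posWord h ℓ d))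
        (o ++ (fact h cell₀ w ℓ d).encode))
      (mem1 (q, decide (centre h ℓ < d + 1), decide (d = N)) i 0 (wordTape (posWord h ℓ d))
        (o ++ (fact h cell₀ w ℓ d).encode)) := by
    -- The centre has been passed at `d + 1` iff it has been passed at `d` or is `d` itself, which
    -- the scan has just found out.
    have e2 : (decide (centre h ℓ < d + 1)) =
        (decide (centre h ℓ < d) || decide (d = centre h ℓ)) := by
      rw [Bool.eq_iff_iff]
      simp only [Bool.or_eq_true, decide_eq_true_eq]
      omega
    rw [e2, ← e]
    exact ends_setReg _ (by omega)
  have h3 : Ends w (InSpace S) (ite1 (fun r _ _ => r.2.1) (moveInp .right) (setReg id))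
      (mem1 (q, decide (centre h ℓ < d + 1), decide (d = N)) i 0 (wordTape (posWord h ℓ d))
        (o ++ (fact h cell₀ w ℓ d).encode))
      (mem1 (q, decide (centre h ℓ < d + 1), decide (d = N))
        (min (d + 1 - centre h ℓ) (w.length + 1)) 0 (wordTape (posWord h ℓ d))
        (o ++ (fact h cell₀ w ℓ d).encode)) := by
    refine Ends.ite1 (by omega) ?_
    simp only [decide_eq_true_eq]
    split_ifs with h4
    · have e3 : min (d + 1 - centre h ℓ) (w.length + 1) = TM.moveInput w.length i .right := by
        simp only [TM.moveInput]
        omega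
      rw [e3]
      exact ends_moveInp _ (by omega)
    · have e3 : min (d + 1 - centre h ℓ) (w.length + 1) = i := by omega
      rw [e3]
      exact ends_setReg _ (by omega)
  have h4 := ends_inc (w := w) (S := S) (r := (q, decide (centre h ℓ < d + 1), decide (d = N)))
    (i := min (d + 1 - centre h ℓ) (w.length + 1)) (o := o ++ (fact h cell₀ w ℓ d).encode)
    (nextConst h) (constTracks h 0)
    none (fun r b => (relStart, r.2.1, b)) (posWord h ℓ d) (by omega)
  have h5 : (incWord (nextConst h) (constTracks h 0) (posWord h ℓ d)) = _ :=
    incWord_digits (by omega) (nextConst_const h) ℓ d hd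
  rw [h5, Option.toList_none, ite_self, List.append_nil] at h4
  exact (ends_scanRel _ (by omega)).seq (h1.seq (h2.seq (h3.seq h4)))

/-- The word with number `k` among all words of length `ℓ`. -/
noncomputable def trackWord (h ℓ k : ℕ) : List (Tracks h) :=
  digits (allTracks h) (trackCount h) ℓ k

theorem ends_clauseBody (ℓ k : ℕ) (hk : k < trackCount h ^ ℓ) (hS : ℓ + 1 < S) :
    Ends w (InSpace S) (clauseBody h F bad)
      (mem1 (relStart, false, decide (k = trackCount h ^ ℓ)) i 0
        (wordTape (trackWord h ℓ k)) o)
      (mem1 (relStart, false, decide (k + 1 = trackCount h ^ ℓ)) i 0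
        (wordTape (trackWord h ℓ (k + 1)))
        (o ++ if relOk h (trackWord h ℓ k) then
          (clauses h F bad (trackWord h ℓ k)).flatMap NNF.encode else [])) := by
  have hl : (trackWord h ℓ k).length = ℓ := by simp [trackWord]
  set q := (trackWord h ℓ k).foldl (relStep h) relStart with hq
  set N := trackCount h ^ ℓ with hN
  set o' := o ++ if relOk h (trackWord h ℓ k) then
    (clauses h F bad (trackWord h ℓ k)).flatMap NNF.encode else [] with ho'
  have h1 : Ends w (InSpace S)
      (ite1 (fun r _ _ => decide (r.1 = (some false, true, some false, some false)))
        (emitClauses h F bad) (setReg id))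
      (mem1 (q, false, decide (k = N)) i 0 (wordTape (trackWord h ℓ k)) o)
      (mem1 (q, false, decide (k = N)) i 0 (wordTape (trackWord h ℓ k)) o') := by
    refine Ends.ite1 (by omega) ?_
    change Ends w _ (if relOk h (trackWord h ℓ k) = true then _ else _) _ _
    rw [ho']
    split_ifs with h1
    · exact outputs_emitClauses F bad _ (by omega) _
    · exact outputs_nop _
  have h4 := ends_inc (w := w) (S := S) (r := (q, false, decide (k = N)))
    (i := i) (o := o') (nextAll h) (allTracks h 0)
    none (fun r b => (relStart, r.2.1, b)) (trackWord h ℓ k) (by omega)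
  have h5 : (incWord (nextAll h) (allTracks h 0) (trackWord h ℓ k)) = _ :=
    incWord_digits (trackCount_pos h) (nextAll_all h) ℓ k hk
  rw [h5, Option.toList_none, ite_self, List.append_nil] at h4
  exact (ends_scanRel _ (by omega)).seq (h1.seq h4)

variable (h)

/-- All clauses for the input `w`, for words of length `ℓ`. -/
noncomputable def allClauses (w : List α) (ℓ : ℕ) : List NNF :=
  (List.range ((2 * h + 1) ^ ℓ)).map (fact h cell₀ w ℓ) ++
    (List.range (trackCount h ^ ℓ)).flatMap fun k =>
      if relOk h (trackWord h ℓ k) then clauses h F bad (trackWord h ℓ k) else []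

/-- Output all clauses. -/
noncomputable def transducer : Prog α NNF.Symb Regs (Option (Tracks h)) Unit :=
  seq (layout h) (seq (reset (constTracks h 0)) (seq rewindInp (seq (emit fun _ _ _ => [.andOpen])
    (seq (loop1 (fun r _ _ => !r.2.2) (factBody h cell₀))
      (seq (setReg fun _ => (relStart, false, false)) (seq (reset (allTracks h 0))
        (seq (loop1 (fun r _ _ => !r.2.2) (clauseBody h F bad))
          (emit fun _ _ _ => [.andClose]))))))))

variable {h}

/-- The two loops end by overflow of their counters, after all positions and after all words with
six tracks; the invariant of each loop is the output accumulated so far. -/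
theorem ends_transducer (hh : 0 < h) (hS : (w.length + 1).size + 1 < S) :
    ∃ r i t, Ends w (InSpace S) (transducer h cell₀ F bad)
      (start (relStart, false, false) none)
      (mem1 r i 0 t (NNF.conjL (allClauses h cell₀ F bad w (w.length + 1).size)).encode) := by
  set ℓ := (w.length + 1).size with hℓ
  have hB : 0 < (2 * h + 1) ^ ℓ := by positivity
  have hT : 0 < trackCount h ^ ℓ := Nat.pow_pos (trackCount_pos h)
  have hbin : (binWord h (w.length + 1)).length = ℓ := by simp [binWord, hℓ]
  -- The overflow flag is set after the last loop, and the input head remains where the loop over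
  -- the facts has left it.
  refine ⟨(relStart, false, true),
    min ((2 * h + 1) ^ ℓ - centre h ℓ) (w.length + 1),
    wordTape (trackWord h ℓ (trackCount h ^ ℓ)), ?_⟩
  have e0 : (start (relStart, false, false) none : Mem NNF.Symb Regs (Option (Tracks h)) Unit) =
      mem1 (relStart, false, false) 0 0 (wordTape []) [] := by
    simp only [start, mem1, Mem.mk.injEq, true_and, and_true]
    funext _ z
    simp [wordTape]
  -- The list is nonempty because it contains `(2 * h + 1) ^ ℓ` facts.
  rw [e0, NNF.encode_conjL (by
    intro e
    have := congrArg List.length e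
    simp [allClauses] at this)]
  have h1 := Ends.loop_count (w := w) (S := S) (c := fun r _ _ => !r.2.2) (p := factBody h cell₀)
    ((2 * h + 1) ^ ℓ)
    (fun d => (relStart, decide (centre h ℓ < d), decide (d = (2 * h + 1) ^ ℓ)))
    (fun d => min (d - centre h ℓ) (w.length + 1)) (fun d => wordTape (posWord h ℓ d))
    (fun d => [.andOpen] ++ ((List.range d).map (fact h cell₀ w ℓ)).flatMap NNF.encode)
    (fun d hd => ⟨by simp; omega, by
      have := ends_factBody (w := w) (o := [.andOpen] ++
        ((List.range d).map (fact h cell₀ w ℓ)).flatMap NNF.encode) cell₀ ℓ d hd hS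
      simpa [List.range_succ] using this⟩)
    (by simp)
  have h2 := Ends.loop_count (w := w) (S := S) (c := fun r _ _ => !r.2.2)
    (p := clauseBody h F bad) (trackCount h ^ ℓ)
    (fun k => (relStart, false, decide (k = trackCount h ^ ℓ)))
    (fun _ => min ((2 * h + 1) ^ ℓ - centre h ℓ) (w.length + 1))
    (fun k => wordTape (trackWord h ℓ k))
    (fun k => [.andOpen] ++ (((List.range ((2 * h + 1) ^ ℓ)).map (fact h cell₀ w ℓ)).flatMap
      NNF.encode ++ ((List.range k).flatMap fun k =>
      if relOk h (trackWord h ℓ k) then clauses h F bad (trackWord h ℓ k) else []).flatMap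
      NNF.encode))
    (fun k hk => ⟨by simp; omega, by
      have := ends_clauseBody (w := w) (i := min ((2 * h + 1) ^ ℓ - centre h ℓ) (w.length + 1))
        (o := [.andOpen] ++ (((List.range ((2 * h + 1) ^ ℓ)).map (fact h cell₀ w ℓ)).flatMap
      NNF.encode ++ ((List.range k).flatMap fun k =>
      if relOk h (trackWord h ℓ k) then clauses h F bad (trackWord h ℓ k) else []).flatMap
      NNF.encode)) F bad ℓ k hk hS
      convert this using 2
      rw [List.range_succ]
      split_ifs with h3 <;> simp [h3]⟩)
    (by simp)
  have h3 := ends_reset (w := w) (r := (relStart, false, false)) (i := w.length + 1) (o := [])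
    (constTracks h 0) (binWord h (w.length + 1)) (S := S) (by omega)
  have h4 := ends_emit (w := w) (S := S) (r := (relStart, false, false)) (i := 0)
    (t := wordTape (List.replicate (binWord h (w.length + 1)).length (constTracks h 0)))
    (o := []) (h := 0) (fun _ _ _ => [NNF.Symb.andOpen]) (by omega)
  have h5 := ends_reset (w := w) (r := (relStart, false, false))
    (i := min ((2 * h + 1) ^ ℓ - centre h ℓ) (w.length + 1)) (S := S)
    (o := [.andOpen] ++ ((List.range ((2 * h + 1) ^ ℓ)).map (fact h cell₀ w ℓ)).flatMap NNF.encode)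
    (allTracks h 0) (posWord h ℓ ((2 * h + 1) ^ ℓ)) (by simp only [posWord, length_digits]; omega)
  -- At index 0 the flags are false, the words are constant and the loop has contributed no output;
  -- in this form each loop starts in the memory that its predecessor leaves.
  simp only [posWord, digits_zero, length_digits, hbin, Nat.not_lt_zero, decide_false, hB.ne,
    Nat.zero_sub, Nat.zero_min, List.range_zero, List.map_nil, List.flatMap_nil,
    List.append_nil, trackWord, hT.ne, decide_true, List.nil_append] at h1 h2 h3 h4 h5
  refine (ends_layout hh hS).seq (h3.seq (ends_rewindInp.seq
    (h4.seq (h1.seq ((ends_setReg _ (by omega)).seq (h5.seq (h2.seq ?_)))))))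
  have h6 := ends_emit (w := w) (S := S) (r := (relStart, false, true))
    (i := min ((2 * h + 1) ^ ℓ - centre h ℓ) (w.length + 1))
    (t := wordTape (trackWord h ℓ (trackCount h ^ ℓ))) (h := 0)
    (o := [NNF.Symb.andOpen] ++ (allClauses h cell₀ F bad w ℓ).flatMap NNF.encode)
    (fun _ _ _ => [.andClose]) (by omega)
  rw [allClauses, List.flatMap_append, List.append_assoc] at h6
  rw [allClauses, List.flatMap_append]
  exact h6

end Prog

/-! ### Space-time diagrams of Turing machines -/

namespace TM

variable {α : Type}

instance (M : TM α Empty) : Finite M.State := M.finiteState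
instance (M : TM α Empty) : Finite M.Γ := M.finiteΓ
instance (M : TM α Empty) : Finite M.ι := M.finiteι

/-- The contents of a cell of a space-time diagram: the state (at the position of the heads only),
the contents of the work tapes, and the contents of the input tape together with the information
whether the cell is at (or beyond) its left or right end. -/
abbrev Cell (M : TM α Empty) : Type :=
  Option M.State × (M.ι → M.Γ) × Option α × Bool × Bool

/-- The contents of the cell `x` of the input tape. -/
def inCell (w : List α) (x : ℤ) : Option α × Bool × Bool :=
  (readInput w x.toNat, decide (x ≤ 0), decide ((w.length : ℤ) + 1 ≤ x))

/-- The contents of the tapes at distance `d` from the heads. -/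
def row (M : TM α Empty) (w : List α) (c : M.Cfg) (d : ℤ) : M.Cell :=
  (if d = 0 then some c.state else none, fun i => c.tape i (c.head i + d),
    inCell w (c.inputHead + d))

/-- The neighbour of a cell in the direction of a move. -/
def pick {C : Type} (m : Move) (c₁ c₂ c₃ : C) : C :=
  match m with
  | .left => c₁
  | .stay => c₂
  | .right => c₃

/-- The rule of a space-time diagram: `c₀` is the cell at the position of the heads, and `c₁`, `c₂`,
`c₃` are three consecutive cells. -/
def cellRule (M : TM α Empty) (c₀ c₁ c₂ c₃ : M.Cell) : M.Cell :=
  match c₀.1.bind fun q => M.δ q c₀.2.2.1 c₀.2.1 with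
  | none => c₂
  | some a =>
    (c₂.1.map fun _ => a.next,
      fun i => if (pick (a.move i) c₁ c₂ c₃).1.isSome then a.write i
        else (pick (a.move i) c₁ c₂ c₃).2.1 i,
      match a.inputMove with
      | .left => if c₀.2.2.2.1 then c₂.2.2 else c₁.2.2
      | .stay => c₂.2.2
      | .right => if c₀.2.2.2.2 then c₂.2.2 else c₃.2.2)

variable {M : TM α Empty} {w : List α}

/-- The centre alone determines the action, since it holds the state and everything that the heads
scan. -/
theorem row_zero_bind (c : M.Cfg) :
    ((M.row w c 0).1.bind fun q => M.δ q (M.row w c 0).2.2.1 (M.row w c 0).2.1) =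
      M.action w c := by
  simp [row, inCell, action]

theorem pick_row (m : Move) (c : M.Cfg) (d : ℤ) :
    pick m (M.row w c (d - 1)) (M.row w c d) (M.row w c (d + 1)) = M.row w c (d + m.toInt) := by
  cases m <;> simp [pick, Move.toInt, sub_eq_add_neg]

/-- A move of a head shifts its tape the other way, so each component of a cell is copied from one
of three neighbours, chosen by the action at the centre. Different tapes may shift differently, as
the choice is made for each tape separately. The end flags of the centre tell when the input head is
held back. -/
theorem row_step (c : M.Cfg) (hc : c.inputHead ≤ w.length + 1) (d : ℤ) :
    M.row w (M.step w c) d =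
      M.cellRule (M.row w c 0) (M.row w c (d - 1)) (M.row w c d) (M.row w c (d + 1)) := by
  rw [cellRule, row_zero_bind, step]
  cases ha : M.action w c with
  | none => rfl
  | some a =>
    simp only [pick_row]
    refine Prod.ext ?_ (Prod.ext ?_ ?_)
    · simp only [row]
      split_ifs <;> rfl
    · funext i
      -- Distance `d` from the new head is distance `d + (a.move i).toInt` from the old one; if that
      -- is 0, it is the cell just written.
      by_cases hd : d + (a.move i).toInt = 0
      · have : c.head i + (a.move i).toInt + d = c.head i := by omega
        simp [row, hd, this]
      · have h1 : c.head i + (a.move i).toInt + d ≠ c.head i := by omega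
        simp only [row, hd, Function.update_of_ne h1, if_false, Option.isSome_none,
          Bool.false_eq_true]
        congr 1
        ring
    · have hL : (M.row w c 0).2.2.2.1 = decide (c.inputHead = 0) := by
        simp [row, inCell]
      -- The flag means at or beyond the right end; by `hc` the input head is never beyond it.
      have hR : (M.row w c 0).2.2.2.2 = decide (c.inputHead = w.length + 1) := by
        simp only [row, inCell, add_zero]
        rw [Bool.eq_iff_iff]
        simp only [decide_eq_true_eq]
        omega
      rw [hL, hR]
      change inCell w ((moveInput w.length c.inputHead a.inputMove : ℕ) + d) = _
      cases a.inputMove with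
      | left =>
        simp only [decide_eq_true_eq, moveInput]
        split_ifs with h <;> exact congrArg (inCell w) (by omega)
      | stay => rfl
      | right =>
        simp only [decide_eq_true_eq, moveInput]
        split_ifs with h <;> exact congrArg (inCell w) (by omega)

theorem cfgAt_succ (t : ℕ) : M.cfgAt w (t + 1) = M.step w (M.cfgAt w t) :=
  Function.iterate_succ_apply' _ _ _

theorem inputHead_cfgAt (t : ℕ) : (M.cfgAt w t).inputHead ≤ w.length + 1 := by
  induction t with
  | zero => exact Nat.zero_le _
  | succ t ih =>
    rw [cfgAt_succ, step]
    cases M.action w (M.cfgAt w t) with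
    | none => exact ih
    | some a =>
      simp only
      cases a.inputMove <;> simp only [moveInput] <;> omega

theorem row_cfgAt_succ (t : ℕ) (d : ℤ) :
    M.row w (M.cfgAt w (t + 1)) d =
      M.cellRule (M.row w (M.cfgAt w t) 0) (M.row w (M.cfgAt w t) (d - 1))
        (M.row w (M.cfgAt w t) d) (M.row w (M.cfgAt w t) (d + 1)) := by
  rw [cfgAt_succ, row_step _ (inputHead_cfgAt t)]

theorem cfgAt_of_halted {s t : ℕ} (hst : s ≤ t) (h : M.Halted w (M.cfgAt w s)) :
    M.cfgAt w t = M.cfgAt w s := by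
  rw [cfgAt, ← Nat.sub_add_cancel hst, Function.iterate_add_apply]
  have h1 : M.step w (M.cfgAt w s) = M.cfgAt w s := by
    unfold Halted at h
    simp [step, h]
  exact Function.iterate_fixed h1 _

/-- The contents of the cell at the position of the heads in a rejecting halted configuration. -/
def BadCell (M : TM α Empty) (c : M.Cell) : Prop :=
  ∃ q, c.1 = some q ∧ M.δ q c.2.2.1 c.2.1 = none ∧ q ∉ M.accept

theorem badCell_row (c : M.Cfg) :
    M.BadCell (M.row w c 0) ↔ M.Halted w c ∧ c.state ∉ M.accept := by
  simp [BadCell, row, inCell, Halted, action]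

/-- The contents of the cells of the initial configuration, depending on whether the cell is to the
right of the heads, or at their position, and on the input symbol. -/
def startCell (M : TM α Empty) (right here : Bool) (a : Option α) : M.Cell :=
  (if here then some M.start else none, fun _ => M.blank, a, !right, right && a.isNone)

theorem row_init (d c : ℕ) : M.row w M.init ((d : ℤ) - c) =
    M.startCell (decide (c < d)) (decide (d = c))
      (readInput w (min (d - c) (w.length + 1))) := by
  have e1 : (((M.init.inputHead : ℕ) : ℤ) + ((d : ℤ) - c)).toNat = d - c := by
    simp only [init]
    omega
  -- Beyond the right end marker only `none` is read, so it does no harm that the input head stops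
  -- there.
  have e2 : readInput w (min (d - c) (w.length + 1)) = readInput w (d - c) := by
    rcases Nat.le_total (d - c) (w.length + 1) with h | h
    · rw [min_eq_left h]
    · rw [min_eq_right h]
      obtain ⟨k, hk⟩ := Nat.exists_eq_add_of_le h
      rw [hk, show w.length + 1 + k = w.length + k + 1 by omega]
      simp [readInput]
  rw [e2]
  refine Prod.ext ?_ (Prod.ext rfl (Prod.ext ?_ (Prod.ext ?_ ?_)))
  · simp only [row, startCell, init, decide_eq_true_eq]
    have : (d : ℤ) - c = 0 ↔ d = c := by omega
    simp only [this]
  · simp only [row, startCell, inCell, e1]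
  · change decide (((0 : ℕ) : ℤ) + ((d : ℤ) - c) ≤ 0) = !decide (c < d)
    rw [Bool.eq_iff_iff]
    simp
  · change decide ((w.length : ℤ) + 1 ≤ ((0 : ℕ) : ℤ) + ((d : ℤ) - c)) =
      (decide (c < d) && (readInput w (d - c)).isNone)
    rw [Bool.eq_iff_iff]
    simp only [decide_eq_true_eq, Bool.and_eq_true, Option.isNone_iff_eq_none]
    constructor
    · intro h
      refine ⟨by omega, ?_⟩
      obtain ⟨k, hk⟩ : ∃ k, d - c = w.length + k + 1 := ⟨d - c - w.length - 1, by omega⟩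
      simp [hk, readInput]
    · rintro ⟨h1, h2⟩
      by_contra h
      obtain ⟨k, hk⟩ : ∃ k, d - c = k + 1 := ⟨d - c - 1, by omega⟩
      rw [hk, readInput, List.getElem?_eq_none_iff] at h2
      omega

end TM

/-! ### Correctness of the reduction. -/

namespace Prog

variable {α : Type} [Finite α] {h : ℕ}

theorem pair_ext {B : ℕ} {l l' : List (Fin B × Fin B)} (hl : l.length = l'.length)
    (h1 : val (l.map Prod.fst) = val (l'.map Prod.fst))
    (h2 : val (l.map Prod.snd) = val (l'.map Prod.snd)) : l = l' := by
  have e1 := val_inj (by simpa using hl) h1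
  have e2 := val_inj (by simpa using hl) h2
  have e : ∀ l : List (Fin B × Fin B), l = (l.map Prod.fst).zip (l.map Prod.snd) := fun l =>
    List.zip_of_prod rfl rfl
  rw [e l, e l', e1, e2]

/-- The word whose tracks are given numbers. -/
def tracksOf (h : ℕ) : ℕ → (Fin 6 → ℕ) → List (Tracks h)
  | 0, _ => []
  | ℓ + 1, n => (fun j => Fin.ofNat (2 * h + 1) (n j % (2 * h + 1))) ::
    tracksOf h ℓ fun j => n j / (2 * h + 1)

theorem length_tracksOf (ℓ : ℕ) (n : Fin 6 → ℕ) : (tracksOf h ℓ n).length = ℓ := by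
  induction ℓ generalizing n with
  | zero => rfl
  | succ ℓ ih => simp [tracksOf, ih]

theorem map_tracksOf (ℓ : ℕ) (n : Fin 6 → ℕ) (j : Fin 6) :
    (tracksOf h ℓ n).map (fun g => g j) =
      digits (fun i => Fin.ofNat (2 * h + 1) i) (2 * h + 1) ℓ (n j) := by
  induction ℓ generalizing n with
  | zero => rfl
  | succ ℓ ih => simp only [tracksOf, List.map_cons, ih, digits]

theorem val_tracksOf (ℓ : ℕ) (n : Fin 6 → ℕ) (j : Fin 6) (hn : n j < (2 * h + 1) ^ ℓ) :
    val ((tracksOf h ℓ n).map fun g => g j) = n j := by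
  rw [map_tracksOf]
  exact val_digits ℓ _ hn

theorem relOk_tracksOf (ℓ s d : ℕ) (hs : s + 1 < (2 * h + 1) ^ ℓ) (hd : d + 2 < (2 * h + 1) ^ ℓ) :
    relOk h (tracksOf h ℓ ![s, s + 1, centre h ℓ, d, d + 1, d + 2]) = true := by
  have hc := two_mul_centre h ℓ
  rw [relOk_iff]
  refine ⟨?_, ?_, ?_, ?_⟩
  · rw [val_tracksOf _ _ _ (by simpa using hs), val_tracksOf _ _ _ (by simp; omega)]
    rfl
  · have : (tracksOf h ℓ ![s, s + 1, centre h ℓ, d, d + 1, d + 2]).map (fun g => g 2) =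
        List.replicate ℓ (mid h) := by
      apply val_inj
      · simp [length_tracksOf]
      · rw [val_tracksOf _ _ _ (by simp; omega)]
        rfl
    rw [List.eq_replicate_iff] at this
    simpa using this.2
  · rw [val_tracksOf _ _ _ (by simp; omega), val_tracksOf _ _ _ (by simp; omega)]
    rfl
  · rw [val_tracksOf _ _ _ (by simp; omega), val_tracksOf _ _ _ (by simp; omega)]
    rfl

theorem exists_trackWord (ℓ : ℕ) (l : List (Tracks h)) (hl : l.length = ℓ) :
    ∃ k < trackCount h ^ ℓ, trackWord h ℓ k = l := by
  subst hl
  exact exists_digits (trackCount_pos h) (exists_allTracks h) l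

variable (M : TM α Empty) (w : List α) (ℓ : ℕ)

open Classical in
/-- All clauses that describe the computation of a Turing machine. -/
noncomputable def compClauses (h : ℕ) : List NNF :=
  allClauses h M.startCell M.cellRule (fun c => decide (M.BadCell c)) w ℓ

variable {M w ℓ}

theorem compClauses_ne_nil : compClauses M w ℓ h ≠ [] := by
  intro e
  have := congrArg List.length e
  simp [compClauses, allClauses] at this

/-- This removes the enumeration: the clauses are indexed by all words whose tracks are related as
required, and the semantic arguments below use only this form. -/
theorem forall_compClauses (P : NNF → Prop) : (∀ φ ∈ compClauses M w ℓ h, P φ) ↔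
    (∀ d < (2 * h + 1) ^ ℓ, P (fact h M.startCell w ℓ d)) ∧
    ∀ l : List (Tracks h), l.length = ℓ → relOk h l = true →
      (∀ σ : M.Cell × M.Cell × M.Cell × M.Cell, P (.disjL
        [cellLit h false (sel h 0 2) l σ.1, cellLit h false (sel h 0 3) l σ.2.1,
          cellLit h false (sel h 0 4) l σ.2.2.1, cellLit h false (sel h 0 5) l σ.2.2.2,
          cellLit h true (sel h 1 4) l (M.cellRule σ.1 σ.2.1 σ.2.2.1 σ.2.2.2)])) ∧
      ∀ σ : M.Cell, M.BadCell σ → P (cellLit h false (sel h 0 2) l σ) := by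
  let _ := Fintype.ofFinite M.Cell
  constructor
  · intro H
    refine ⟨fun d hd => H _ ?_, fun l hl hr => ?_⟩
    · simp only [compClauses, allClauses, List.mem_append, List.mem_map, List.mem_range]
      exact .inl ⟨d, hd, rfl⟩
    · obtain ⟨k, hk, rfl⟩ := exists_trackWord ℓ l hl
      have H' : ∀ φ ∈ clauses h M.cellRule _ (trackWord h ℓ k), P φ := fun φ hφ => H φ (by
        simp only [compClauses, allClauses, List.mem_append, List.mem_flatMap, List.mem_range]
        exact .inr ⟨k, hk, by rw [if_pos hr]; exact hφ⟩)
      refine ⟨fun σ => H' _ ?_, fun σ hσ => H' _ ?_⟩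
      · simp only [clauses, List.mem_append, List.mem_map, Finset.mem_toList]
        exact .inl ⟨σ, Finset.mem_univ _, rfl⟩
      · simp only [clauses, List.mem_append, List.mem_map, Finset.mem_toList]
        exact .inr ⟨σ, by simpa using hσ, rfl⟩
  · rintro ⟨H1, H2⟩ φ hφ
    simp only [compClauses, allClauses, List.mem_append, List.mem_map, List.mem_range,
      List.mem_flatMap] at hφ
    rcases hφ with ⟨d, hd, rfl⟩ | ⟨k, hk, hφ⟩
    · exact H1 d hd
    · split_ifs at hφ with hr
      · obtain ⟨H3, H4⟩ := H2 _ (by simp [trackWord]) hr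
        simp only [clauses, List.mem_append, List.mem_map, Finset.mem_toList,
          Finset.mem_filter, decide_eq_true_eq] at hφ
        rcases hφ with ⟨σ, -, rfl⟩ | ⟨σ, hσ, rfl⟩
        · exact H3 σ
        · exact H4 σ hσ.2
      · simp at hφ

/-- In each disjunction only the last literal is positive. -/
theorem isHNF_compClauses : (NNF.conjL (compClauses M w ℓ h)).IsHNF := by
  refine NNF.isHNF_conjL ((forall_compClauses _).2 ⟨fun d _ => trivial, fun l _ _ =>
    ⟨fun σ => ?_, fun σ _ => trivial⟩⟩)
  refine ⟨fun i => ?_, fun i j hi hj => ?_⟩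
  · fin_cases i <;> trivial
  · fin_cases i <;> fin_cases j <;> first | rfl | exact absurd rfl hi | exact absurd rfl hj

/-- The interpretation given by the computation. -/
def compVal (M : TM α Empty) (w : List α) (h ℓ : ℕ) (x : PVar) : Prop :=
  ∃ (l : List (Fin (2 * h + 1) × Fin (2 * h + 1))) (σ : M.Cell), l.length = ℓ ∧ x = name l σ ∧
    M.row w (M.cfgAt w (val (l.map Prod.fst)))
      ((val (l.map Prod.snd) : ℤ) - centre h ℓ) = σ

/-- Since `name` is injective for words of length `ℓ`, a variable determines the time, the position
and the content that it speaks of. -/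
theorem compVal_name (l : List (Fin (2 * h + 1) × Fin (2 * h + 1))) (hl : l.length = ℓ)
    (σ : M.Cell) : compVal M w h ℓ (name l σ) ↔
      M.row w (M.cfgAt w (val (l.map Prod.fst)))
        ((val (l.map Prod.snd) : ℤ) - centre h ℓ) = σ := by
  constructor
  · rintro ⟨l', σ', hl', e, H⟩
    obtain ⟨rfl, rfl⟩ := name_inj (hl.trans hl'.symm) e
    exact H
  · intro H
    exact ⟨l, σ, hl, rfl, H⟩

theorem map_sel_fst (l : List (Tracks h)) (i j : Fin 6) :
    (l.map (sel h i j)).map Prod.fst = l.map fun g => g i := by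
  rw [List.map_map]
  rfl

theorem map_sel_snd (l : List (Tracks h)) (i j : Fin 6) :
    (l.map (sel h i j)).map Prod.snd = l.map fun g => g j := by
  rw [List.map_map]
  rfl

theorem val_map_zero {G : Type} (l : List G) : val (l.map fun _ => (0 : Fin (2 * h + 1))) = 0 := by
  induction l with
  | nil => rfl
  | cons g l ih => rw [List.map_cons, val, ih, Fin.val_zero, mul_zero, add_zero]

theorem map_selStart_fst (l : List (Tracks h)) :
    (l.map (selStart h)).map Prod.fst = l.map fun _ => 0 := by
  rw [List.map_map]
  rfl

theorem map_selStart_snd (l : List (Tracks h)) :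
    (l.map (selStart h)).map Prod.snd = l.map fun g => g 0 := by
  rw [List.map_map]
  rfl

theorem compVal_sel (l : List (Tracks h)) (hl : l.length = ℓ) (i j : Fin 6) (σ : M.Cell) :
    compVal M w h ℓ (name (l.map (sel h i j)) σ) ↔
      M.row w (M.cfgAt w (val (l.map fun g => g i)))
        ((val (l.map fun g => g j) : ℤ) - centre h ℓ) = σ := by
  rw [compVal_name _ (by simpa using hl), map_sel_fst, map_sel_snd]

theorem val_of_forall_mid (l : List (Tracks h)) (hl : l.length = ℓ) (H : ∀ g ∈ l, g 2 = mid h) :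
    val (l.map fun g => g 2) = centre h ℓ := by
  rw [centre]
  congr 1
  rw [List.eq_replicate_iff]
  simpa [hl] using H

open Classical in
-- The actual computation is a model: it starts with the initial row, obeys the rule, and is never
-- in a rejecting halted configuration. No time bound is needed, because the diagram is defined for
-- all times and all distances.
theorem holds_of_accepts (hM : ∀ t, M.Halted w (M.cfgAt w t) → (M.cfgAt w t).state ∈ M.accept) :
    (NNF.conjL (compClauses M w ℓ h)).Satisfiable := by
  refine ⟨fun x => decide (compVal M w h ℓ x), ?_⟩
  rw [NNF.holds_conjL compClauses_ne_nil, forall_compClauses]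
  refine ⟨fun d hd => ?_, fun l hl hr => ⟨fun σ => ?_, fun σ hσ => ?_⟩⟩
  · simp only [fact, cellLit, NNF.Holds, decide_eq_true_eq]
    rw [compVal_name _ (by simp [posWord]), map_selStart_fst, map_selStart_snd, val_map_zero,
      val_posWord h ℓ d hd]
    exact TM.row_init d _
  · rw [NNF.holds_disjL (by simp)]
    rw [relOk_iff] at hr
    obtain ⟨h1, h2, h3, h4⟩ := hr
    simp only [List.mem_cons, List.not_mem_nil, or_false, exists_eq_or_imp, exists_eq_left,
      cellLit, NNF.Holds, decide_eq_true_eq, decide_eq_false_iff_not, compVal_sel l hl]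
    by_contra! H
    obtain ⟨H0, H1, H2, H3, H4⟩ := H
    apply H4
    rw [h1, TM.row_cfgAt_succ, ← H0, ← H1, ← H2, ← H3, val_of_forall_mid l hl h2, h4, h3]
    push_cast
    congr 2 <;> ring
  · simp only [cellLit, NNF.Holds, decide_eq_false_iff_not, compVal_sel l hl]
    rw [relOk_iff] at hr
    rw [val_of_forall_mid l hl hr.2.1, sub_self]
    rintro rfl
    rw [TM.badCell_row] at hσ
    exact hσ.2 (hM _ hσ.1)

/-- Forward chaining: the variables derived from the facts by the rules are true in every model. A
cell needs both neighbours one step earlier, so one position is lost at each end per step; hence the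
bounds `t ≤ d` and `d + t < (2 * h + 1) ^ ℓ`, which always leave the centre inside when `d` is. -/
theorem row_of_holds {v : PVar → Bool} (hv : (NNF.conjL (compClauses M w ℓ h)).Holds v)
    (t : ℕ) : ∀ d, t ≤ d → d + t < (2 * h + 1) ^ ℓ →
      ∀ l : List (Fin (2 * h + 1) × Fin (2 * h + 1)), l.length = ℓ → val (l.map Prod.fst) = t →
        val (l.map Prod.snd) = d →
        v (name l (M.row w (M.cfgAt w t) ((d : ℤ) - centre h ℓ))) = true := by
  rw [NNF.holds_conjL compClauses_ne_nil, forall_compClauses] at hv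
  obtain ⟨hv1, hv2⟩ := hv
  have hc := two_mul_centre h ℓ
  induction t with
  | zero =>
    intro d _ hd l hl h1 h2
    have := hv1 d (by omega)
    simp only [fact, cellLit, NNF.Holds] at this
    rw [← TM.row_init] at this
    have e : l = (posWord h ℓ d).map (selStart h) := by
      apply pair_ext
      · simp [posWord, hl]
      · rw [h1, map_selStart_fst, val_map_zero]
      · rw [h2, map_selStart_snd, val_posWord h ℓ d (by omega)]
    rw [e]
    exact this
  | succ t ih =>
    intro d hd hd' l hl h1 h2
    -- The cell in question sits on the middle one of the three position tracks, so its left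
    -- neighbour becomes the new `d`.
    obtain ⟨d, rfl⟩ : ∃ d', d = d' + 1 := ⟨d - 1, by omega⟩
    set u := tracksOf h ℓ ![t, t + 1, centre h ℓ, d, d + 1, d + 2] with hu
    have hul : u.length = ℓ := length_tracksOf _ _
    have v0 : val (u.map fun g => g 0) = t := val_tracksOf _ _ 0 (by simp; omega)
    have v1 : val (u.map fun g => g 1) = t + 1 := val_tracksOf _ _ 1 (by simp; omega)
    have v2 : val (u.map fun g => g 2) = centre h ℓ := val_tracksOf _ _ 2 (by simp; omega)
    have v3 : val (u.map fun g => g 3) = d := val_tracksOf _ _ 3 (by simp; omega)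
    have v4 : val (u.map fun g => g 4) = d + 1 := val_tracksOf _ _ 4 (by simp; omega)
    have v5 : val (u.map fun g => g 5) = d + 2 := val_tracksOf _ _ 5 (by simp; omega)
    -- The rule is instantiated with the true contents of the four cells; by induction its negative
    -- disjuncts fail and only the positive one remains.
    have hu' := (hv2 u hul (relOk_tracksOf ℓ t d (by omega) (by omega))).1
      (M.row w (M.cfgAt w t) ((centre h ℓ : ℤ) - centre h ℓ),
        M.row w (M.cfgAt w t) ((d : ℤ) - centre h ℓ),
        M.row w (M.cfgAt w t) (((d + 1 : ℕ) : ℤ) - centre h ℓ),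
        M.row w (M.cfgAt w t) (((d + 2 : ℕ) : ℤ) - centre h ℓ))
    rw [NNF.holds_disjL (by simp)] at hu'
    simp only [List.mem_cons, List.not_mem_nil, or_false, exists_eq_or_imp, exists_eq_left,
      cellLit, NNF.Holds] at hu'
    have H : ∀ j d', t ≤ d' → d' + t < (2 * h + 1) ^ ℓ → val (u.map fun g => g j) = d' →
        v (name (u.map (sel h 0 j)) (M.row w (M.cfgAt w t) ((d' : ℤ) - centre h ℓ))) = true :=
      fun j d' h3 h4 h5 => ih d' h3 h4 _ (by simpa using hul) (by rw [map_sel_fst, v0])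
        (by rw [map_sel_snd, h5])
    rw [H 2 _ (by omega) (by omega) v2, H 3 _ (by omega) (by omega) v3,
      H 4 _ (by omega) (by omega) v4, H 5 _ (by omega) (by omega) v5] at hu'
    simp only [Bool.true_eq_false, false_or] at hu'
    have e : l = u.map (sel h 1 4) := by
      apply pair_ext
      · simp [hul, hl]
      · rw [h1, map_sel_fst, v1]
      · rw [h2, map_sel_snd, v4]
    rw [e, TM.row_cfgAt_succ, ← hu']
    congr 3
    · rw [sub_self]
    all_goals
      congr 1
      push_cast
      ring

/-- As `T` is less than the middle number, the centre at time `T` is among the cells that every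
model must contain, and a rejecting content would violate a negative unit clause. -/
theorem accepts_of_satisfiable (hs : (NNF.conjL (compClauses M w ℓ h)).Satisfiable) {T : ℕ}
    (hT : T < centre h ℓ) (hh : M.Halted w (M.cfgAt w T)) :
    (M.cfgAt w T).state ∈ M.accept := by
  obtain ⟨v, hv⟩ := hs
  have H := row_of_holds hv T
  rw [NNF.holds_conjL compClauses_ne_nil, forall_compClauses] at hv
  have hc := two_mul_centre h ℓ
  by_contra hacc
  -- The unit clause concerns only the time and the centre; `d` merely fills the position tracks
  -- within the range.
  obtain ⟨d, hd⟩ : ∃ d, centre h ℓ = d + 1 := ⟨centre h ℓ - 1, by omega⟩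
  have h1 := (hv.2 _ (length_tracksOf _ _) (relOk_tracksOf ℓ T d (by omega) (by omega))).2
    (M.row w (M.cfgAt w T) 0) (TM.badCell_row _ |>.2 ⟨hh, hacc⟩)
  have h2 := H (centre h ℓ) hT.le (by omega)
    ((tracksOf h ℓ ![T, T + 1, centre h ℓ, d, d + 1, d + 2]).map (sel h 0 2))
    (by simp [length_tracksOf]) (by
      rw [map_sel_fst, val_tracksOf _ _ _ (by simp; omega)]; rfl) (by
      rw [map_sel_snd, val_tracksOf _ _ _ (by simp; omega)]; rfl)
  rw [sub_self] at h2
  simp only [cellLit, NNF.Holds] at h1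
  rw [h1] at h2
  exact Bool.false_ne_true h2

theorem polynomial_eval_le (p : Polynomial ℕ) (n : ℕ) :
    p.eval n ≤ p.eval 1 * (n + 1) ^ p.natDegree := by
  rw [Polynomial.eval_eq_sum_range, Polynomial.eval_eq_sum_range, Finset.sum_mul]
  refine Finset.sum_le_sum fun i hi => ?_
  rw [one_pow, mul_one]
  refine Nat.mul_le_mul_left _ ?_
  exact (Nat.pow_le_pow_left (Nat.le_succ n) i).trans
    (Nat.pow_le_pow_right (Nat.succ_pos n) (by simpa [Nat.lt_succ_iff] using hi))

/-- Twice the middle number is `(2 * h + 1) ^ ℓ - 1`, hence at least `(2 * h) ^ ℓ`, which is at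
least twice `h ^ ℓ`. -/
theorem pow_le_centre (h ℓ : ℕ) (hℓ : 0 < ℓ) : h ^ ℓ ≤ centre h ℓ := by
  have h1 := two_mul_centre h ℓ
  have h2 : (2 * h) ^ ℓ < (2 * h + 1) ^ ℓ := Nat.pow_lt_pow_left (by omega) (by omega)
  have h3 : 2 * h ^ ℓ ≤ (2 * h) ^ ℓ := by
    rw [mul_pow]
    exact Nat.mul_le_mul_right _ (Nat.le_self_pow (by omega) 2)
  omega

/-- The base depends on the polynomial only. With `ℓ` the binary length of `n + 1` one has `n + 1 <
2 ^ ℓ`, so a power of `n + 1` is absorbed by the same power of 2 in the base, and the coefficients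
by the factor `p.eval 1 + 1`. -/
theorem eval_lt_centre (p : Polynomial ℕ) (n : ℕ) :
    p.eval n < centre ((p.eval 1 + 1) * 2 ^ p.natDegree) (n + 1).size := by
  set k := p.natDegree
  set A := p.eval 1
  set ℓ := (n + 1).size with hℓ
  have hpos : 0 < ℓ := Nat.size_pos.2 (Nat.succ_pos n)
  have h2 : n + 1 < 2 ^ ℓ := Nat.lt_size_self _
  calc p.eval n ≤ A * (n + 1) ^ k := polynomial_eval_le p n
    _ < (A + 1) * (n + 1) ^ k := by
      have : 0 < (n + 1) ^ k := by positivity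
      rw [add_mul]; omega
    _ ≤ (A + 1) ^ ℓ * (2 ^ ℓ) ^ k :=
      Nat.mul_le_mul (Nat.le_self_pow hpos.ne' _) (Nat.pow_le_pow_left h2.le k)
    _ = ((A + 1) * 2 ^ k) ^ ℓ := by rw [mul_pow, ← pow_mul, ← pow_mul, mul_comm ℓ k]
    _ ≤ _ := pow_le_centre _ _ hpos

theorem logSpaceReducible_HNFSAT {L : Language α} (hL : InP L) : LogSpaceReducible L HNFSAT := by
  classical
  obtain ⟨M, p, hM⟩ := hL
  set h := (p.eval 1 + 1) * 2 ^ p.natDegree with hh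
  have hpos : 0 < h := by positivity
  refine ⟨fun w => (NNF.conjL (compClauses M w (w.length + 1).size h)).encode,
    ⟨(transducer h M.startCell M.cellRule fun c => decide (M.BadCell c)).toTM
      (relStart, false, false) none ∅, 4, fun w => ?_⟩, fun w => ?_⟩
  · have hS : (w.length + 1).size + 1 < 4 * (Nat.log 2 w.length + 1) := by
      have : (w.length + 1).size ≤ Nat.log 2 w.length + 2 := by
        rw [Nat.size_le]
        have := Nat.lt_pow_succ_log_self one_lt_two w.length
        rw [pow_succ]
        have h1 : 0 < 2 ^ (Nat.log 2 w.length + 1) := by positivity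
        omega
      omega
    obtain ⟨r, i, t, T, hT⟩ := ends_transducer M.startCell M.cellRule
      (fun c => decide (M.BadCell c)) hpos hS
    refine ⟨⟨T, ?_, ?_⟩, fun s _ => ?_⟩
    · rw [hT.cfgAt]
      exact halted_cfg
    · rw [hT.cfgAt]
      rfl
    · obtain ⟨z, hz, hI⟩ := hT.cfgAt_inv (acc := ∅) s
      rw [hz]
      exact hI
  · obtain ⟨h1, h2⟩ := hM w
    rw [← h2]
    constructor
    · intro hacc
      -- A halted configuration at any time `t` coincides with the one at the time bound, whichever
      -- of the two times is earlier.
      refine ⟨_, isHNF_compClauses, holds_of_accepts fun t ht => ?_, rfl⟩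
      rcases Nat.le_total t (p.eval w.length) with h3 | h3
      · rwa [← TM.cfgAt_of_halted h3 ht]
      · rwa [TM.cfgAt_of_halted h3 h1]
    · rintro ⟨φ, -, hs, he⟩
      rw [NNF.encode_injective he] at hs
      exact accepts_of_satisfiable hs (eval_lt_centre p w.length) h1

end Prog

/-! ### Evaluation of formulas with marked literals -/

namespace NNF

/-- The length of the code of the first `i` of a family of formulas. -/
def offset {k : ℕ} (φ : Fin (k + 1) → NNF) (i : Fin (k + 1)) : ℕ :=
  (((List.ofFn fun j => (φ j).encode).take i).flatten).length

/-- The value of the formula whose code starts at position `o`, if the literal whose code starts at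
position `j` has the value `m j`. -/
noncomputable def ev (m : ℕ → Bool) : NNF → ℕ → Bool
  | lit _ _, o => m o
  | conj φ, o => open Classical in decide (∀ i, (φ i).ev m (o + 1 + offset φ i) = true)
  | disj φ, o => open Classical in decide (∃ i, (φ i).ev m (o + 1 + offset φ i) = true)

/-- At position `j` of the word there is the code of a literal. -/
def LitAt (W : List Symb) (j : ℕ) (s : Bool) (x : PVar) : Prop :=
  (lit s x).encode <+: W.drop j

theorem LitAt.unique {W : List Symb} {j : ℕ} {s s' : Bool} {x x' : PVar} (h : LitAt W j s x)
    (h' : LitAt W j s' x') : s = s' ∧ x = x' := by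
  obtain ⟨t, h⟩ := h
  obtain ⟨t', h'⟩ := h'
  obtain ⟨e, -⟩ := encode_append_inj _ _ _ _ (h.trans h'.symm)
  simpa using e

/-- This carries the hypothesis that a code stands at a position down to the arguments; the summand
1 skips the opening bracket. -/
theorem child_prefix {W : List Symb} {o : ℕ} {a b : Symb} {k : ℕ} (φ : Fin (k + 1) → NNF)
    (h : a :: ((List.ofFn fun i => (φ i).encode).flatten ++ [b]) <+: W.drop o) (i : Fin (k + 1)) :
    (φ i).encode <+: W.drop (o + 1 + offset φ i) := by
  obtain ⟨t, ht⟩ := h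
  set l := List.ofFn fun i => (φ i).encode with hl
  have hi : (i : ℕ) < l.length := by rw [hl, List.length_ofFn]; exact i.2
  have e : l.flatten = (l.take i).flatten ++ ((φ i).encode ++ (l.drop (i + 1)).flatten) := by
    conv_lhs => rw [← List.take_append_drop i l, List.drop_eq_getElem_cons hi]
    simp [hl, -List.ofFn_succ]
  rw [add_assoc, ← List.drop_drop, ← ht, e, add_comm 1]
  simp only [List.cons_append, List.drop_succ_cons, List.append_assoc]
  rw [offset, ← hl, List.drop_left]
  exact List.prefix_append _ _

/-- Conjunction and disjunction are monotone, and no negation occurs above a literal. -/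
theorem ev_mono {m m' : ℕ → Bool} (hm : ∀ j, m j = true → m' j = true) (φ : NNF) (o : ℕ)
    (h : φ.ev m o = true) : φ.ev m' o = true := by
  induction φ generalizing o with
  | lit s x => exact hm _ h
  | conj φ ih =>
    simp only [ev, decide_eq_true_eq] at h ⊢
    exact fun i => ih i _ (h i)
  | disj φ ih =>
    simp only [ev, decide_eq_true_eq] at h ⊢
    exact h.imp fun i => ih i _

variable {W : List Symb} {m : ℕ → Bool} {v : PVar → Bool}

theorem ev_of_holds (hm : ∀ j s x, LitAt W j s x → v x = s → m j = true) (φ : NNF) (o : ℕ)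
    (hW : φ.encode <+: W.drop o) (h : φ.Holds v) : φ.ev m o = true := by
  induction φ generalizing o with
  | lit s x => exact hm o s x hW h
  | conj φ ih =>
    simp only [ev, decide_eq_true_eq]
    exact fun i => ih i _ (child_prefix φ hW i) (h i)
  | disj φ ih =>
    simp only [ev, decide_eq_true_eq]
    exact h.imp fun i => ih i _ (child_prefix φ hW i)

/-- On negative literals the marks are at most as true as `v`; for a negative formula the value is
then at most the truth value under `v`. -/
theorem ev_of_isNegative (hm : ∀ j x, LitAt W j false x → v x = true → m j = false) (φ : NNF)
    (o : ℕ) (hW : φ.encode <+: W.drop o) (hn : φ.IsNegative) (h : ¬ φ.Holds v) :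
    φ.ev m o = false := by
  induction φ generalizing o with
  | lit s x =>
    obtain rfl : s = false := hn
    exact hm o x hW (by simpa [Holds] using h)
  | conj φ ih =>
    simp only [ev, decide_eq_false_iff_not]
    simp only [Holds, not_forall] at h
    obtain ⟨i, hi⟩ := h
    intro H
    have := ih i _ (child_prefix φ hW i) (hn i) hi
    rw [H i] at this
    exact absurd this (by simp)
  | disj φ ih =>
    simp only [ev, decide_eq_false_iff_not]
    simp only [Holds, not_exists] at h
    rintro ⟨i, hi⟩
    have := ih i _ (child_prefix φ hW i) (hn i) (h i)
    rw [hi] at this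
    exact absurd this (by simp)

/-- If a Horn-NNF formula is false, then so is its value, possibly after making a positive
literal false that is false already. -/
theorem exists_ev_eq_false (hm : ∀ j x, LitAt W j false x → v x = true → m j = false) (φ : NNF)
    (o : ℕ) (hW : φ.encode <+: W.drop o) (hn : φ.IsHNF) (h : ¬ φ.Holds v) :
    φ.ev m o = false ∨ ∃ j x, LitAt W j true x ∧ v x = false ∧
      φ.ev (Function.update m j false) o = false := by
  have hup : ∀ j k, Function.update m j false k = true → m k = true := fun j k hk => by
    by_cases e : k = j
    · subst e
      simp at hk
    · rwa [Function.update_of_ne e] at hk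
  induction φ generalizing o with
  | lit s x =>
    cases s with
    | false => exact .inl (hm o x hW (by simpa [Holds] using h))
    -- The literal to be blamed is this one, and its value is its own mark.
    | true => exact .inr ⟨o, x, hW, by simpa [Holds] using h, by simp [ev]⟩
  | conj φ ih =>
    simp only [Holds, not_forall] at h
    obtain ⟨i, hi⟩ := h
    rcases ih i _ (child_prefix φ hW i) (hn i) hi with h1 | ⟨j, x, hj, hx, h1⟩
    · left
      simp only [ev, decide_eq_false_iff_not]
      intro H
      rw [H i] at h1
      exact absurd h1 (by simp)
    · refine .inr ⟨j, x, hj, hx, ?_⟩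
      simp only [ev, decide_eq_false_iff_not]
      intro H
      rw [H i] at h1
      exact absurd h1 (by simp)
  | disj φ ih =>
    simp only [Holds, not_exists] at h
    obtain ⟨hn1, hn2⟩ := hn
    have hneg : ∀ i, (φ i).IsNegative → (φ i).ev m (o + 1 + offset φ i) = false := fun i hi =>
      ev_of_isNegative hm _ _ (child_prefix φ hW i) hi (h i)
    by_cases hall : ∀ i, (φ i).IsNegative
    · left
      simp only [ev, decide_eq_false_iff_not]
      rintro ⟨i, hi⟩
      rw [hneg i (hall i)] at hi
      exact absurd hi (by simp)
    -- All disjuncts other than `i` are negative and so already have value false. The search for a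
    -- literal to blame therefore continues in `i` only, which is why one literal is enough.
    · push Not at hall
      obtain ⟨i, hi⟩ := hall
      have hother : ∀ i', i' ≠ i → (φ i').ev m (o + 1 + offset φ i') = false := fun i' hne =>
        hneg i' (by
          by_contra hi'
          exact hne (hn2 i' i hi' hi))
      rcases ih i _ (child_prefix φ hW i) (hn1 i) (h i) with h1 | ⟨j, x, hj, hx, h1⟩
      · left
        simp only [ev, decide_eq_false_iff_not]
        rintro ⟨i', hi'⟩
        by_cases e : i' = i
        · subst e
          rw [h1] at hi'
          exact absurd hi' (by simp)
        · rw [hother i' e] at hi'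
          exact absurd hi' (by simp)
      · refine .inr ⟨j, x, hj, hx, ?_⟩
        simp only [ev, decide_eq_false_iff_not]
        rintro ⟨i', hi'⟩
        by_cases e : i' = i
        · subst e
          rw [h1] at hi'
          exact absurd hi' (by simp)
        -- Making one more literal false cannot make the other disjuncts true.
        · have := ev_mono (hup j) _ _ hi'
          rw [hother i' e] at this
          exact absurd this (by simp)

/-! ### Sound marks and the criterion for satisfiability. -/

/-- The marks say that only those negative literals are false that are false in all models. -/
def SoundMarks (φ : NNF) (m : ℕ → Bool) : Prop :=
  (∀ j x, LitAt φ.encode j true x → m j = true) ∧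
    ∀ v, φ.Holds v → ∀ k x, LitAt φ.encode k false x → m k = false → v x = true

/-- In a model with `x` false, all literals that are true would still be marked true after the
change at `j`, so the value would be true as well. -/
theorem SoundMarks.consequence {φ : NNF} {m : ℕ → Bool} (hm : φ.SoundMarks m) {j : ℕ} {x : PVar}
    (hj : LitAt φ.encode j true x) (he : φ.ev (Function.update m j false) 0 = false)
    (hv : φ.Holds v) : v x = true := by
  by_contra hx
  have := ev_of_holds (W := φ.encode) (m := Function.update m j false) (v := v) ?_ φ 0
    (by simp) hv
  · rw [he] at this
    exact absurd this (by simp)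
  · intro k s y hk hy
    by_cases e : k = j
    · subst e
      obtain ⟨rfl, rfl⟩ := hk.unique hj
      exact absurd hy hx
    · rw [Function.update_of_ne e]
      cases s with
      | true => exact hm.1 k y hk
      | false =>
        by_contra hmk
        rw [hm.2 v hv k y hk (by simpa using hmk)] at hy
        exact absurd hy (by simp)

/-- Soundness gives one direction: in a model every true literal is marked true. For the other, `hs`
says that the marks are closed under derivation, so `exists_ev_eq_false` applies to the
interpretation of the derived variables; a literal to be blamed would have a derived variable, yet
be false. -/
theorem satisfiable_iff_ev {φ : NNF} (hφ : φ.IsHNF) {m : ℕ → Bool} (hm : φ.SoundMarks m)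
    (hs : ∀ j x, LitAt φ.encode j true x → φ.ev (Function.update m j false) 0 = false →
      ∀ k, LitAt φ.encode k false x → m k = false) :
    φ.Satisfiable ↔ φ.ev m 0 = true := by
  classical
  constructor
  · rintro ⟨v, hv⟩
    refine ev_of_holds (W := φ.encode) (v := v) (fun k s y hk hy => ?_) φ 0 (by simp) hv
    cases s with
    | true => exact hm.1 k y hk
    | false =>
      by_contra hmk
      rw [hm.2 v hv k y hk (by simpa using hmk)] at hy
      exact absurd hy (by simp)
  · intro he
    -- The variables made true are those with a positive occurrence whose falsification makes the
    -- value false.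
    refine ⟨fun x => decide (∃ j, LitAt φ.encode j true x ∧
      φ.ev (Function.update m j false) 0 = false), ?_⟩
    by_contra H
    have key := exists_ev_eq_false (W := φ.encode) (m := m) (fun k x hk hx => by
      obtain ⟨j, hj, h1⟩ := of_decide_eq_true hx
      exact hs j x hj h1 k hk) φ 0 (by simp) hφ H
    rcases key with h1 | ⟨j, x, hj, hx, h1⟩
    · rw [he] at h1
      exact absurd h1 (by simp)
    · simp only [decide_eq_false_iff_not, not_exists, not_and] at hx
      exact hx j hj h1

/-! ### A pushdown automaton for the evaluation of formulas -/

/-- The kinds of brackets, and a kind for the bottom of the stack. -/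
inductive Kind
  | root
  | and
  | or
  deriving DecidableEq

instance : Fintype Kind := ⟨{.root, .and, .or}, fun k => by cases k <;> decide⟩

/-- An entry of the stack: an open bracket, with the information whether it has arguments, the value
of the formula so far, and the information whether there is a non-negative argument. -/
structure Frame where
  kind : Kind
  nonempty : Bool
  acc : Bool
  nonneg : Bool
  deriving DecidableEq, Fintype

/-- Add an argument with value `v` to an open bracket. The result is `none` if there is a second
non-negative disjunct, or a second formula at the bottom. -/
def Frame.feed (f : Frame) (v p : Bool) : Option Frame :=
  match f.kind with
  | .root => if f.nonempty then none else some ⟨.root, true, v, p⟩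
  | .and => some ⟨.and, true, f.acc && v, f.nonneg || p⟩
  | .or => if f.nonneg && p then none else some ⟨.or, true, f.acc || v, f.nonneg || p⟩

/-- The operations of the automaton on its stack. -/
inductive Op
  | skip
  | push (f : Frame)
  | feed (v p : Bool)
  | pop (v p : Bool)
  | fail
  deriving DecidableEq, Fintype

/-- The transition of the automaton. Its state is `some (s, b)` inside a literal with sign `s` and
value `b`; `f` is the top of the stack. -/
def plan (q : Option (Bool × Bool)) (f : Frame) (a : Symb × Bool) :
    Option (Bool × Bool) × Op :=
  match q, a with
  | none, (.andOpen, _) => (none, .push ⟨.and, false, true, false⟩)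
  | none, (.orOpen, _) => (none, .push ⟨.or, false, false, false⟩)
  | none, (.andClose, _) =>
    (none, if f.kind = .and ∧ f.nonempty = true then .pop f.acc f.nonneg else .fail)
  | none, (.orClose, _) =>
    (none, if f.kind = .or ∧ f.nonempty = true then .pop f.acc f.nonneg else .fail)
  | none, (.sign s, b) => (some (s, b), .skip)
  | none, (.bit _, _) => (none, .fail)
  | none, (.endMark, _) => (none, .fail)
  | some q, (.bit _, _) => (some q, .skip)
  | some q, (.endMark, _) => (none, .feed q.2 q.1)
  | some _, _ => (none, .fail)

/-- The effect of an operation on the top and the rest of the stack. -/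
def Op.exec (o : Op) (f : Frame) (st : List Frame) : Option (Frame × List Frame) :=
  match o with
  | .skip => some (f, st)
  | .push g => some (g, f :: st)
  | .feed v p => (f.feed v p).map fun f' => (f', st)
  | .pop v p =>
    match st with
    | [] => none
    | g :: st' => (g.feed v p).map fun g' => (g', st')
  | .fail => none

/-- A configuration of the automaton. -/
abbrev PCfg : Type := Option (Bool × Bool) × Frame × List Frame

/-- A step of the automaton. -/
def pdaStep (c : Option PCfg) (a : Symb × Bool) : Option PCfg :=
  c.bind fun c => ((plan c.1 c.2.1 a).2.exec c.2.1 c.2.2).map fun s => ((plan c.1 c.2.1 a).1, s)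

/-- The word with the marks of its positions, which are counted from `o` on. -/
def cells (m : ℕ → Bool) : ℕ → List Symb → List (Symb × Bool)
  | _, [] => []
  | o, a :: l => (a, m o) :: cells m (o + 1) l

theorem cells_append (o : ℕ) (l l' : List Symb) :
    cells m o (l ++ l') = cells m o l ++ cells m (o + l.length) l' := by
  induction l generalizing o with
  | nil => rfl
  | cons a l ih => simp [cells, ih, Nat.add_assoc, Nat.add_comm 1]

/-- The formula is not negative, as a Boolean. -/
noncomputable def nonneg (φ : NNF) : Bool := open Classical in decide (¬ φ.IsNegative)

theorem nonneg_iff (φ : NNF) : φ.nonneg = true ↔ ¬ φ.IsNegative := by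
  classical
  exact decide_eq_true_iff

/-- The values of formulas whose codes follow each other, and the information whether they are
non-negative. -/
noncomputable def evList (m : ℕ → Bool) : List NNF → ℕ → List (Bool × Bool)
  | [], _ => []
  | φ :: l, o => (φ.ev m o, φ.nonneg) :: evList m l (o + φ.encode.length)

/-- Add several arguments. -/
def Frame.feedAll (f : Frame) (l : List (Bool × Bool)) : Option Frame :=
  l.foldl (fun f x => f.bind fun f => f.feed x.1 x.2) (some f)

theorem feedAll_cons (f : Frame) (x : Bool × Bool) (l : List (Bool × Bool)) :
    f.feedAll (x :: l) = (f.feed x.1 x.2).bind fun f => f.feedAll l := by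
  rw [Frame.feedAll, List.foldl_cons, Option.bind_some]
  cases f.feed x.1 x.2 with
  | some f => rfl
  | none =>
    rw [Option.bind_none]
    induction l with
    | nil => rfl
    | cons y l ih => exact ih

theorem feedAll_and (ne acc p : Bool) (l : List (Bool × Bool)) :
    (Frame.mk .and ne acc p).feedAll l =
      some ⟨.and, ne || !l.isEmpty, acc && l.all Prod.fst, p || l.any Prod.snd⟩ := by
  induction l generalizing ne acc p with
  | nil => simp [Frame.feedAll]
  | cons x l ih => simp [feedAll_cons, Frame.feed, ih, Bool.and_assoc, Bool.or_assoc]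

/-- The two hypotheses together say that at most one non-negative argument is ever seen, so no
argument is refused. -/
theorem feedAll_or (ne acc p : Bool) (l : List (Bool × Bool)) (hp : p = true → ∀ x ∈ l, x.2 = false)
    (hl : l.Pairwise fun x y => ¬ (x.2 = true ∧ y.2 = true)) :
    (Frame.mk .or ne acc p).feedAll l =
      some ⟨.or, ne || !l.isEmpty, acc || l.any Prod.fst, p || l.any Prod.snd⟩ := by
  induction l generalizing ne acc p with
  | nil => simp [Frame.feedAll]
  | cons x l ih =>
    rw [List.pairwise_cons] at hl
    have h1 : (p && x.2) = false := by
      cases p with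
      | false => rfl
      | true => simpa using hp rfl x (by simp)
    simp only [feedAll_cons, Frame.feed, h1, Bool.false_eq_true, if_false, Option.bind_some]
    rw [ih _ _ _ ?_ hl.2]
    · simp [Bool.or_assoc]
    · intro h2 y hy
      rw [Bool.or_eq_true] at h2
      rcases h2 with h2 | h2
      · exact hp h2 y (List.mem_cons_of_mem _ hy)
      · simpa [h2] using hl.1 y hy

theorem foldl_pdaStep_bits (s b : Bool) (f : Frame) (st : List Frame) (x : PVar) (o : ℕ) :
    (cells m o (x.map .bit)).foldl pdaStep (some (some (s, b), f, st)) =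
      some (some (s, b), f, st) := by
  induction x generalizing o with
  | nil => rfl
  | cons a x ih => exact ih _

/-- The automaton evaluates the formula and adds its value to the top of the stack. -/
def Evaluates (m : ℕ → Bool) (φ : NNF) : Prop :=
  ∀ f st o, (cells m o φ.encode).foldl pdaStep (some (none, f, st)) =
    (f.feed (φ.ev m o) φ.nonneg).map fun f' => (none, f', st)

theorem foldl_pdaStep_none (l : List (Symb × Bool)) : l.foldl pdaStep none = none := by
  induction l with
  | nil => rfl
  | cons a l ih => exact ih

theorem foldl_pdaStep_list (l : List NNF) (hl : ∀ φ ∈ l, Evaluates m φ) (f : Frame)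
    (st : List Frame) (o : ℕ) :
    (cells m o (l.map encode).flatten).foldl pdaStep (some (none, f, st)) =
      (f.feedAll (evList m l o)).map fun f' => (none, f', st) := by
  induction l generalizing f o with
  | nil => rfl
  | cons φ l ih =>
    simp only [List.mem_cons, forall_eq_or_imp] at hl
    rw [List.map_cons, List.flatten_cons, cells_append, List.foldl_append, hl.1, evList,
      feedAll_cons]
    cases f.feed (φ.ev m o) φ.nonneg with
    | none => exact foldl_pdaStep_none _
    | some f' => exact ih hl.2 f' _

theorem evList_eq (l : List NNF) (o : ℕ) :
    evList m l o = List.ofFn fun i : Fin l.length =>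
      ((l.get i).ev m (o + ((l.map encode).take i).flatten.length), (l.get i).nonneg) := by
  induction l generalizing o with
  | nil => rfl
  | cons φ l ih =>
    rw [List.ofFn_succ, evList, ih]
    simp [add_assoc]

theorem evList_ofFn {k : ℕ} (φ : Fin (k + 1) → NNF) (o : ℕ) :
    evList m (List.ofFn φ) o =
      List.ofFn fun i => ((φ i).ev m (o + offset φ i), (φ i).nonneg) := by
  rw [evList_eq]
  apply List.ext_getElem
  · simp
  · intro n h1 h2
    simp only [List.getElem_ofFn, List.get_eq_getElem, offset, List.map_ofFn]
    rfl

/-- Structural induction: between matching brackets the automaton works above the current stack, and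
at the closing bracket it hands one value down. The mark of a literal is read at its sign, where
`ev` looks for it. The Horn condition ensures that no disjunction refuses an argument. -/
theorem evaluates (φ : NNF) (hφ : φ.IsHNF) : Evaluates m φ := by
  induction φ with
  | lit s x =>
    intro f st o
    have e : (cells m o (lit s x).encode) =
        (Symb.sign s, m o) :: (cells m (o + 1) (x.map .bit) ++
          [(Symb.endMark, m (o + 1 + (x.map Symb.bit).length))]) := by
      rw [encode, cells, cells_append]
      rfl
    rw [e, List.foldl_cons, List.foldl_append]
    have e1 : pdaStep (some (none, f, st)) (Symb.sign s, m o) = some (some (s, m o), f, st) := rfl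
    have e2 : (lit s x).nonneg = s := by
      cases s <;> simp [nonneg, IsNegative]
    rw [e1, foldl_pdaStep_bits, e2]
    change ((f.feed (m o) s).map fun f' => (f', st)).map _ = _
    rw [Option.map_map]
    rfl
  | conj φ ih =>
    intro f st o
    have e : cells m o (conj φ).encode = (Symb.andOpen, m o) ::
        (cells m (o + 1) ((List.ofFn φ).map encode).flatten ++
          [(Symb.andClose, m (o + 1 + ((List.ofFn φ).map encode).flatten.length))]) := by
      rw [encode, cells, cells_append, List.map_ofFn]
      rfl
    have e1 : pdaStep (some (none, f, st)) (Symb.andOpen, m o) =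
      some (none, ⟨.and, false, true, false⟩, f :: st) := rfl
    rw [e, List.foldl_cons, List.foldl_append, e1, foldl_pdaStep_list, feedAll_and, evList_ofFn]
    · have e2 : (conj φ).ev m o = (List.ofFn fun i => ((φ i).ev m (o + 1 + offset φ i),
          (φ i).nonneg)).all Prod.fst := by
        rw [Bool.eq_iff_iff]
        simp [ev, List.all_eq_true, List.mem_ofFn, -List.ofFn_succ]
      have e3 : (conj φ).nonneg = (List.ofFn fun i => ((φ i).ev m (o + 1 + offset φ i),
          (φ i).nonneg)).any Prod.snd := by
        rw [Bool.eq_iff_iff]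
        rw [nonneg_iff]
        simp [nonneg, IsNegative, List.any_eq_true, List.mem_ofFn, -List.ofFn_succ]
      rw [e2, e3]
      simp [pdaStep, plan, Op.exec]
      rfl
    · intro ψ hψ
      obtain ⟨i, rfl⟩ := (List.mem_ofFn' _ _).1 hψ
      exact ih i (hφ i)
  | disj φ ih =>
    intro f st o
    have e : cells m o (disj φ).encode = (Symb.orOpen, m o) ::
        (cells m (o + 1) ((List.ofFn φ).map encode).flatten ++
          [(Symb.orClose, m (o + 1 + ((List.ofFn φ).map encode).flatten.length))]) := by
      rw [encode, cells, cells_append, List.map_ofFn]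
      rfl
    have e1 : pdaStep (some (none, f, st)) (Symb.orOpen, m o) =
      some (none, ⟨.or, false, false, false⟩, f :: st) := rfl
    rw [e, List.foldl_cons, List.foldl_append, e1, foldl_pdaStep_list, feedAll_or, evList_ofFn]
    · have e2 : (disj φ).ev m o = (List.ofFn fun i => ((φ i).ev m (o + 1 + offset φ i),
          (φ i).nonneg)).any Prod.fst := by
        rw [Bool.eq_iff_iff]
        simp [ev, List.any_eq_true, List.mem_ofFn, -List.ofFn_succ]
      have e3 : (disj φ).nonneg = (List.ofFn fun i => ((φ i).ev m (o + 1 + offset φ i),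
          (φ i).nonneg)).any Prod.snd := by
        rw [Bool.eq_iff_iff]
        rw [nonneg_iff]
        simp [nonneg, IsNegative, List.any_eq_true, List.mem_ofFn, -List.ofFn_succ]
      rw [e2, e3]
      simp [pdaStep, plan, Op.exec]
      rfl
    · simp
    · rw [evList_ofFn, List.pairwise_ofFn]
      rintro i j hij ⟨h1, h2⟩
      simp only [nonneg, decide_eq_true_eq] at h1 h2
      exact hij.ne (hφ.2 i j h1 h2)
    · intro ψ hψ
      obtain ⟨i, rfl⟩ := (List.mem_ofFn' _ _).1 hψ
      exact ih i (hφ.1 i)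

/-- The result of the automaton on a word with marks. -/
def evalRes (W : List Symb) (m : ℕ → Bool) : Option Bool :=
  match (cells m 0 W).foldl pdaStep (some (none, ⟨.root, false, false, false⟩, [])) with
  | some (none, f, _) => if f.kind = .root ∧ f.nonempty = true then some f.acc else none
  | _ => none

theorem evalRes_encode (φ : NNF) (hφ : φ.IsHNF) (m : ℕ → Bool) :
    evalRes φ.encode m = some (φ.ev m 0) := by
  rw [evalRes, evaluates φ hφ]
  rfl

/-! ### The automaton accepts only codes of Horn-NNF formulas -/

theorem isNegative_conjL {l : List NNF} (hl : l ≠ []) :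
    (conjL l).IsNegative ↔ ∀ φ ∈ l, φ.IsNegative := by
  cases l with
  | nil => exact absurd rfl hl
  | cons φ l => exact (List.forall_mem_iff_get (l := φ :: l) (p := IsNegative)).symm

theorem isNegative_disjL {l : List NNF} (hl : l ≠ []) :
    (disjL l).IsNegative ↔ ∀ φ ∈ l, φ.IsNegative := by
  cases l with
  | nil => exact absurd rfl hl
  | cons φ l => exact (List.forall_mem_iff_get (l := φ :: l) (p := IsNegative)).symm

theorem isHNF_disjL {l : List NNF} (h : ∀ φ ∈ l, φ.IsHNF)
    (hp : l.Pairwise fun φ ψ => φ.IsNegative ∨ ψ.IsNegative) : (disjL l).IsHNF := by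
  cases l with
  | nil => trivial
  | cons φ l =>
    refine ⟨(List.forall_mem_iff_get (l := φ :: l) (p := IsHNF)).1 h, fun i j hi hj => ?_⟩
    rw [List.pairwise_iff_get] at hp
    rcases lt_trichotomy i j with hij | hij | hij
    · exact absurd (hp i j hij) (by rintro (h | h); exacts [hi h, hj h])
    · exact hij
    · exact absurd (hp j i hij) (by rintro (h | h); exacts [hj h, hi h])

/-- The entry of the stack is an open bracket with the arguments `cs`. -/
structure FrameOf (f : Frame) (cs : List NNF) : Prop where
  nonempty : f.nonempty = true → cs ≠ []
  isHNF : ∀ φ ∈ cs, φ.IsHNF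
  nonneg : f.nonneg = false → ∀ φ ∈ cs, φ.IsNegative
  nonneg' : f.nonneg = true → ∃ φ ∈ cs, ¬ φ.IsNegative
  or : f.kind = .or → cs.Pairwise fun φ ψ => φ.IsNegative ∨ ψ.IsNegative
  root : f.kind = .root → cs.length ≤ 1 ∧ (f.nonempty = false → cs = [])

/-- A disjunction refuses an argument exactly when it and an earlier one are both non-negative, so
acceptance preserves the Horn condition. -/
theorem FrameOf.feed {f f' : Frame} {cs : List NNF} (h : FrameOf f cs) {φ : NNF} {v : Bool}
    (hφ : φ.IsHNF) (hf : f.feed v φ.nonneg = some f') :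
    f'.kind = f.kind ∧ FrameOf f' (cs ++ [φ]) := by
  obtain ⟨k, ne, acc, p⟩ := f
  obtain ⟨h1, h2, h3, h4, h5, h6⟩ := h
  have h2' : ∀ ψ ∈ cs ++ [φ], ψ.IsHNF := by
    intro ψ hψ
    rw [List.mem_append, List.mem_singleton] at hψ
    rcases hψ with hψ | rfl
    · exact h2 ψ hψ
    · exact hφ
  have h3' : (p || φ.nonneg) = false → ∀ ψ ∈ cs ++ [φ], ψ.IsNegative := by
    intro hp ψ hψ
    simp only [Bool.or_eq_false_iff] at hp
    rw [List.mem_append, List.mem_singleton] at hψ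
    rcases hψ with hψ | rfl
    · exact h3 hp.1 ψ hψ
    · simpa [NNF.nonneg] using hp.2
  have h4' : (p || φ.nonneg) = true → ∃ ψ ∈ cs ++ [φ], ¬ ψ.IsNegative := by
    intro hp
    rw [Bool.or_eq_true] at hp
    rcases hp with hp | hp
    · obtain ⟨ψ, hψ, hn⟩ := h4 hp
      exact ⟨ψ, List.mem_append_left _ hψ, hn⟩
    · exact ⟨φ, by simp, by simpa [NNF.nonneg] using hp⟩
  cases k with
  | root =>
    simp only [Frame.feed] at hf
    split_ifs at hf with hne
    obtain rfl := (Option.some.inj hf)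
    -- The bottom entry accepts only its first formula.
    obtain rfl : cs = [] := (h6 rfl).2 (by simpa using hne)
    refine ⟨rfl, ⟨by simp, h2', fun hp => ?_, fun hp => ?_, by simp, by simp⟩⟩
    · simpa [NNF.nonneg] using hp
    · simpa [NNF.nonneg] using hp
  | and =>
    obtain rfl := (Option.some.inj hf)
    exact ⟨rfl, ⟨by simp, h2', h3', h4', by simp, by simp⟩⟩
  | or =>
    simp only [Frame.feed] at hf
    split_ifs at hf with hne
    obtain rfl := (Option.some.inj hf)
    refine ⟨rfl, ⟨by simp, h2', h3', h4', fun _ => ?_, by simp⟩⟩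
    rw [List.pairwise_append]
    refine ⟨h5 rfl, by simp, fun ψ hψ χ hχ => ?_⟩
    rw [List.mem_singleton] at hχ
    subst hχ
    simp only [Bool.and_eq_true, not_and, Bool.not_eq_true] at hne
    cases p with
    | false => exact .inl (h3 rfl ψ hψ)
    | true => exact .inr (by simpa [NNF.nonneg] using hne rfl)

/-- The opening bracket of an entry of the stack. -/
def Kind.opener : Kind → Symb
  | .or => .orOpen
  | _ => .andOpen

/-- The stack describes the word `u` that has been read. -/
inductive Describes : List Symb → Frame → List Frame → Prop
  | root {f : Frame} {cs : List NNF} : f.kind = .root → FrameOf f cs →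
      Describes (cs.map encode).flatten f []
  | push {u : List Symb} {f g : Frame} {st : List Frame} {cs : List NNF} : Describes u f st →
      g.kind ≠ .root → FrameOf g cs →
      Describes (u ++ g.kind.opener :: (cs.map encode).flatten) g (f :: st)

theorem Describes.feed {u : List Symb} {f f' : Frame} {st : List Frame} (h : Describes u f st)
    {φ : NNF} {v : Bool} (hφ : φ.IsHNF) (hf : f.feed v φ.nonneg = some f') :
    Describes (u ++ φ.encode) f' st := by
  cases h with
  | @root _ cs hk hc =>
    obtain ⟨h1, h2⟩ := hc.feed hφ hf
    have := Describes.root (h1.trans hk) h2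
    simpa using this
  | @push u g _ st cs hd hk hc =>
    obtain ⟨h1, h2⟩ := hc.feed hφ hf
    have := Describes.push hd (by rwa [h1]) h2
    rw [h1] at this
    simpa using this

/-- The configuration describes the word `u` that has been read. -/
def DescribesCfg (u : List Symb) (c : PCfg) : Prop :=
  match c.1 with
  | none => Describes u c.2.1 c.2.2
  | some q => ∃ (u' : List Symb) (x : PVar), u = u' ++ .sign q.1 :: x.map .bit ∧
      Describes u' c.2.1 c.2.2

/-- A closing bracket turns the arguments collected in the top entry into one formula, which becomes
an argument of the entry below. The entry is nonempty, as formulas have at least one argument. -/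
theorem Describes.close {u : List Symb} {f g : Frame} {st : List Frame}
    (h : Describes u f st) (hk : f.kind ≠ .root) (hne : f.nonempty = true) {v : Bool} {c : Symb}
    (hc : f.kind = .and ∧ c = .andClose ∨ f.kind = .or ∧ c = .orClose) :
    ∃ g₀ st', st = g₀ :: st' ∧ (g₀.feed v f.nonneg = some g → Describes (u ++ [c]) g st') := by
  cases h with
  | root h => exact absurd h hk
  | @push u g₀ _ st cs hd _ hf =>
    refine ⟨g₀, st, rfl, fun hg => ?_⟩
    have hcs := hf.nonempty hne
    have key : ∀ φ : NNF, φ.IsHNF → (φ.IsNegative ↔ ∀ ψ ∈ cs, ψ.IsNegative) →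
        φ.encode = f.kind.opener :: ((cs.map encode).flatten ++ [c]) →
        Describes ((u ++ f.kind.opener :: (cs.map encode).flatten) ++ [c]) g st := by
      intro φ h1 h2 h3
      have e : φ.nonneg = f.nonneg := by
        rw [Bool.eq_iff_iff]
        simp only [NNF.nonneg, decide_eq_true_eq, h2]
        constructor
        · intro h
          by_contra hn
          exact h (hf.nonneg (by simpa using hn))
        · intro h h'
          obtain ⟨ψ, hψ, hn⟩ := hf.nonneg' h
          exact hn (h' ψ hψ)
      rw [← e] at hg
      have := hd.feed h1 hg
      rw [h3] at this
      simpa using this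
    rcases hc with ⟨hk', rfl⟩ | ⟨hk', rfl⟩
    · refine key (conjL cs) (isHNF_conjL hf.isHNF) (isNegative_conjL hcs) ?_
      rw [encode_conjL hcs, hk']
      rfl
    · refine key (disjL cs) (isHNF_disjL hf.isHNF (hf.or hk')) (isNegative_disjL hcs) ?_
      rw [encode_disjL hcs, hk']
      rfl

theorem DescribesCfg.step {u : List Symb} {c c' : PCfg} (h : DescribesCfg u c) (a : Symb × Bool)
    (hc : pdaStep (some c) a = some c') : DescribesCfg (u ++ [a.1]) c' := by
  obtain ⟨q, f, st⟩ := c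
  obtain ⟨a, b⟩ := a
  simp only [pdaStep, Option.bind_some, Option.map_eq_some_iff] at hc
  obtain ⟨⟨f', st'⟩, he, rfl⟩ := hc
  cases q with
  | none =>
    have h : Describes u f st := h
    cases a with
    | andOpen =>
      obtain ⟨rfl, rfl⟩ : Frame.mk .and false true false = f' ∧ f :: st = st' := by
        simpa [plan, Op.exec] using he
      exact h.push (g := ⟨.and, false, true, false⟩) (cs := []) (by simp) ⟨by simp, by simp, by simp, by simp, by simp, by simp⟩
    | orOpen =>
      obtain ⟨rfl, rfl⟩ : Frame.mk .or false false false = f' ∧ f :: st = st' := by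
        simpa [plan, Op.exec] using he
      exact h.push (g := ⟨.or, false, false, false⟩) (cs := []) (by simp) ⟨by simp, by simp, by simp, by simp, by simp, by simp⟩
    | andClose =>
      simp only [plan] at he
      split_ifs at he with hk
      · obtain ⟨g₀, st₀, rfl, hg⟩ := h.close (v := f.acc) (g := f') (by simp [hk.1]) hk.2
          (.inl ⟨hk.1, rfl⟩)
        simp only [Op.exec, Option.map_eq_some_iff, Prod.mk.injEq] at he
        obtain ⟨g, hg', rfl, rfl⟩ := he
        exact hg hg'
      · simp [Op.exec] at he
    | orClose =>
      simp only [plan] at he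
      split_ifs at he with hk
      · obtain ⟨g₀, st₀, rfl, hg⟩ := h.close (v := f.acc) (g := f') (by simp [hk.1]) hk.2
          (.inr ⟨hk.1, rfl⟩)
        simp only [Op.exec, Option.map_eq_some_iff, Prod.mk.injEq] at he
        obtain ⟨g, hg', rfl, rfl⟩ := he
        exact hg hg'
      · simp [Op.exec] at he
    | sign s =>
      obtain ⟨rfl, rfl⟩ : f = f' ∧ st = st' := by simpa [plan, Op.exec] using he
      exact ⟨u, [], rfl, h⟩
    | bit _ => simp [plan, Op.exec] at he
    | endMark => simp [plan, Op.exec] at he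
  | some q =>
    obtain ⟨u', x, rfl, h⟩ := h
    cases a with
    | bit d =>
      obtain ⟨rfl, rfl⟩ : f = f' ∧ st = st' := by simpa [plan, Op.exec] using he
      exact ⟨u', x ++ [d], by simp, h⟩
    | endMark =>
      simp only [plan, Op.exec, Option.map_eq_some_iff, Prod.mk.injEq] at he
      obtain ⟨g, hg, rfl, rfl⟩ := he
      have e2 : (lit q.1 x).nonneg = q.1 := by
        cases q.1 <;> simp [nonneg, IsNegative]
      rw [← e2] at hg
      have := h.feed (φ := lit q.1 x) trivial hg
      simpa [DescribesCfg, plan, encode] using this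
    | andOpen => simp [plan, Op.exec] at he
    | andClose => simp [plan, Op.exec] at he
    | orOpen => simp [plan, Op.exec] at he
    | orClose => simp [plan, Op.exec] at he
    | sign s => simp [plan, Op.exec] at he

theorem DescribesCfg.foldl (l : List Symb) {u : List Symb} {c c' : PCfg} (h : DescribesCfg u c)
    (o : ℕ) (hc : (cells m o l).foldl pdaStep (some c) = some c') : DescribesCfg (u ++ l) c' := by
  induction l generalizing u c o with
  | nil =>
    obtain rfl : c = c' := by simpa [cells] using hc
    simpa using h
  | cons a l ih =>
    rw [cells, List.foldl_cons] at hc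
    cases hs : pdaStep (some c) (a, m o) with
    | none =>
      rw [hs, foldl_pdaStep_none] at hc
      cases hc
    | some c₁ =>
      rw [hs] at hc
      have := ih (h.step _ hs) _ hc
      simpa using this

/-- Together with `evalRes_encode` this makes the evaluation a test for codes of Horn-NNF formulas,
whatever the marks are. At the end the stack consists of the bottom entry, which holds exactly one
formula. -/
theorem exists_of_evalRes {W : List Symb} {m : ℕ → Bool} {b : Bool}
    (h : evalRes W m = some b) : ∃ φ : NNF, φ.IsHNF ∧ φ.encode = W := by
  unfold evalRes at h
  split at h
  · rename_i f st hc
    split_ifs at h with hk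
    have hd : Describes W f st := by
      have h0 : DescribesCfg [] (none, ⟨.root, false, false, false⟩, []) :=
        Describes.root (cs := []) rfl ⟨by simp, by simp, by simp, by simp, by simp, by simp⟩
      exact h0.foldl W 0 hc
    cases hd with
    | @root _ cs hk' hf =>
      have h1 := hf.nonempty hk.2
      have h2 := (hf.root hk').1
      cases cs with
      | nil => exact absurd rfl h1
      | cons φ l =>
        cases l with
        | nil => exact ⟨φ, hf.isHNF φ (by simp), by simp⟩
        | cons ψ l => simp at h2
    | push _ hk' _ => exact absurd hk.1 hk'
  · cases h

end NNF

/-! ### Programs with two work tapes: a word with marks, and a stack -/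

namespace Sat

open NNF Prog

/-- The registers of the decision procedure. -/
structure Reg where
  lit : Option (Bool × Bool)
  op : Op
  err : Bool
  res : Option Bool
  changed : Bool
  eq : Bool
  deriving DecidableEq, Fintype

/-- The symbols on the tape with the word. -/
abbrev Mark : Type := Option (Symb × Bool)

/-- The bottom of the stack. -/
def bottom : Frame := ⟨.root, false, false, false⟩

/-- The programs of the decision procedure. -/
abbrev SProg : Type := Prog Symb Empty Reg (Mark × Frame) Bool

/-- The memories of the decision procedure. -/
abbrev SMem : Type := Mem Empty Reg (Mark × Frame) Bool

/-- The memory with given contents of the two work tapes. -/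
def mem2 (r : Reg) (i : ℕ) (h₁ : ℤ) (t₁ : ℤ → Mark) (h₂ : ℤ) (t₂ : ℤ → Frame) : SMem where
  reg := r
  inp := i
  head := fun b => bif b then h₁ else h₂
  tape := fun b z => bif b then (t₁ z, bottom) else (none, t₂ z)
  out := []

/-- A basic step. -/
def act2 (f : Reg → Option Symb → Mark → Frame → Reg × Move × (Mark × Move) × Frame × Move) :
    SProg :=
  .act fun r a s =>
    { next := (f r a (s true).1 (s false).2).1
      inputMove := (f r a (s true).1 (s false).2).2.1
      write := fun b => bif b then ((f r a (s true).1 (s false).2).2.2.1.1, bottom)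
        else (none, (f r a (s true).1 (s false).2).2.2.2.1)
      move := fun b => bif b then (f r a (s true).1 (s false).2).2.2.1.2
        else (f r a (s true).1 (s false).2).2.2.2.2
      emit := none }

/-- Every memory starting with `P` leads to a memory with `Q` in at most `T` steps. -/
def Does (w : List Symb) (p : SProg) (T : ℕ) (P Q : SMem → Prop) : Prop :=
  ∀ m, P m → ∃ m', Run w (fun _ => True) p m T m' ∧ Q m'

variable {w : List Symb} {p q : SProg} {T T' : ℕ} {P Q R : SMem → Prop}

theorem Does.seq (h : Does w p T P Q) (h' : Does w q T' Q R) : Does w (.seq p q) (T + T') P R := by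
  intro m hm
  obtain ⟨m₁, h₁, hm₁⟩ := h m hm
  obtain ⟨m₂, h₂, hm₂⟩ := h' m₁ hm₁
  exact ⟨m₂, h₁.seq h₂, hm₂⟩

theorem Does.mono (h : Does w p T P Q) (hT : T ≤ T') : Does w p T' P Q := by
  intro m hm
  obtain ⟨m₁, h₁, hm₁⟩ := h m hm
  exact ⟨m₁, h₁.mono hT, hm₁⟩

theorem Does.imp {P' Q' : SMem → Prop} (h : Does w p T P Q) (hP : ∀ m, P' m → P m)
    (hQ : ∀ m, Q m → Q' m) : Does w p T P' Q' := by
  intro m hm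
  obtain ⟨m₁, h₁, hm₁⟩ := h m (hP m hm)
  exact ⟨m₁, h₁, hQ _ hm₁⟩

/-- A test that does not read the stack. -/
def cond (c : Reg → Option Symb → Mark → Bool) (r : Reg) (a : Option Symb)
    (s : Bool → Mark × Frame) : Bool :=
  c r a (s true).1

/-- A basic step that does not use the stack. -/
def step1 (f : Reg → Option Symb → Mark → Reg × Move × Mark × Move) : SProg :=
  act2 fun r a x y =>
    ((f r a x).1, (f r a x).2.1, ((f r a x).2.2.1, (f r a x).2.2.2), y, .stay)

theorem run_act2 {f : Reg → Option Symb → Mark → Frame → Reg × Move × (Mark × Move) × Frame × Move}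
    {r r' : Reg} {i : ℕ} {h₁ h₂ : ℤ} {t₁ : ℤ → Mark} {t₂ : ℤ → Frame} {mi m₁ m₂ : Move} {x : Mark}
    {y : Frame}
    (hf : f r (TM.readInput w i) (t₁ h₁) (t₂ h₂) = (r', mi, (x, m₁), y, m₂)) :
    Run w (fun _ => True) (act2 f) (mem2 r i h₁ t₁ h₂ t₂) 1
      (mem2 r' (TM.moveInput w.length i mi) (h₁ + m₁.toInt) (Function.update t₁ h₁ x)
        (h₂ + m₂.toInt) (Function.update t₂ h₂ y)) := by
  have e : (mem2 r i h₁ t₁ h₂ t₂).apply w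
      { next := (f r (TM.readInput w i) (t₁ h₁) (t₂ h₂)).1
        inputMove := (f r (TM.readInput w i) (t₁ h₁) (t₂ h₂)).2.1
        write := fun b => bif b then ((f r (TM.readInput w i) (t₁ h₁) (t₂ h₂)).2.2.1.1, bottom)
          else (none, (f r (TM.readInput w i) (t₁ h₁) (t₂ h₂)).2.2.2.1)
        move := fun b => bif b then (f r (TM.readInput w i) (t₁ h₁) (t₂ h₂)).2.2.1.2
          else (f r (TM.readInput w i) (t₁ h₁) (t₂ h₂)).2.2.2.2
        emit := none } =
      mem2 r' (TM.moveInput w.length i mi) (h₁ + m₁.toInt) (Function.update t₁ h₁ x)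
        (h₂ + m₂.toInt) (Function.update t₂ h₂ y) := by
    simp only [hf, Mem.apply, mem2, Mem.mk.injEq, true_and]
    refine ⟨?_, ?_, rfl⟩
    · funext b
      cases b <;> rfl
    · funext b z
      cases b
      · by_cases hz : z = h₂
        · subst hz
          simp
        · simp [Function.update_of_ne hz]
      · by_cases hz : z = h₁
        · subst hz
          simp
        · simp [Function.update_of_ne hz]
  rw [← e]
  exact Run.act (w := w) _ trivial trivial

/-- The memory has the given register, head positions and tape, and an arbitrary stack. -/
def St (r : Reg) (i : ℕ) (h : ℤ) (t : ℤ → Mark) (m : SMem) : Prop :=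
  ∃ h₂ t₂, m = mem2 r i h t h₂ t₂

variable {r r' : Reg} {i : ℕ} {h : ℤ} {t t' : ℤ → Mark}

theorem does_step1 {f : Reg → Option Symb → Mark → Reg × Move × Mark × Move} {mi mv : Move}
    {x : Mark} (hf : f r (TM.readInput w i) (t h) = (r', mi, x, mv)) :
    Does w (step1 f) 1 (St r i h t)
      (St r' (TM.moveInput w.length i mi) (h + mv.toInt) (Function.update t h x)) := by
  rintro _ ⟨h₂, t₂, rfl⟩
  exact ⟨_, run_act2 (by rw [hf]), _, _, rfl⟩

theorem Does.ite {c : Reg → Option Symb → Mark → Bool}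
    (h' : Does w (if c r (TM.readInput w i) (t h) then p else q) T (St r i h t) Q) :
    Does w (.ite (cond c) p q) (T + 1) (St r i h t) Q := by
  rintro _ ⟨h₂, t₂, rfl⟩
  obtain ⟨m₁, h₁, hm₁⟩ := h' _ ⟨h₂, t₂, rfl⟩
  exact ⟨m₁, Run.ite h₁ trivial, hm₁⟩

theorem Does.loop {c : Reg → Option Symb → Mark → Bool} (K b : ℕ) (r : ℕ → Reg) (i : ℕ → ℕ)
    (h : ℕ → ℤ) (t : ℕ → ℤ → Mark)
    (hc : ∀ k < K, c (r k) (TM.readInput w (i k)) (t k (h k)) = true)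
    (hp : ∀ k < K, Does w p b (St (r k) (i k) (h k) (t k))
      (St (r (k + 1)) (i (k + 1)) (h (k + 1)) (t (k + 1))))
    (hK : c (r K) (TM.readInput w (i K)) (t K (h K)) = false) :
    Does w (.loop (cond c) p) (K * (b + 1) + 1) (St (r 0) (i 0) (h 0) (t 0))
      (St (r K) (i K) (h K) (t K)) := by
  intro m hm
  refine Run.loop_count (fun k => St (r k) (i k) (h k) (t k)) b K (fun _ _ _ => trivial)
    (fun k hk m hm => ⟨?_, hp k hk m hm⟩) (fun m hm => ?_) hm
  · obtain ⟨h₂, t₂, rfl⟩ := hm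
    exact hc k hk
  · obtain ⟨h₂, t₂, rfl⟩ := hm
    exact hK

/-- The tape with the word `W` and the marks `m`. -/
def markTape (W : List Symb) (m : ℕ → Bool) (z : ℤ) : Mark :=
  if 0 ≤ z then (W[z.toNat]?).map fun a => (a, m z.toNat) else none

theorem markTape_nat (W : List Symb) (m : ℕ → Bool) (k : ℕ) :
    markTape W m k = (W[k]?).map fun a => (a, m k) := by
  simp [markTape]

theorem markTape_neg (W : List Symb) (m : ℕ → Bool) : markTape W m (-1) = none := by
  simp [markTape]

theorem isSome_markTape {W : List Symb} {m : ℕ → Bool} {k : ℕ} (hk : k < W.length) :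
    (markTape W m k).isSome = true := by
  simp [markTape_nat, hk]

theorem markTape_length (W : List Symb) (m : ℕ → Bool) : markTape W m (W.length : ℤ) = none := by
  simp [markTape_nat]

theorem update_markTape {W : List Symb} (m : ℕ → Bool) {k : ℕ} {a : Symb} (hk : W[k]? = some a)
    (b : Bool) : Function.update (markTape W m) k (some (a, b)) =
      markTape W (Function.update m k b) := by
  funext z
  by_cases hz : z = k
  · subst hz
    rw [Function.update_self, markTape_nat, hk, Function.update_self]
    rfl
  · rw [Function.update_of_ne hz]
    unfold markTape
    split_ifs with h0
    · have : z.toNat ≠ k := by omega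
      rw [Function.update_of_ne this]
    · rfl

/-- Move the input head and the head on the word. -/
def moves (mi mv : Move) : SProg := step1 fun r _ x => (r, mi, x, mv)

theorem does_moves (mi mv : Move) : Does w (moves mi mv) 1 (St r i h t)
    (St r (TM.moveInput w.length i mi) (h + mv.toInt) t) := by
  have := does_step1 (w := w) (r := r) (r' := r) (i := i) (h := h) (t := t) (x := t h)
    (f := fun r _ x => (r, mi, x, mv)) rfl
  rwa [Function.update_eq_self] at this

/-- Move the head on the word back to cell `0`. -/
def rewindTape : SProg :=
  .seq (moves .stay .left) (.seq (.loop (cond fun _ _ x => x.isSome) (moves .stay .left))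
    (moves .stay .right))

theorem does_rewindTape (W : List Symb) (m : ℕ → Bool) (k : ℕ) (hk : k ≤ W.length) :
    Does w rewindTape (2 * W.length + 3) (St r i k (markTape W m)) (St r i 0 (markTape W m)) := by
  have h1 := does_moves (w := w) (r := r) (i := i) (h := k) (t := markTape W m) .stay .left
  have h2 := Does.loop (w := w) (p := moves .stay .left) (c := fun _ _ x => x.isSome) k 1
    (fun _ => r) (fun _ => i) (fun j => (k : ℤ) - 1 - j) (fun _ => markTape W m)
    (fun j hj => by
      rw [show (k : ℤ) - 1 - j = ((k - 1 - j : ℕ) : ℤ) by omega]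
      exact isSome_markTape (by omega))
    (fun j hj => by
      have := does_moves (w := w) (r := r) (i := i) (h := (k : ℤ) - 1 - j) (t := markTape W m)
        .stay .left
      rwa [show (k : ℤ) - 1 - j + Move.left.toInt = (k : ℤ) - 1 - (j + 1 : ℕ) by
        simp only [Move.toInt]; omega] at this)
    (by
      rw [show (k : ℤ) - 1 - k = -1 by omega, markTape_neg]
      rfl)
  have h3 := does_moves (w := w) (r := r) (i := i) (h := (k : ℤ) - 1 - k) (t := markTape W m)
    .stay .right
  simp only [TM.moveInput, Move.toInt] at h1 h3
  rw [show (k : ℤ) - 1 - k + 1 = 0 by omega] at h3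
  rw [show (k : ℤ) + -1 = (k : ℤ) - 1 - (0 : ℕ) by omega] at h1
  exact (h1.seq (h2.seq h3)).mono (by omega)

/-! ### Evaluation -/

/-- The stack on the second work tape. -/
def StackAt (t : ℤ → Frame) : ℤ → Frame → List Frame → Prop
  | h, f, [] => t h = f ∧ f.kind = .root
  | h, f, g :: st => t h = f ∧ StackAt t (h - 1) g st

theorem StackAt.top {t : ℤ → Frame} {h : ℤ} {f : Frame} {st : List Frame}
    (H : StackAt t h f st) : t h = f := by
  cases st <;> exact H.1

theorem StackAt.congr {t t' : ℤ → Frame} {h : ℤ} {f : Frame} {st : List Frame}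
    (H : StackAt t h f st) (e : ∀ z ≤ h, t z = t' z) : StackAt t' h f st := by
  induction st generalizing h f with
  | nil => exact ⟨(e h le_rfl).symm.trans H.1, H.2⟩
  | cons g st ih =>
    exact ⟨(e h le_rfl).symm.trans H.1, ih H.2 fun z hz => e z (by omega)⟩

theorem StackAt.update {t : ℤ → Frame} {h : ℤ} {f f' : Frame} {st : List Frame}
    (H : StackAt t h f st) (hk : f'.kind = f.kind) :
    StackAt (Function.update t h f') h f' st := by
  cases st with
  | nil => exact ⟨Function.update_self _ _ _, hk.trans H.2⟩
  | cons g st =>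
    refine ⟨Function.update_self _ _ _, H.2.congr fun z hz => ?_⟩
    rw [Function.update_of_ne (by omega)]

theorem StackAt.push {t : ℤ → Frame} {h : ℤ} {f : Frame} {st : List Frame}
    (H : StackAt t h f st) (g : Frame) :
    StackAt (Function.update t (h + 1) g) (h + 1) g (f :: st) := by
  refine ⟨Function.update_self _ _ _, ?_⟩
  rw [add_sub_cancel_right]
  refine H.congr fun z hz => ?_
  rw [Function.update_of_ne (by omega)]

theorem kind_feed {f f' : Frame} {v b : Bool} (h : f.feed v b = some f') : f'.kind = f.kind := by
  obtain ⟨k, ne, acc, n⟩ := f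
  cases k <;> simp only [Frame.feed] at h
  · split_ifs at h
    rw [← Option.some.inj h]
  · rw [← Option.some.inj h]
  · split_ifs at h
    rw [← Option.some.inj h]

/-- The register and the move of the stack head in the first half of a step of the automaton, which
reads a symbol and goes to the top of the stack after the operation. -/
def planFn (r : Reg) (x : Mark) (y : Frame) : Reg × Move :=
  match x with
  | none => (r, .stay)
  | some a =>
    if r.err then (r, .stay) else
      match plan r.lit y a with
      | (q, .push f) => ({r with lit := q, op := .push f}, .right)
      | (q, .pop v b) => ({r with lit := q, op := .feed v b}, .left)
      | (q, .fail) => ({r with lit := q, op := .skip, err := true}, .stay)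
      | (q, .skip) => ({r with lit := q, op := .skip}, .stay)
      | (q, .feed v b) => ({r with lit := q, op := .feed v b}, .stay)

/-- The register and the top of the stack after the second half of a step of the automaton. -/
def execFn (r : Reg) (y : Frame) : Reg × Frame :=
  if r.err then (r, y) else
    match r.op with
    | .push f => (r, f)
    | .feed v b =>
      match y.feed v b with
      | some f => (r, f)
      | none => ({r with err := true}, y)
    | _ => (r, y)

/-- A step of the automaton. -/
def evalStep : SProg :=
  .seq (act2 fun r _ x y => ((planFn r x y).1, .stay, (x, .stay), y, (planFn r x y).2))
    (act2 fun r _ x y => ((execFn r y).1, .stay, (x, .right), (execFn r y).2, .stay))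

/-- The memory represents a configuration of the automaton; `r₀` is the register before. -/
def Rep (r₀ : Reg) (i : ℕ) (h : ℤ) (t : ℤ → Mark) (c : Option PCfg) (m : SMem) : Prop :=
  ∃ r h₂ t₂, m = mem2 r i h t h₂ t₂ ∧ (r.changed = r₀.changed ∧ r.eq = r₀.eq) ∧
    match c with
    | none => r.err = true
    | some (q, f, st) => r.err = false ∧ r.lit = q ∧ StackAt t₂ h₂ f st

theorem run_evalStep {h₂ : ℤ} {t₂ : ℤ → Frame} {r₁ r₂ : Reg} {v : Move} {y : Frame}
    (h1 : planFn r (t h) (t₂ h₂) = (r₁, v))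
    (h2 : execFn r₁ (t₂ (h₂ + v.toInt)) = (r₂, y)) :
    Run w (fun _ => True) evalStep (mem2 r i h t h₂ t₂) 2
      (mem2 r₂ i (h + 1) t (h₂ + v.toInt) (Function.update t₂ (h₂ + v.toInt) y)) := by
  have e1 : Run w (fun _ => True)
      (act2 fun r _ x y => ((planFn r x y).1, .stay, (x, .stay), y, (planFn r x y).2))
      (mem2 r i h t h₂ t₂) 1 _ :=
    run_act2 (r' := r₁) (mi := .stay) (x := t h) (m₁ := .stay) (y := t₂ h₂) (m₂ := v)
      (by simp only [h1])
  have e2 : Run w (fun _ => True)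
      (act2 fun r _ x y => ((execFn r y).1, .stay, (x, .right), (execFn r y).2, .stay))
      (mem2 r₁ i h t (h₂ + v.toInt) t₂) 1 _ :=
    run_act2 (r' := r₂) (mi := .stay) (x := t h) (m₁ := .right) (y := y) (m₂ := .stay)
      (by simp only [h2])
  simp only [Function.update_eq_self, TM.moveInput, Move.toInt, add_zero] at e1 e2
  exact e1.seq e2

/-- Closing a bracket changes the entry below the top, which is not scanned at that moment. Hence
two machine steps: the first moves the stack head and stores in the register what is left to do, the
second does it in the cell now scanned. -/
theorem does_evalStep {r₀ : Reg} {c : Option PCfg} {a : Symb × Bool} (ha : t h = some a) :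
    Does w evalStep 2 (Rep r₀ i h t c) (Rep r₀ i (h + 1) t (pdaStep c a)) := by
  rintro _ ⟨r, h₂, t₂, rfl, hr, hc⟩
  cases c with
  | none =>
    have hc : r.err = true := hc
    refine ⟨_, run_evalStep (r₁ := r) (v := .stay) (r₂ := r) (y := t₂ h₂)
      (by simp [planFn, ha, hc]) (by simp [execFn, hc, Move.toInt]), r, _, _, rfl, hr, hc⟩
  | some c =>
    obtain ⟨q, f, st⟩ := c
    obtain ⟨hc, hq, hs⟩ : r.err = false ∧ r.lit = q ∧ StackAt t₂ h₂ f st := hc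
    obtain ⟨q', o, ho⟩ : ∃ q' o, plan q f a = (q', o) := ⟨_, _, rfl⟩
    have hp : pdaStep (some (q, f, st)) a = (o.exec f st).map fun s => (q', s) := by
      simp only [pdaStep, Option.bind_some, ho]
    have hP : planFn r (t h) (t₂ h₂) = match (q', o) with
      | (q, .push f) => ({r with lit := q, op := .push f}, .right)
      | (q, .pop v b) => ({r with lit := q, op := .feed v b}, .left)
      | (q, .fail) => ({r with lit := q, op := .skip, err := true}, .stay)
      | (q, .skip) => ({r with lit := q, op := .skip}, .stay)
      | (q, .feed v b) => ({r with lit := q, op := .feed v b}, .stay) := by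
      rw [ha, hs.top, ← ho, ← hq]
      simp only [planFn, hc, Bool.false_eq_true, if_false]
    rw [hp]
    cases o with
    | skip =>
      refine ⟨_, run_evalStep hP (r₂ := {r with lit := q', op := .skip}) (y := t₂ h₂)
        (by simp [execFn, hc, Move.toInt]), _, _, _, rfl, hr, hc, rfl, ?_⟩
      simpa [Move.toInt] using hs
    | push g =>
      refine ⟨_, run_evalStep hP (r₂ := {r with lit := q', op := .push g}) (y := g)
        (by simp [execFn, hc]), _, _, _, rfl, hr, hc, rfl, ?_⟩
      exact hs.push g
    | feed v b =>
      cases hf : f.feed v b with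
      | none =>
        refine ⟨_, run_evalStep hP (r₂ := {r with lit := q', op := .feed v b, err := true}) (y := f)
          (by simp [execFn, hc, Move.toInt, hs.top, hf]), _, _, _, rfl, hr, ?_⟩
        simp [Op.exec, hf]
      | some f' =>
        refine ⟨_, run_evalStep hP (r₂ := {r with lit := q', op := .feed v b}) (y := f')
          (by simp [execFn, hc, Move.toInt, hs.top, hf]), _, _, _, rfl, hr, ?_⟩
        simp only [Op.exec, hf, Move.toInt, add_zero]
        exact ⟨hc, rfl, hs.update (kind_feed hf)⟩
    | pop v b =>
      cases st with
      | nil =>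
        -- With an empty rest of the stack the top is the bottom entry of kind `root`, which `plan`
        -- never pops.
        exfalso
        have hk : f.kind = .root := hs.2
        obtain ⟨a, b'⟩ := a
        cases q <;> cases a <;> simp [plan, hk] at ho
      | cons g st =>
        have hs' : StackAt t₂ (h₂ - 1) g st := hs.2
        cases hf : g.feed v b with
        | none =>
          refine ⟨_, run_evalStep hP (r₂ := {r with lit := q', op := .feed v b, err := true})
            (y := g) (by
              simp only [execFn, hc, Move.toInt, ← sub_eq_add_neg, hs'.top, hf]
              rfl), _, _, _, rfl, hr, ?_⟩
          simp [Op.exec, hf]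
        | some g' =>
          refine ⟨_, run_evalStep hP (r₂ := {r with lit := q', op := .feed v b})
            (y := g') (by
              simp only [execFn, hc, Move.toInt, ← sub_eq_add_neg, hs'.top, hf]
              rfl), _, _, _, rfl, hr, ?_⟩
          simp only [Op.exec, hf, Move.toInt, ← sub_eq_add_neg]
          exact ⟨hc, rfl, hs'.update (kind_feed hf)⟩
    | fail =>
      exact ⟨_, run_evalStep hP (r₂ := {r with lit := q', op := .skip, err := true}) (y := t₂ h₂)
        (by simp [execFn, Move.toInt]), _, _, _, rfl, hr, rfl⟩

/-- The register between the parts of the decision procedure. -/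
def rg (res : Option Bool) (changed eq : Bool) : Reg := ⟨none, .skip, false, res, changed, eq⟩

/-- The result of the automaton at the end of the word. -/
def finishRes (r : Reg) (y : Frame) : Option Bool :=
  if r.err = false ∧ r.lit = none ∧ y.kind = .root ∧ y.nonempty = true then some y.acc else none

/-- Evaluation of the word with marks. -/
def evalP : SProg :=
  .seq (act2 fun r _ x _ => (rg r.res r.changed r.eq, .stay, (x, .stay), bottom, .stay))
    (.seq (.loop (cond fun _ _ x => x.isSome) evalStep)
      (.seq (act2 fun r _ x y => (rg (finishRes r y) r.changed r.eq, .stay, (x, .stay), y, .stay))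
        rewindTape))

theorem getElem?_cells (m : ℕ → Bool) (W : List Symb) (k o : ℕ) :
    (cells m o W)[k]? = (W[k]?).map fun a => (a, m (o + k)) := by
  induction W generalizing k o with
  | nil => simp [cells]
  | cons a W ih =>
    cases k with
    | zero => rfl
    | succ k =>
      simp only [cells, List.getElem?_cons_succ, ih]
      rw [show o + 1 + k = o + (k + 1) by omega]

theorem length_cells (m : ℕ → Bool) (W : List Symb) (o : ℕ) : (cells m o W).length = W.length := by
  induction W generalizing o with
  | nil => rfl
  | cons a W ih => simp [cells, ih]

/-- The loop invariant is that after `k` symbols the memory represents the configuration `c k`. The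
stack is not cleared beforehand: the entry at the head is overwritten by the bottom entry, and
whatever else remains on that tape is never consulted. -/
theorem does_evalP (W : List Symb) (m : ℕ → Bool) (res : Option Bool) (ch e : Bool) (i : ℕ) :
    Does w evalP (5 * W.length + 6) (St (rg res ch e) i 0 (markTape W m))
      (St (rg (evalRes W m) ch e) i 0 (markTape W m)) := by
  set c₀ : Option PCfg := some (none, bottom, []) with hc₀
  set c : ℕ → Option PCfg := fun k => ((cells m 0 W).take k).foldl pdaStep c₀ with hcdef
  have h1 : Does w (act2 fun r _ x _ => (rg r.res r.changed r.eq, .stay, (x, .stay), bottom, .stay))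
      1 (St (rg res ch e) i 0 (markTape W m))
      (Rep (rg res ch e) i (0 : ℕ) (markTape W m) (c 0)) := by
    rintro _ ⟨h₂, t₂, rfl⟩
    refine ⟨_, run_act2 (r' := rg res ch e) (mi := .stay) (x := markTape W m 0) (m₁ := .stay)
      (y := bottom) (m₂ := .stay) rfl, rg res ch e, h₂, Function.update t₂ h₂ bottom, ?_,
      ⟨rfl, rfl⟩, rfl, rfl, ?_⟩
    · simp [TM.moveInput, Move.toInt]
    · exact ⟨Function.update_self _ _ _, rfl⟩
  have h2 : Does w (.loop (cond fun _ _ x => x.isSome) evalStep) (W.length * 3 + 1)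
      (Rep (rg res ch e) i (0 : ℕ) (markTape W m) (c 0))
      (Rep (rg res ch e) i W.length (markTape W m) (c W.length)) := by
    intro m₀ hm₀
    refine Run.loop_count (fun k => Rep (rg res ch e) i k (markTape W m) (c k)) 2 W.length
      (fun _ _ _ => trivial) (fun k hk m₁ hm₁ => ⟨?_, ?_⟩) (fun m₁ hm₁ => ?_) hm₀
    · obtain ⟨r, h₂, t₂, rfl, -⟩ := hm₁
      exact isSome_markTape hk
    · have hk' : markTape W m k = some (W[k], m k) := by
        simp [markTape_nat, hk]
      have := does_evalStep (w := w) (r₀ := rg res ch e) (i := i) (c := c k) hk' m₁ hm₁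
      have e : c (k + 1) = pdaStep (c k) (W[k], m k) := by
        have hk2 : k < (cells m 0 W).length := by rwa [length_cells]
        have hk3 : (cells m 0 W)[k] = (W[k], m k) := by
          have := getElem?_cells m W k 0
          rw [List.getElem?_eq_getElem hk2, List.getElem?_eq_getElem hk] at this
          simpa using this
        simp only [hcdef]
        rw [List.take_succ_eq_append_getElem hk2, List.foldl_append, hk3]
        rfl
      rw [e]
      exact_mod_cast this
    · obtain ⟨r, h₂, t₂, rfl, -⟩ := hm₁
      change (markTape W m (W.length : ℤ)).isSome = false
      rw [markTape_length]
      rfl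
  have h3 : Does w (act2 fun r _ x y =>
      (rg (finishRes r y) r.changed r.eq, .stay, (x, .stay), y, .stay)) 1
      (Rep (rg res ch e) i W.length (markTape W m) (c W.length))
      (St (rg (evalRes W m) ch e) i W.length (markTape W m)) := by
    rintro _ ⟨r, h₂, t₂, rfl, ⟨hr1, hr2⟩, hc⟩
    have hres : finishRes r (t₂ h₂) = evalRes W m := by
      have hcc : c W.length = (cells m 0 W).foldl pdaStep c₀ := by
        simp only [hcdef]
        rw [List.take_of_length_le (by rw [length_cells])]
      have hev : evalRes W m = match c W.length with
        | some (none, f, _) => if f.kind = .root ∧ f.nonempty = true then some f.acc else none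
        | _ => none := by
        rw [hcc]
        rfl
      rw [hev]
      generalize c W.length = d at hc
      rcases d with _ | ⟨_ | q, f, st⟩
      · have hc : r.err = true := hc
        simp [finishRes, hc]
      · obtain ⟨h1, h2, h3⟩ := hc
        simp [finishRes, h1, h2, h3.top]
      · obtain ⟨h1, h2, h3⟩ := hc
        simp [finishRes, h2]
    have hr1 : r.changed = ch := hr1
    have hr2 : r.eq = e := hr2
    refine ⟨_, run_act2 (r' := rg (evalRes W m) ch e) (mi := .stay) (x := markTape W m W.length)
      (m₁ := .stay) (y := t₂ h₂) (m₂ := .stay) (by simp only [hres, hr1, hr2]), h₂, t₂, ?_⟩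
    simp [TM.moveInput, Move.toInt]
  have h4 := does_rewindTape (w := w) (r := rg (evalRes W m) ch e) (i := i) W m W.length le_rfl
  exact (h1.seq (h2.seq (h3.seq h4))).mono (by omega)

end Sat

/-! ### Comparison of names of variables -/

namespace NNF

/-- The name of a variable as it is written. -/
def nameCode (x : PVar) : List Symb := x.map .bit ++ [.endMark]

theorem LitAt.sign {W : List Symb} {j : ℕ} {s : Bool} {x : PVar} (h : LitAt W j s x) :
    W[j]? = some (.sign s) := by
  obtain ⟨t, h⟩ := h
  have := List.getElem?_drop (xs := W) (i := j) (j := 0)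
  rw [add_zero, ← h] at this
  rw [← this]
  rfl

theorem LitAt.name {W : List Symb} {j : ℕ} {s : Bool} {x : PVar} (h : LitAt W j s x) {q : ℕ}
    {a : Symb} (hq : (nameCode x)[q]? = some a) : W[j + 1 + q]? = some a := by
  obtain ⟨t, h⟩ := h
  have := List.getElem?_drop (xs := W) (i := j) (j := q + 1)
  rw [← h] at this
  rw [show j + 1 + q = j + (q + 1) by omega, ← this]
  change (nameCode x ++ t)[q]? = some a
  rw [List.getElem?_append_left (List.getElem?_eq_some_iff.1 hq).1, hq]

/-- Every sign in the word is the start of a literal. -/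
def SignsOfLits (W : List Symb) : Prop :=
  ∀ j s, W[j]? = some (.sign s) → ∃ x, LitAt W j s x

theorem SignsOfLits.append {W V : List Symb} (h : SignsOfLits W) (h' : SignsOfLits V) :
    SignsOfLits (W ++ V) := by
  intro j s hj
  by_cases hl : j < W.length
  · rw [List.getElem?_append_left hl] at hj
    obtain ⟨x, hx⟩ := h j s hj
    refine ⟨x, ?_⟩
    unfold LitAt at hx ⊢
    rw [List.drop_append_of_le_length hl.le]
    exact hx.trans (List.prefix_append _ _)
  · rw [List.getElem?_append_right (by omega)] at hj
    obtain ⟨x, hx⟩ := h' _ s hj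
    refine ⟨x, ?_⟩
    unfold LitAt at hx ⊢
    rwa [List.drop_append, List.drop_of_length_le (by omega), List.nil_append]

theorem signsOfLits_of_forall {W : List Symb} (h : ∀ s, .sign s ∉ W) : SignsOfLits W :=
  fun _ s hj => absurd (List.mem_of_getElem? hj) (h s)

theorem signsOfLits_flatten {l : List (List Symb)} (h : ∀ W ∈ l, SignsOfLits W) :
    SignsOfLits l.flatten := by
  induction l with
  | nil => exact signsOfLits_of_forall (by simp)
  | cons W l ih =>
    rw [List.flatten_cons]
    exact (h W (by simp)).append (ih fun V hV => h V (List.mem_cons_of_mem _ hV))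

/-- Signs occur only at the beginning of literals, so in the code of a formula a scanned sign
suffices to know that a literal starts there. -/
theorem signsOfLits_encode (φ : NNF) : SignsOfLits φ.encode := by
  induction φ with
  | lit s x =>
    intro j s' hj
    cases j with
    | zero =>
      obtain rfl : s = s' := by simpa [encode] using hj
      exact ⟨x, by simp [LitAt]⟩
    | succ j =>
      exfalso
      have : Symb.sign s' ∈ x.map Symb.bit ++ [Symb.endMark] := List.mem_of_getElem? hj
      simp at this
  | conj φ ih =>
    refine SignsOfLits.append (W := [Symb.andOpen]) (signsOfLits_of_forall (by simp))
      ((signsOfLits_flatten fun W hW => ?_).append (signsOfLits_of_forall (by simp)))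
    obtain ⟨i, rfl⟩ := (List.mem_ofFn' _ _).1 hW
    exact ih i
  | disj φ ih =>
    refine SignsOfLits.append (W := [Symb.orOpen]) (signsOfLits_of_forall (by simp))
      ((signsOfLits_flatten fun W hW => ?_).append (signsOfLits_of_forall (by simp)))
    obtain ⟨i, rfl⟩ := (List.mem_ofFn' _ _).1 hW
    exact ih i

/-- Two names agree up to a position at which they can be compared. -/
theorem exists_common (x y : PVar) : ∃ (p : ℕ) (a b : Symb),
    (∀ q < p, ∃ d, (nameCode x)[q]? = some (.bit d) ∧ (nameCode y)[q]? = some (.bit d)) ∧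
      (nameCode x)[p]? = some a ∧ (nameCode y)[p]? = some b ∧
      (∀ s, a ≠ .sign s) ∧ (∀ s, b ≠ .sign s) ∧ (∀ d, ¬ (a = .bit d ∧ b = .bit d)) ∧
      (x = y ↔ a = .endMark ∧ b = .endMark) := by
  induction x generalizing y with
  | nil =>
    cases y with
    | nil => exact ⟨0, .endMark, .endMark, by simp, rfl, rfl, by simp, by simp, by simp, by simp⟩
    | cons d y => exact ⟨0, .endMark, .bit d, by simp, rfl, rfl, by simp, by simp, by simp, by simp⟩
  | cons d x ih =>
    cases y with
    | nil => exact ⟨0, .bit d, .endMark, by simp, rfl, rfl, by simp, by simp, by simp, by simp⟩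
    | cons d' y =>
      by_cases hd : d = d'
      · subst hd
        obtain ⟨p, a, b, h1, h2, h3, h4, h5, h6, h7⟩ := ih y
        refine ⟨p + 1, a, b, fun q hq => ?_, h2, h3, h4, h5, h6, by simpa using h7⟩
        cases q with
        | zero => exact ⟨d, rfl, rfl⟩
        | succ q => exact h1 q (by omega)
      · exact ⟨0, .bit d, .bit d', by simp, rfl, rfl, by simp, by simp, by
          rintro e ⟨h1, h2⟩
          simp only [Symb.bit.injEq] at h1 h2
          exact hd (h1.trans h2.symm), by simp [hd]⟩

end NNF

namespace Sat

open NNF Prog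

variable {w : List Symb} {r r' : Reg} {i : ℕ} {h : ℤ} {t t' : ℤ → Mark}

/-- Both symbols are the same bit. -/
def sameBit (a : Option Symb) (x : Mark) : Bool :=
  match a, x with
  | some (.bit b), some (.bit d, _) => b == d
  | _, _ => false

/-- The symbol is a sign. -/
def isSign (a : Option Symb) : Bool :=
  match a with
  | some (.sign _) => true
  | _ => false

/-- Compare the name of the variable at the input head with the name at the head on the word; if
they are the same, mark the literal at the head on the word as false. -/
def compareP : SProg :=
  .seq (moves .right .right) <| .seq (.loop (cond fun _ a x => sameBit a x) (moves .right .right)) <|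
  .seq (step1 fun r a x => ({r with eq := decide (a = some .endMark ∧ x.map Prod.fst = some .endMark)},
    .stay, x, .stay)) <|
  .seq (.loop (cond fun _ a _ => !isSign a) (moves .left .stay)) <|
  .seq (.loop (cond fun _ _ x => !isSign (x.map Prod.fst)) (moves .stay .left)) <|
  step1 fun r _ x => (if r.eq then {r with eq := false, changed := true} else r, .stay,
    if r.eq then some (.sign false, false) else x, .stay)

/-- The input tape holds the same word as the work tape, so two heads can read the two names in
parallel. They run to the first position where the names differ or both end, and each returns to the
nearest sign on its left. The input head is at `j + 1` because cell 0 holds the end marker. With `p`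
common bits the time is at most `6 * p + 12`. -/
theorem does_compareP {W : List Symb} {m : ℕ → Bool} {res : Option Bool} {ch : Bool} {j k : ℕ}
    {x y : PVar} (hj : LitAt W j true x) (hk : LitAt W k false y) :
    Does W compareP (6 * W.length + 12) (St (rg res ch false) (j + 1) k (markTape W m))
      (St (rg res (ch || decide (x = y)) false) (j + 1) k
        (markTape W (if x = y then Function.update m k false else m))) := by
  obtain ⟨p, a, b, hp, ha, hb, ha', hb', hab, hxy⟩ := exists_common x y
  have hjW : j + 1 + p < W.length := (List.getElem?_eq_some_iff.1 (hj.name ha)).1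
  have hsj : ∀ q ≤ p, isSign W[j + 1 + q]? = false := by
    intro q hq
    rcases hq.lt_or_eq with hq | rfl
    · obtain ⟨d, hd, -⟩ := hp q hq
      rw [hj.name hd]
      rfl
    · rw [hj.name ha]
      cases a <;> first | rfl | exact absurd rfl (ha' _)
  have hsk : ∀ q ≤ p, isSign W[k + 1 + q]? = false := by
    intro q hq
    rcases hq.lt_or_eq with hq | rfl
    · obtain ⟨d, -, hd⟩ := hp q hq
      rw [hk.name hd]
      rfl
    · rw [hk.name hb]
      cases b <;> first | rfl | exact absurd rfl (hb' _)
  set r₀ := rg res ch false with hr₀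
  set e := decide (x = y) with he
  set r₁ := rg res ch e with hr₁
  have h1 : Does W (moves .right .right) 1 (St r₀ (j + 1) k (markTape W m))
      (St r₀ (j + 2 + 0) (k + 1 + (0 : ℕ) : ℕ) (markTape W m)) := by
    have := does_moves (w := W) (r := r₀) (i := j + 1) (h := k) (t := markTape W m) .right .right
    simp only [TM.moveInput, Move.toInt] at this
    rw [min_eq_left (by omega)] at this
    exact_mod_cast this
  have h2 := Does.loop (w := W) (p := moves .right .right) (c := fun _ a x => sameBit a x) p 1
    (fun _ => r₀) (fun q => j + 2 + q) (fun q => ((k + 1 + q : ℕ) : ℤ)) (fun _ => markTape W m)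
    (fun q hq => by
      obtain ⟨d, hd, hd'⟩ := hp q hq
      rw [show j + 2 + q = j + 1 + q + 1 by omega, markTape_nat, TM.readInput, hj.name hd,
        hk.name hd']
      simp [sameBit])
    (fun q hq => by
      have := does_moves (w := W) (r := r₀) (i := j + 2 + q) (h := (k + 1 + q : ℕ))
        (t := markTape W m) .right .right
      simp only [TM.moveInput, Move.toInt] at this
      rw [min_eq_left (by omega)] at this
      exact_mod_cast this)
    (by
      rw [show j + 2 + p = j + 1 + p + 1 by omega, markTape_nat, TM.readInput, hj.name ha,
        hk.name hb]
      cases a <;> cases b <;> simp [sameBit]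
      rename_i d d'
      intro hd
      subst hd
      exact hab _ ⟨rfl, rfl⟩)
  have h3 : Does W (step1 fun r a x =>
      ({r with eq := decide (a = some .endMark ∧ x.map Prod.fst = some .endMark)},
        .stay, x, .stay)) 1 (St r₀ (j + 2 + p) (k + 1 + p : ℕ) (markTape W m))
      (St r₁ (j + 1 + (p + 1) - 0) (k + 1 + p : ℕ) (markTape W m)) := by
    have := does_step1 (w := W) (r := r₀) (i := j + 2 + p) (h := (k + 1 + p : ℕ))
      (t := markTape W m) (r' := r₁) (mi := .stay) (mv := .stay) (x := markTape W m (k + 1 + p : ℕ))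
      (f := fun r a x => ({r with eq := decide (a = some .endMark ∧ x.map Prod.fst = some .endMark)},
        .stay, x, .stay)) (by
        rw [show j + 2 + p = j + 1 + p + 1 by omega, markTape_nat, TM.readInput, hj.name ha,
          hk.name hb]
        simp only [Option.map_some, Option.some.injEq, ← hxy]
        rfl)
    simp only [Function.update_eq_self, TM.moveInput, Move.toInt, add_zero] at this
    rwa [show j + 1 + (p + 1) - 0 = j + 2 + p by omega]
  have h4 := Does.loop (w := W) (p := moves .left .stay) (c := fun _ a _ => !isSign a) (p + 1) 1
    (fun _ => r₁) (fun q => j + 1 + (p + 1) - q) (fun q => ((k + 1 + p : ℕ) : ℤ))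
    (fun _ => markTape W m)
    (fun q hq => by
      rw [show j + 1 + (p + 1) - q = j + 1 + (p - q) + 1 by omega, TM.readInput,
        hsj _ (by omega)]
      rfl)
    (fun q hq => by
      have := does_moves (w := W) (r := r₁) (i := j + 1 + (p + 1) - q) (h := (k + 1 + p : ℕ))
        (t := markTape W m) .left .stay
      simp only [TM.moveInput, Move.toInt, add_zero] at this
      rwa [show j + 1 + (p + 1) - (q + 1) = j + 1 + (p + 1) - q - 1 by omega])
    (by
      rw [show j + 1 + (p + 1) - (p + 1) = j + 1 by omega, TM.readInput, hj.sign]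
      rfl)
  rw [show j + 1 + (p + 1) - (p + 1) = j + 1 by omega] at h4
  have h5 := Does.loop (w := W) (p := moves .stay .left)
    (c := fun _ _ x => !isSign (x.map Prod.fst)) (p + 1) 1
    (fun _ => r₁) (fun q => j + 1) (fun q => ((k + 1 + p : ℕ) : ℤ) - q)
    (fun _ => markTape W m)
    (fun q hq => by
      rw [show ((k + 1 + p : ℕ) : ℤ) - q = ((k + 1 + (p - q) : ℕ) : ℤ) by omega, markTape_nat,
        Option.map_map]
      have := hsk (p - q) (by omega)
      simp only [Function.comp_def, Option.map_id']
      rw [this]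
      rfl)
    (fun q hq => by
      have := does_moves (w := W) (r := r₁) (i := j + 1) (h := ((k + 1 + p : ℕ) : ℤ) - q)
        (t := markTape W m) .stay .left
      simp only [TM.moveInput, Move.toInt] at this
      rwa [show ((k + 1 + p : ℕ) : ℤ) - (q + 1 : ℕ) = ((k + 1 + p : ℕ) : ℤ) - q + -1 by omega])
    (by
      rw [show ((k + 1 + p : ℕ) : ℤ) - (p + 1 : ℕ) = (k : ℤ) by omega, markTape_nat, hk.sign]
      rfl)
  rw [show ((k + 1 + p : ℕ) : ℤ) - (p + 1 : ℕ) = (k : ℤ) by omega,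
    show ((k + 1 + p : ℕ) : ℤ) - (0 : ℕ) = (k + 1 + p : ℕ) by omega] at h5
  have h6 : Does W (step1 fun r _ x => (if r.eq then {r with eq := false, changed := true} else r,
      .stay, if r.eq then some (.sign false, false) else x, .stay)) 1
      (St r₁ (j + 1) k (markTape W m))
      (St (rg res (ch || e) false) (j + 1) k
        (markTape W (if x = y then Function.update m k false else m))) := by
    have := does_step1 (w := W) (r := r₁) (i := j + 1) (h := k)
      (t := markTape W m) (r' := rg res (ch || e) false) (mi := .stay) (mv := .stay)
      (x := if e then some (.sign false, false) else markTape W m k)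
      (f := fun r _ x => (if r.eq then {r with eq := false, changed := true} else r,
        .stay, if r.eq then some (.sign false, false) else x, .stay)) (by
        rw [hr₁]
        cases e <;> simp [rg])
    simp only [TM.moveInput, Move.toInt, add_zero] at this
    by_cases hxy' : x = y
    · have he' : e = true := by simp [he, hxy']
      simp only [he', if_true, if_pos hxy'] at this ⊢
      rwa [update_markTape m hk.sign] at this
    · have he' : e = false := by simp [he, hxy']
      simp only [he', Bool.false_eq_true, if_false, if_neg hxy', Function.update_eq_self] at this ⊢
      exact this
  exact (h1.seq (h2.seq (h3.seq (h4.seq (h5.seq h6))))).mono (by omega)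

end Sat

/-! ### The marking procedure -/

namespace Sat

open NNF Prog

/-- At positions `j` and `k` there are a positive and a negative literal with the same variable. -/
def SameName (W : List Symb) (j k : ℕ) : Prop := ∃ x, LitAt W j true x ∧ LitAt W k false x

open Classical in
/-- The marks after all negations of the variable at position `j` are marked as false. -/
noncomputable def strike (W : List Symb) (j : ℕ) (m : ℕ → Bool) (k : ℕ) : Bool :=
  m k && !decide (SameName W j k)

open Classical in
/-- The marks after the positive literal at position `j` has been examined. -/
noncomputable def examine (W : List Symb) (j : ℕ) (m : ℕ → Bool) : ℕ → Bool :=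
  if W[j]? = some (.sign true) ∧ evalRes W (Function.update m j false) = some false then
    strike W j m
  else m

/-- The marks after the first `j` positions have been examined. -/
noncomputable def marksAt (W : List Symb) (m : ℕ → Bool) : ℕ → ℕ → Bool
  | 0 => m
  | j + 1 => examine W j (marksAt W m j)

/-- The marks after all positions have been examined. -/
noncomputable def round (W : List Symb) (m : ℕ → Bool) : ℕ → Bool := marksAt W m W.length

variable {W : List Symb} {m : ℕ → Bool}

theorem strike_le (j : ℕ) : strike W j m ≤ m := fun k => by
  unfold strike
  exact Bool.and_le_left _ _

theorem examine_le (j : ℕ) : examine W j m ≤ m := by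
  unfold examine
  split_ifs
  · exact strike_le j
  · exact le_rfl

theorem marksAt_le (j : ℕ) : marksAt W m j ≤ m := by
  induction j with
  | zero => exact le_rfl
  | succ j ih => exact (examine_le j).trans ih

theorem marksAt_anti {j k : ℕ} (h : j ≤ k) : marksAt W m k ≤ marksAt W m j := by
  induction k, h using Nat.le_induction with
  | base => exact le_rfl
  | succ k _ ih => exact (examine_le k).trans ih

theorem round_le : round W m ≤ m := marksAt_le _

theorem strike_apply_sign_true {j k : ℕ} (hk : W[k]? = some (.sign true)) :
    strike W j m k = m k := by
  have : ¬ SameName W j k := by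
    rintro ⟨x, -, hx⟩
    rw [hx.sign] at hk
    simp at hk
  simp [strike, this]

/-- Positive literals are marked as true. -/
def PosTrue (W : List Symb) (m : ℕ → Bool) : Prop := ∀ j, W[j]? = some (.sign true) → m j = true

theorem PosTrue.examine (h : PosTrue W m) (j : ℕ) : PosTrue W (examine W j m) := by
  intro k hk
  unfold Sat.examine
  split_ifs
  · rw [strike_apply_sign_true hk, h k hk]
  · exact h k hk

theorem PosTrue.marksAt (h : PosTrue W m) (j : ℕ) : PosTrue W (marksAt W m j) := by
  induction j with
  | zero => exact h
  | succ j ih => exact ih.examine j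

theorem strike_of_length_le {j k : ℕ} (hk : W.length ≤ k) : strike W j m k = m k := by
  have : ¬ SameName W j k := by
    rintro ⟨x, -, hx⟩
    have := (List.getElem?_eq_some_iff.1 hx.sign).1
    omega
  simp [strike, this]

theorem round_of_length_le {k : ℕ} (hk : W.length ≤ k) : round W m k = m k := by
  suffices H : ∀ j, marksAt W m j k = m k from H _
  intro j
  induction j with
  | zero => rfl
  | succ j ih =>
    rw [marksAt, examine]
    split_ifs
    · rw [strike_of_length_le hk, ih]
    · exact ih

/-- Marks change only if the evaluation has derived the variable, and then only at its negations. -/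
theorem SoundMarks.examine {φ : NNF} (hφ : φ.IsHNF) (hm : φ.SoundMarks m) (j : ℕ) :
    φ.SoundMarks (examine φ.encode j m) := by
  unfold Sat.examine
  split_ifs with h
  · obtain ⟨h1, h2⟩ := h
    rw [evalRes_encode φ hφ] at h2
    refine ⟨fun k x hk => ?_, fun v hv k x hk hmk => ?_⟩
    · rw [strike_apply_sign_true hk.sign, hm.1 k x hk]
    · cases hk' : m k with
      | false => exact hm.2 v hv k x hk hk'
      | true =>
        have hs : SameName φ.encode j k := by
          by_contra hs
          simp [strike, hs, hk'] at hmk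
        obtain ⟨y, hy, hy'⟩ := hs
        obtain ⟨-, rfl⟩ := hk.unique hy'
        exact hm.consequence hy (Option.some.inj h2) hv
  · exact hm

theorem SoundMarks.round {φ : NNF} (hφ : φ.IsHNF) (hm : φ.SoundMarks m) :
    φ.SoundMarks (round φ.encode m) := by
  unfold Sat.round
  generalize φ.encode.length = j
  induction j with
  | zero => exact hm
  | succ j ih => exact SoundMarks.examine hφ ih j

/-- Marks only decrease during a round. If they agree at its beginning and its end, each single
examination left them unchanged, so they are closed under derivation. -/
theorem satisfiable_iff_of_round_eq {φ : NNF} (hφ : φ.IsHNF) (hm : φ.SoundMarks m)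
    (hr : round φ.encode m = m) : φ.Satisfiable ↔ evalRes φ.encode m = some true := by
  rw [evalRes_encode φ hφ, Option.some.injEq]
  refine satisfiable_iff_ev hφ hm fun j x hj he k hk => ?_
  have hjl : j < φ.encode.length := (List.getElem?_eq_some_iff.1 hj.sign).1
  have heq : ∀ i ≤ φ.encode.length, marksAt φ.encode m i = m := fun i hi =>
    le_antisymm (marksAt_le i) (hr.symm.le.trans (marksAt_anti hi))
  have h1 := heq (j + 1) hjl
  rw [marksAt, heq j hjl.le, examine, if_pos ⟨hj.sign, by rw [evalRes_encode φ hφ, he]⟩] at h1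
  have h2 := congrFun h1 k
  have hs : SameName φ.encode j k := ⟨x, hj, hk⟩
  simpa [strike, hs] using h2.symm

theorem soundMarks_true (φ : NNF) : φ.SoundMarks fun _ => true :=
  ⟨fun _ _ _ => rfl, fun _ _ _ _ _ h => Bool.noConfusion h⟩

/-- The number of rounds until the marks do not change. -/
theorem exists_iterate_round (W : List Symb) (m : ℕ → Bool) : ∃ K ≤ W.length,
    (round W)^[K + 1] m = (round W)^[K] m ∧ ∀ k < K, (round W)^[k + 1] m ≠ (round W)^[k] m := by
  have key : ∃ K, K ≤ W.length ∧ (round W)^[K + 1] m = (round W)^[K] m := by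
    by_contra! H
    -- Every round that changes something lowers the number of true marks within the word by at
    -- least one.
    have hcard : ∀ k ≤ W.length + 1,
        ((Finset.range W.length).filter fun q => (round W)^[k] m q = true).card + k ≤ W.length := by
      intro k
      induction k with
      | zero =>
        intro _
        exact (Finset.card_filter_le _ _).trans_eq (Finset.card_range _)
      | succ k ih =>
        intro hk
        have h1 := ih (by omega)
        have h2 := H k (by omega)
        rw [Function.iterate_succ_apply'] at h2 ⊢
        generalize (round W)^[k] m = m' at h1 h2 ⊢
        have h3 := Finset.card_lt_card (s := (Finset.range W.length).filter fun q =>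
          round W m' q = true) (t := (Finset.range W.length).filter fun q => m' q = true) ?_
        · omega
        · rw [Finset.ssubset_iff_subset_ne]
          refine ⟨fun q hq => ?_, fun he => h2 ?_⟩
          · rw [Finset.mem_filter] at hq ⊢
            exact ⟨hq.1, le_antisymm le_top (hq.2.symm.le.trans (round_le q))⟩
          · funext q
            by_cases hq : q < W.length
            · have := Finset.ext_iff.1 he q
              simp only [Finset.mem_filter, Finset.mem_range, hq, true_and] at this
              rwa [Bool.eq_iff_iff]
            · exact round_of_length_le (by omega)
    have := hcard _ le_rfl
    omega
  classical
  refine ⟨Nat.find key, (Nat.find_spec key).1, (Nat.find_spec key).2, fun k hk he => ?_⟩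
  exact Nat.find_min key hk ⟨hk.le.trans (Nat.find_spec key).1, he⟩

end Sat

/-! ### The decision procedure as a program -/

namespace Sat

open NNF Prog

variable {W : List Symb} {m : ℕ → Bool} {r : Reg} {ch : Bool}

/-- Mark the negations of the variable at the input head as false. -/
def strikeP : SProg :=
  .seq (.loop (cond fun _ _ x => x.isSome)
    (.seq (.ite (cond fun _ _ x => decide (x = some (.sign false, true))) compareP
      (moves .stay .stay)) (moves .stay .right))) rewindTape

/-- The time for `strikeP`. -/
def strikeTime (n : ℕ) : ℕ := n * (6 * n + 15) + 1 + (2 * n + 3)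

open Classical in
theorem does_strikeP (hW : SignsOfLits W) {res : Option Bool} {j : ℕ}
    (hj : W[j]? = some (.sign true)) :
    Does W strikeP (strikeTime W.length) (St (rg res ch false) (j + 1) 0 (markTape W m))
      (St (rg res (ch || decide (strike W j m ≠ m)) false) (j + 1) 0
        (markTape W (strike W j m))) := by
  obtain ⟨x, hx⟩ := hW j true hj
  -- The marks `μ k` are those after the first `k` positions have been treated; they serve as loop
  -- invariant.
  set μ : ℕ → ℕ → Bool := fun k q => if q < k then strike W j m q else m q with hμ
  have hμ0 : μ 0 = m := by
    funext q
    simp [hμ]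
  have hμn : μ W.length = strike W j m := by
    funext q
    simp only [hμ]
    split_ifs with h
    · rfl
    · exact (strike_of_length_le (by omega)).symm
  have hμs : ∀ k, μ (k + 1) = Function.update (μ k) k (strike W j m k) := by
    intro k
    funext q
    by_cases hq : q = k
    · subst hq
      simp [hμ]
    · rw [Function.update_of_ne hq]
      simp only [hμ, show (q < k + 1) = (q < k) by rw [eq_iff_iff]; omega]
  have hμk : ∀ k, μ k k = m k := by simp [hμ]
  have hloop := Does.loop (w := W) (p := .seq (.ite (cond fun _ _ x =>
      decide (x = some (.sign false, true))) compareP (moves .stay .stay)) (moves .stay .right))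
    (c := fun _ _ x => x.isSome) W.length (6 * W.length + 14)
    (fun k => rg res (ch || decide (μ k ≠ m)) false) (fun _ => j + 1) (fun k => (k : ℤ))
    (fun k => markTape W (μ k))
    (fun k hk => isSome_markTape hk)
    (fun k hk => by
      have h1 : Does W (.ite (cond fun _ _ x => decide (x = some (.sign false, true))) compareP
          (moves .stay .stay)) (6 * W.length + 12 + 1)
          (St (rg res (ch || decide (μ k ≠ m)) false) (j + 1) k (markTape W (μ k)))
          (St (rg res (ch || decide (μ (k + 1) ≠ m)) false) (j + 1) k
            (markTape W (μ (k + 1)))) := by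
        apply Does.ite
        -- Only negative literals still marked true are compared, so the flag reports genuine
        -- changes.
        by_cases hc : W[k]? = some (.sign false) ∧ m k = true
        · obtain ⟨y, hy⟩ := hW k false hc.1
          rw [if_pos (by simp [markTape_nat, hc.1, hμk, hc.2])]
          have := does_compareP (m := μ k) (res := res) (ch := ch || decide (μ k ≠ m)) hx hy
          by_cases hxy : x = y
          · have hs : SameName W j k := ⟨x, hx, hxy ▸ hy⟩
            have hsk : strike W j m k = false := by simp [strike, hs]
            have hne : μ (k + 1) ≠ m := fun he => by
              have := congrFun he k
              rw [hμs, Function.update_self, hsk, hc.2] at this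
              cases this
            simp only [hxy, if_true, decide_true, Bool.or_true] at this
            rw [decide_eq_true hne, Bool.or_true, hμs, hsk]
            exact this
          · have hs : ¬ SameName W j k := by
              rintro ⟨z, hz, hz'⟩
              exact hxy ((hx.unique hz).2.trans (hy.unique hz').2.symm)
            have hsk : μ (k + 1) = μ k := by
              rw [hμs, strike, decide_eq_false hs, Bool.not_false, Bool.and_true, ← hμk,
                Function.update_eq_self]
            simpa [hxy, hsk] using this
        · have hsk : μ (k + 1) = μ k := by
            rw [hμs]
            have : strike W j m k = m k := by
              rw [strike]
              cases hmk : m k with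
              | false => rfl
              | true =>
                have : ¬ SameName W j k := by
                  rintro ⟨z, -, hz⟩
                  exact hc ⟨hz.sign, hmk⟩
                simp [this]
            rw [this, ← hμk, Function.update_eq_self]
          rw [if_neg, hsk]
          · have := does_moves (w := W) (r := rg res (ch || decide (μ k ≠ m)) false) (i := j + 1)
              (h := k) (t := markTape W (μ k)) .stay .stay
            simp only [TM.moveInput, Move.toInt, add_zero] at this
            exact this.mono (by omega)
          · simp only [markTape_nat, hμk, decide_eq_true_eq, Option.map_eq_some_iff,
              Prod.mk.injEq]
            rintro ⟨a, h1, rfl, h2⟩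
            exact hc ⟨h1, h2⟩
      have h2 := does_moves (w := W) (r := rg res (ch || decide (μ (k + 1) ≠ m)) false)
        (i := j + 1) (h := k) (t := markTape W (μ (k + 1))) .stay .right
      simp only [TM.moveInput, Move.toInt] at h2
      exact_mod_cast h1.seq h2)
    (by rw [markTape_length]; rfl)
  have hr := does_rewindTape (w := W) (r := rg res (ch || decide (μ W.length ≠ m)) false)
    (i := j + 1) W (μ W.length) W.length le_rfl
  have := hloop.seq hr
  have h0 : decide (μ 0 ≠ m) = false := by simp [hμ0]
  rw [h0, hμn, hμ0, Bool.or_false] at this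
  exact this

/-- Examine the positive literal at the heads. -/
def examineP : SProg :=
  .seq (step1 fun r _ _ => (r, .stay, some (.sign true, false), .stay)) <|
  .seq rewindTape <| .seq evalP <|
  .seq (.ite (cond fun r _ _ => decide (r.res = some false)) strikeP (moves .stay .stay)) <|
  .seq (.loop (cond fun _ _ x => decide (x ≠ some (.sign true, false))) (moves .stay .right)) <|
  step1 fun r _ _ => ({r with res := none}, .stay, some (.sign true, true), .stay)

/-- The time for `examineP`. -/
def examineTime (n : ℕ) : ℕ :=
  1 + ((2 * n + 3) + ((5 * n + 6) + (strikeTime n + 1 + ((n * 2 + 1) + 1))))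

open Classical in
-- The mark set to false at `j` has two purposes. It gives the tentative valuation, and it is a
-- bookmark: all other positive literals are marked true, so the head finds its way back to `j`,
-- where the mark is restored.
theorem does_examineP (hW : SignsOfLits W) (hm : PosTrue W m) {j : ℕ}
    (hj : W[j]? = some (.sign true)) :
    Does W examineP (examineTime W.length) (St (rg none ch false) (j + 1) j (markTape W m))
      (St (rg none (ch || decide (examine W j m ≠ m)) false) (j + 1) j
        (markTape W (examine W j m))) := by
  have hjl : j < W.length := (List.getElem?_eq_some_iff.1 hj).1
  set m₁ := Function.update m j false with hm₁
  set m₂ := if evalRes W m₁ = some false then strike W j m₁ else m₁ with hm₂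
  set ch' := ch || decide (examine W j m ≠ m) with hch'
  -- A strike changes negative literals only, so it commutes with the temporary change at the
  -- positive literal `j`.
  have e2 : Function.update m₂ j true = examine W j m := by
    rw [hm₂, examine]
    by_cases he : evalRes W m₁ = some false
    · rw [if_pos he, if_pos ⟨hj, he⟩]
      funext k
      by_cases hk : k = j
      · subst hk
        rw [Function.update_self, strike_apply_sign_true hj, hm _ hj]
      · rw [Function.update_of_ne hk, strike, strike, hm₁, Function.update_of_ne hk]
    · rw [if_neg he, if_neg fun h => he h.2, hm₁, Function.update_idem, ← hm j hj,
        Function.update_eq_self]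
  have e2' : m₂ = Function.update (examine W j m) j false := by
    have hmj : m₂ j = false := by
      rw [hm₂]
      split_ifs
      · rw [strike_apply_sign_true hj, hm₁, Function.update_self]
      · rw [hm₁, Function.update_self]
    rw [← e2, Function.update_idem, ← hmj, Function.update_eq_self]
  have h1 : Does W (step1 fun r _ _ => (r, .stay, some (.sign true, false), .stay)) 1
      (St (rg none ch false) (j + 1) j (markTape W m))
      (St (rg none ch false) (j + 1) j (markTape W m₁)) := by
    have := does_step1 (w := W) (r := rg none ch false) (i := j + 1) (h := j)
      (t := markTape W m) (r' := rg none ch false) (mi := .stay) (mv := .stay)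
      (x := some (.sign true, false))
      (f := fun r _ _ => (r, .stay, some (.sign true, false), .stay)) rfl
    rw [update_markTape m hj] at this
    simpa only [TM.moveInput, Move.toInt, add_zero] using this
  have h2 := does_rewindTape (w := W) (r := rg none ch false) (i := j + 1) W m₁ j hjl.le
  have h3 := does_evalP (w := W) W m₁ none ch false (j + 1)
  have h4 : Does W (.ite (cond fun r _ _ => decide (r.res = some false)) strikeP
      (moves .stay .stay)) (strikeTime W.length + 1)
      (St (rg (evalRes W m₁) ch false) (j + 1) 0 (markTape W m₁))
      (St (rg (evalRes W m₁) ch' false) (j + 1) (0 : ℕ) (markTape W m₂)) := by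
    apply Does.ite
    by_cases he : evalRes W m₁ = some false
    · rw [if_pos (by simp [rg, he])]
      have := does_strikeP (m := m₁) (ch := ch) hW (res := evalRes W m₁) hj
      -- The strike is performed on the tentative marks; it changes them iff it changes the original
      -- ones.
      have hiff : strike W j m₁ ≠ m₁ ↔ examine W j m ≠ m := by
        rw [not_iff_not]
        rw [hm₂, if_pos he] at e2 e2'
        constructor
        · intro h
          rw [← e2, h, hm₁, Function.update_idem, ← hm j hj, Function.update_eq_self]
        · intro h
          rw [e2', h]
      rw [decide_eq_decide.2 hiff] at this
      rw [hm₂, if_pos he]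
      exact this
    · rw [if_neg (by simp [rg, he])]
      have hex : examine W j m = m := by
        rw [examine, if_neg fun h => he h.2]
      have hc : ch' = ch := by simp [hch', hex]
      rw [hc, hm₂, if_neg he]
      have := does_moves (w := W) (r := rg (evalRes W m₁) ch false) (i := j + 1)
        (h := 0) (t := markTape W m₁) .stay .stay
      simp only [TM.moveInput, Move.toInt, add_zero] at this
      exact this.mono (by unfold strikeTime; omega)
  have h5 := Does.loop (w := W) (p := moves .stay .right)
    (c := fun _ _ x => decide (x ≠ some (.sign true, false))) j 1
    (fun _ => rg (evalRes W m₁) ch' false) (fun _ => j + 1) (fun k => (k : ℤ))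
    (fun _ => markTape W m₂)
    (fun k hk => by
      simp only [ne_eq, markTape_nat, decide_eq_true_eq, Option.map_eq_some_iff, Prod.mk.injEq]
      rintro ⟨a, h1, rfl, h2⟩
      rw [e2', Function.update_of_ne hk.ne, hm.examine j k h1] at h2
      cases h2)
    (fun k hk => by
      have := does_moves (w := W) (r := rg (evalRes W m₁) ch' false) (i := j + 1)
        (h := k) (t := markTape W m₂) .stay .right
      simp only [TM.moveInput, Move.toInt] at this
      exact_mod_cast this)
    (by
      rw [markTape_nat, hj, e2', Function.update_self]
      rfl)
  have h6 : Does W (step1 fun r _ _ => ({r with res := none}, .stay, some (.sign true, true), .stay))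
      1 (St (rg (evalRes W m₁) ch' false) (j + 1) j (markTape W m₂))
      (St (rg none ch' false) (j + 1) j (markTape W (examine W j m))) := by
    have := does_step1 (w := W) (r := rg (evalRes W m₁) ch' false) (i := j + 1) (h := j)
      (t := markTape W m₂) (r' := rg none ch' false) (mi := .stay) (mv := .stay)
      (x := some (.sign true, true))
      (f := fun r _ _ => ({r with res := none}, .stay, some (.sign true, true), .stay)) rfl
    rw [update_markTape m₂ hj, e2] at this
    simpa only [TM.moveInput, Move.toInt, add_zero] using this
  exact (h1.seq (h2.seq (h3.seq (h4.seq (h5.seq h6))))).mono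
    (by unfold examineTime; nlinarith [hjl])

/-- Move the input head back to the left end. -/
def rewindInput : SProg :=
  .seq (moves .left .stay) (.loop (cond fun _ a _ => a.isSome) (moves .left .stay))

theorem isSome_readInput {k : ℕ} (hk : k < W.length) : (TM.readInput W (k + 1)).isSome = true := by
  simp [TM.readInput, hk]

theorem readInput_length : TM.readInput W (W.length + 1) = none := by
  simp [TM.readInput]

theorem does_rewindInput {h : ℤ} {t : ℤ → Mark} : Does W rewindInput (2 * W.length + 2)
    (St r (W.length + 1) h t) (St r 0 h t) := by
  have h1 := does_moves (w := W) (r := r) (i := W.length + 1) (h := h) (t := t) .left .stay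
  have h2 := Does.loop (w := W) (p := moves .left .stay) (c := fun _ a _ => a.isSome) W.length 1
    (fun _ => r) (fun k => W.length - k) (fun _ => h) (fun _ => t)
    (fun k hk => by
      rw [show W.length - k = W.length - k - 1 + 1 by omega]
      exact isSome_readInput (by omega))
    (fun k hk => by
      have := does_moves (w := W) (r := r) (i := W.length - k) (h := h) (t := t) .left .stay
      simpa only [TM.moveInput, Move.toInt, add_zero, Nat.sub_sub] using this)
    (by
      rw [Nat.sub_self]
      rfl)
  simp only [TM.moveInput, Move.toInt, add_zero, Nat.add_sub_cancel] at h1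
  rw [Nat.sub_self, Nat.sub_zero] at h2
  exact (h1.seq h2).mono (by omega)

/-- Examine all positive literals. -/
def roundP : SProg :=
  .seq (step1 fun r _ x => ({r with changed := false}, .right, x, .stay)) <|
  .seq (.loop (cond fun _ a _ => a.isSome)
    (.seq (.ite (cond fun _ a _ => decide (a = some (.sign true))) examineP (moves .stay .stay))
      (moves .right .right))) <|
  .seq rewindTape rewindInput

/-- The time for `roundP`. -/
def roundTime (n : ℕ) : ℕ :=
  1 + ((n * (examineTime n + 1 + 1 + 1) + 1) + ((2 * n + 3) + (2 * n + 2)))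

open Classical in
theorem does_roundP (hW : SignsOfLits W) (hm : PosTrue W m) :
    Does W roundP (roundTime W.length) (St (rg none ch false) 0 0 (markTape W m))
      (St (rg none (decide (round W m ≠ m)) false) 0 0 (markTape W (round W m))) := by
  have h1 : Does W (step1 fun r _ x => ({r with changed := false}, .right, x, .stay)) 1
      (St (rg none ch false) 0 0 (markTape W m))
      (St (rg none false false) (0 + 1) (0 : ℕ) (markTape W m)) := by
    have := does_step1 (w := W) (r := rg none ch false) (i := 0) (h := 0)
      (t := markTape W m) (r' := rg none false false) (mi := .right) (mv := .stay)
      (x := markTape W m 0) (f := fun r _ x => ({r with changed := false}, .right, x, .stay)) rfl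
    simp only [TM.moveInput, Move.toInt, add_zero, Function.update_eq_self] at this
    rw [min_eq_left (by omega)] at this
    exact this
  have h2 := Does.loop (w := W) (p := .seq (.ite (cond fun _ a _ => decide (a = some (.sign true)))
      examineP (moves .stay .stay)) (moves .right .right)) (c := fun _ a _ => a.isSome) W.length
    (examineTime W.length + 1 + 1)
    (fun k => rg none (decide (marksAt W m k ≠ m)) false) (fun k => k + 1) (fun k => (k : ℤ))
    (fun k => markTape W (marksAt W m k))
    (fun k hk => isSome_readInput hk)
    (fun k hk => by
      have h1 : Does W (.ite (cond fun _ a _ => decide (a = some (.sign true))) examineP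
          (moves .stay .stay)) (examineTime W.length + 1)
          (St (rg none (decide (marksAt W m k ≠ m)) false) (k + 1) k
            (markTape W (marksAt W m k)))
          (St (rg none (decide (marksAt W m (k + 1) ≠ m)) false) (k + 1) k
            (markTape W (marksAt W m (k + 1)))) := by
        apply Does.ite
        by_cases hc : W[k]? = some (.sign true)
        · rw [if_pos (by simp [TM.readInput, hc])]
          have := does_examineP (ch := decide (marksAt W m k ≠ m)) hW (hm.marksAt k) hc
          rw [← Bool.decide_or] at this
          -- Since marks only decrease, a later examination cannot undo an earlier change; the flag
          -- thus compares the marks with those at the start of the round.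
          have hiff : (marksAt W m k ≠ m ∨ examine W k (marksAt W m k) ≠ marksAt W m k) ↔
              marksAt W m (k + 1) ≠ m := by
            rw [← not_iff_not]
            push Not
            constructor
            · rintro ⟨h1, h2⟩
              rw [marksAt, h2, h1]
            · intro h1
              have h2 : marksAt W m k = m :=
                le_antisymm (marksAt_le k) (h1.symm.le.trans (marksAt_anti (Nat.le_succ k)))
              exact ⟨h2, by rw [← marksAt, h1, h2]⟩
          rw [decide_eq_decide.2 hiff] at this
          exact this
        · rw [if_neg (by simp [TM.readInput, hc])]
          have hex : marksAt W m (k + 1) = marksAt W m k := by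
            rw [marksAt, examine, if_neg fun h => hc h.1]
          rw [hex]
          have := does_moves (w := W) (r := rg none (decide (marksAt W m k ≠ m)) false)
            (i := k + 1) (h := k) (t := markTape W (marksAt W m k)) .stay .stay
          simp only [TM.moveInput, Move.toInt, add_zero] at this
          exact this.mono (by unfold examineTime; omega)
      have h2 := does_moves (w := W) (r := rg none (decide (marksAt W m (k + 1) ≠ m)) false)
        (i := k + 1) (h := k) (t := markTape W (marksAt W m (k + 1))) .right .right
      simp only [TM.moveInput, Move.toInt] at h2
      rw [min_eq_left (by omega)] at h2
      exact_mod_cast h1.seq h2)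
    (by rw [readInput_length]; rfl)
  have h3 := does_rewindTape (w := W) (r := rg none (decide (round W m ≠ m)) false)
    (i := W.length + 1) W (round W m) W.length le_rfl
  have h4 := does_rewindInput (W := W) (r := rg none (decide (round W m ≠ m)) false) (h := 0)
    (t := markTape W (round W m))
  have h0 : decide (marksAt W m 0 ≠ m) = false := by simp [marksAt]
  rw [h0] at h2
  exact h1.seq (h2.seq (h3.seq h4))

end Sat

/-! ### Horn-NNF satisfiability is in P -/

namespace Sat

open NNF Prog

variable {W : List Symb} {r : Reg}

/-- Copy the input to the first work tape, with all literals marked as true. -/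
def copyP : SProg :=
  .seq (moves .right .stay) <|
  .seq (.loop (cond fun _ a _ => a.isSome)
    (step1 fun r a _ => (r, .right, a.map fun a => (a, true), .right))) <|
  .seq rewindTape rewindInput

theorem update_markTape_take (m : ℕ → Bool) {k : ℕ} {a : Symb} (hk : W[k]? = some a) :
    Function.update (markTape (W.take k) m) k (some (a, m k)) = markTape (W.take (k + 1)) m := by
  funext z
  by_cases hz : z = k
  · subst hz
    rw [Function.update_self, markTape_nat, List.getElem?_take_of_lt (by omega), hk]
    rfl
  · rw [Function.update_of_ne hz]
    unfold markTape
    split_ifs with h0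
    · rw [List.getElem?_take, List.getElem?_take]
      have : (z.toNat < k) = (z.toNat < k + 1) := by
        rw [eq_iff_iff]
        omega
      simp only [this]
    · rfl

theorem does_copyP : Does W copyP (6 * W.length + 7) (St r 0 0 fun _ => none)
    (St r 0 0 (markTape W fun _ => true)) := by
  have h1 := does_moves (w := W) (r := r) (i := 0) (h := 0) (t := fun _ => none) .right .stay
  have h2 := Does.loop (w := W) (p := step1 fun r a _ => (r, .right, a.map fun a => (a, true),
      .right)) (c := fun _ a _ => a.isSome) W.length 1
    (fun _ => r) (fun k => k + 1) (fun k => (k : ℤ))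
    (fun k => markTape (W.take k) fun _ => true)
    (fun k hk => isSome_readInput hk)
    (fun k hk => by
      have := does_step1 (w := W) (r := r) (i := k + 1) (h := k)
        (t := markTape (W.take k) fun _ => true) (r' := r) (mi := .right) (mv := .right)
        (x := some (W[k], true)) (f := fun r a _ => (r, .right, a.map fun a => (a, true), .right))
        (by simp [TM.readInput, hk])
      rw [update_markTape_take (fun _ => true) (List.getElem?_eq_getElem hk)] at this
      simp only [TM.moveInput, Move.toInt] at this
      rw [min_eq_left (by omega)] at this
      exact_mod_cast this)
    (by rw [readInput_length]; rfl)
  have h3 := does_rewindTape (w := W) (r := r) (i := W.length + 1) W (fun _ => true) W.length le_rfl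
  have h4 := does_rewindInput (W := W) (r := r) (h := 0) (t := markTape W fun _ => true)
  have h0 : markTape (W.take 0) (fun _ => true) = fun _ => none := by
    funext z
    simp [markTape]
  rw [h0, List.take_length] at h2
  simp only [TM.moveInput, Move.toInt, add_zero] at h1
  rw [min_eq_left (by omega)] at h1
  exact (h1.seq (h2.seq (h3.seq h4))).mono (by omega)

/-- The decision procedure. -/
def satP : SProg :=
  .seq copyP <| .seq evalP <|
  .ite (cond fun r _ _ => r.res.isSome)
    (.seq (step1 fun r _ x => ({r with res := none, changed := true}, .stay, x, .stay)) <|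
      .seq (.loop (cond fun r _ _ => r.changed) roundP) evalP)
    (moves .stay .stay)

/-- The time for `satP`. -/
def satTime (n : ℕ) : ℕ :=
  (6 * n + 7) + ((5 * n + 6) +
    (1 + (((n + 1) * (roundTime n + 1) + 1) + (5 * n + 6)) + 1))

theorem posTrue_iterate (k : ℕ) : PosTrue W ((round W)^[k] fun _ => true) := by
  induction k with
  | zero => exact fun _ _ => rfl
  | succ k ih =>
    rw [Function.iterate_succ_apply']
    exact ih.marksAt _

/-- The first evaluation only checks that the input is the code of a Horn-NNF formula. Then rounds
are repeated until one changes nothing, and the value under the final marks is the answer. -/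
theorem does_satP : Does W satP (satTime W.length) (St (rg none false false) 0 0 fun _ => none)
    (fun m => m.reg.res = some true ↔ W ∈ HNFSAT) := by
  classical
  refine does_copyP.seq ((does_evalP W _ none false false 0).seq (Does.ite ?_))
  set m₀ : ℕ → Bool := fun _ => true with hm₀
  cases hres : evalRes W m₀ with
  | none =>
    rw [if_neg (by simp [rg])]
    rintro m hm
    obtain ⟨m', h1, h₂, t₂, rfl⟩ := does_moves (w := W) .stay .stay m hm
    refine ⟨_, h1.mono (by omega), ?_⟩
    simp only [mem2, rg, reduceCtorEq, false_iff]
    rintro ⟨φ, hφ, -, rfl⟩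
    rw [evalRes_encode φ hφ] at hres
    cases hres
  | some b =>
    rw [if_pos (by simp [rg])]
    obtain ⟨φ, hφ, rfl⟩ := exists_of_evalRes hres
    have hW := signsOfLits_encode φ
    obtain ⟨K, hK, hfix, hmin⟩ := exists_iterate_round φ.encode m₀
    set μ : ℕ → ℕ → Bool := fun k => (Sat.round φ.encode)^[k] m₀ with hμ
    -- The flag before round `k`; it is set artificially at the beginning so that the loop is
    -- entered.
    set c : ℕ → Bool := fun k => match k with
      | 0 => true
      | k + 1 => decide (μ (k + 1) ≠ μ k) with hc
    have h1 : Does φ.encode (step1 fun r _ x => ({r with res := none, changed := true}, .stay, x,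
        .stay)) 1 (St (rg (some b) false false) 0 0 (markTape φ.encode m₀))
        (St (rg none (c 0) false) 0 0 (markTape φ.encode (μ 0))) := by
      have := does_step1 (w := φ.encode) (r := rg (some b) false false) (i := 0) (h := 0)
        (t := markTape φ.encode m₀) (r' := rg none true false) (mi := .stay) (mv := .stay)
        (x := markTape φ.encode m₀ 0)
        (f := fun r _ x => ({r with res := none, changed := true}, .stay, x, .stay)) rfl
      simp only [TM.moveInput, Move.toInt, add_zero, Function.update_eq_self] at this
      exact this
    -- There are `K` effective rounds, and one more that finds no change.
    have h2 := Does.loop (w := φ.encode) (p := roundP) (c := fun r _ _ => r.changed) (K + 1)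
      (roundTime φ.encode.length) (fun k => rg none (c k) false) (fun _ => 0) (fun _ => 0)
      (fun k => markTape φ.encode (μ k))
      (fun k hk => by
        cases k with
        | zero => rfl
        | succ k => exact decide_eq_true (hmin k (by omega)))
      (fun k hk => by
        have := does_roundP (ch := c k) hW (posTrue_iterate (W := φ.encode) k)
        have e : μ (k + 1) = Sat.round φ.encode (μ k) := Function.iterate_succ_apply' _ _ _
        change Does _ _ _ _ (St (rg none (decide (μ (k + 1) ≠ μ k)) false) 0 0
          (markTape φ.encode (μ (k + 1))))
        rw [e]
        exact this)
      (decide_eq_false (not_not_intro hfix))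
    have h3 := does_evalP (w := φ.encode) φ.encode (μ (K + 1)) none (c (K + 1)) false 0
    have hT : (K + 1) * (roundTime φ.encode.length + 1) + 1 ≤
        (φ.encode.length + 1) * (roundTime φ.encode.length + 1) + 1 := by
      gcongr
    refine (h1.seq ((h2.mono hT).seq h3)).imp (fun _ h => h) ?_
    rintro _ ⟨h₂, t₂, rfl⟩
    have hsound : ∀ k, φ.SoundMarks (μ k) := by
      intro k
      induction k with
      | zero => exact soundMarks_true φ
      | succ k ih =>
        simp only [hμ, Function.iterate_succ_apply']
        exact SoundMarks.round hφ ih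
    have hr : Sat.round φ.encode (μ (K + 1)) = μ (K + 1) := by
      have e : μ (K + 1) = μ K := hfix
      rw [e]
      simpa only [hμ, Function.iterate_succ_apply'] using hfix
    have hsat := satisfiable_iff_of_round_eq hφ (hsound (K + 1)) hr
    change evalRes φ.encode (μ (K + 1)) = some true ↔ _
    rw [← hsat]
    constructor
    · exact fun h => ⟨φ, hφ, h, rfl⟩
    · rintro ⟨ψ, -, h, he⟩
      rwa [← encode_injective he]

theorem exists_poly_satTime : ∃ p : Polynomial ℕ, ∀ n, p.eval n = satTime n := by
  open Polynomial in
  let s : ℕ[X] := X * (6 * X + 15) + 1 + (2 * X + 3)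
  open Polynomial in
  let e : ℕ[X] := 1 + ((2 * X + 3) + ((5 * X + 6) + (s + 1 + ((X * 2 + 1) + 1))))
  open Polynomial in
  let r : ℕ[X] := 1 + ((X * (e + 1 + 1 + 1) + 1) + ((2 * X + 3) + (2 * X + 2)))
  open Polynomial in
  refine ⟨(6 * X + 7) + ((5 * X + 6) + (1 + (((X + 1) * (r + 1) + 1) + (5 * X + 6)) + 1)),
    fun n => ?_⟩
  simp [s, e, r, satTime, roundTime, examineTime, strikeTime]

theorem inP_HNFSAT : InP HNFSAT := by
  obtain ⟨p, hp⟩ := exists_poly_satTime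
  refine ⟨satP.toTM (rg none false false) (none, bottom) {r | r.res = some true}, p, fun w => ?_⟩
  obtain ⟨m, h, hm⟩ := does_satP (W := w) (start (rg none false false) (none, bottom)) ⟨0,
    fun _ => bottom, by
      simp only [start, mem2, Mem.mk.injEq, true_and, and_true]
      constructor
      · funext b
        cases b <;> rfl
      · funext b z
        cases b <;> rfl⟩
  beta_reduce
  rw [hp, h.cfgAt]
  exact ⟨halted_cfg, hm⟩

end Sat

theorem mainTheorem3 : PComplete HNFSAT :=
  ⟨Sat.inP_HNFSAT, fun _ _ _ hL => Prog.logSpaceReducible_HNFSAT hL⟩
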